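/- **Setting.** Let $n\ge 0$, $\mu\ge1$, $N\ge0$ be integers, $\vec a(0),\dots,\vec a(N)\in\mathbb C^T$. Let $\vec\xi$ be a $T$-dimensional sequence whose $n$th increments $\vec\xi^{(n)}(m,\nu)=\sum_{l=0}^n(-1)^l\binom nl\vec\xi(m-l\nu)$ are stationary with mean zero and spectral density $f$, and $\vec\eta$ a stationary mean-zero sequence with spectral density $g$, uncorrelated with the increments of $\vec\xi$; that is, $$E\,\xi^{(n)}_p(m_0+m,\nu_1)\overline{\xi^{(n)}_q(m_0,\nu_2)}=\frac1{2\pi}\int_{-\pi}^{\pi}e^{i\lambda m}(1-e^{-i\nu_1\lambda})^n(1-e^{i\nu_2\lambda})^n\lambda^{-2n}f_{pq}(\lambda)\,d\lambda,\qquad E\,\eta_p(m_0+m)\overline{\eta_q(m_0)}=\frac1{2\pi}\int_{-\pi}^{\pi}e^{i\lambda m}g_{pq}(\lambda)\,d\lambda .$$ Spectral densities are integrable, a.e. positive semidefinite Hermitian $T\times T$ matrix functions on $[-\pi,\pi)$. Put $\vec\zeta=\vec\xi+\vec\eta$, $p=f+\lambda^{2n}g$, $\chi(\lambda)=(1-e^{-i\lambda\mu})^n/(i\lambda)^n$,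 $w(\lambda)=\lambda^{2n}/|1-e^{i\lambda\mu}|^{2n}$, $\vec A(\lambda)=\sum_{k=0}^N\vec a(k)e^{i\lambda k}$. Let $\sum_k d_\mu(k)x^k=(\sum_j x^{\mu j})^n$, $\vec b(k)=\sum_{m=k}^N d_\mu(m-k)\vec a(m)$ for $k\le N$, $\vec b(k)=0$ for $N<k\le N+\mu n$, $\vec B(\lambda)=\sum_{k=0}^N\vec b(k)e^{i\lambda k}$, and $\vec a_\mu(m)=\sum_l(-1)^l\binom nl\vec a(m-\mu l)$, the sum over $0\le l\le n$ with $0\le m-\mu l\le N$, for $0\le m\le N+\mu n$. **Estimates.** Let $L(f,g)$ be the closed linear span, in the space $L_2(p)$ with squared norm $\int h^\top p\,\bar h\,d\lambda$, of the functions $e^{i\lambda k}\chi(\lambda)\delta_l$ with $1\le l\le T$ and $k\le-1$ or $k\ge N+\mu n+1$. The functional $A_N\vec\xi=\sum_{k=0}^N\vec a(k)^\top\vec\xi(k)$ is estimated from the values $\vec\zeta(m)$, $m\notin\{0,\dots,N\}$, by $\widehat A=Y-\sum_{k=-\mu n}^{-1}\vec v(k)^\top\vec\zeta(k)$, where $\vec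 v(k)=\sum_l(-1)^l\binom nl\vec b(l\mu+k)$, over $0\le l\le n$ with $0\le l\mu+k\le N$, and $Y$ is the random variable with spectral characteristic $h\in L(f,g)$: the limit of finite combinations $\sum_k c(k)^\top\vec\zeta^{(n)}(k,\mu)$, $k\le-1$ or $k\ge N+\mu n+1$, for which $\chi\sum_k c(k)e^{i\lambda k}\to h$ in $L_2(p)$. Let $$\Delta(h;f,g)=\frac1{2\pi}\int_{-\pi}^{\pi}u^\top f\,\bar u\,d\lambda+\frac1{2\pi}\int_{-\pi}^{\pi}\big((i\lambda)^nu-\vec A\big)^\top g\,\overline{\big((i\lambda)^nu-\vec A\big)}\,d\lambda,\qquad u=\chi\vec B-h,$$ and $\Delta(f,g)=\inf_{h\in L(f,g)}\Delta(h;f,g)$. The pair $(f,g)$ satisfies the minimality condition if $p$ is invertible a.e. and $\int_{-\pi}^{\pi}\mathrm{Tr}[w\,p^{-1}]\,d\lambda<\infty$. **Error expression.** For such a pair let $\mathbf P,\mathbf T$ (with $0\le j,k\le N+\mu n$) and $\mathbf Q$ (with $0\le j,k\le N$) be the block matrices with $T\times T$ blocks $\frac1{2\pi}\int_{-\pi}^{\pi}e^{i\lambda(k-j)}M(\lambda)^\top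 d\lambda$, where $M=w\,p^{-1}$, $M=w\,g\,p^{-1}$, $M=f\,p^{-1}g$ respectively. The vector $\mathbf T\mathbf a_\mu$ has the components $\frac1{2\pi}\int_{-\pi}^{\pi} e^{-i\lambda j}\,w\,(g\,p^{-1})^\top\sum_m\vec a_\mu(m)e^{i\lambda m}\,d\lambda$ (which exist even if entries of $\mathbf T$ diverge). With $\mathbf b=(\vec b(0),\dots,\vec b(N+\mu n))$, $\mathbf c=\mathbf P^{-1}(\mathbf b-\mathbf T\mathbf a_\mu)$, $\langle x,y\rangle=\sum x\bar y$, $\mathbf a=(\vec a(0),\dots,\vec a(N))$, put $$\mathcal E(f,g)=\langle\mathbf b-\mathbf T\mathbf a_\mu,\mathbf c\rangle+\langle\mathbf Q\mathbf a,\mathbf a\rangle,$$ $$h_{\mu,N}(f,g)^\top=\vec B^\top\chi-(-i\lambda)^n\vec A^\top g\,p^{-1}-\frac{(-i\lambda)^n}{(1-e^{i\lambda\mu})^n}\Big(\sum_{k=0}^{N+\mu n}\vec c(k)e^{i\lambda k}\Big)^{\!\top}p^{-1}.$$ **Lemma.** Let $\mathcal D_f,\mathcal D_g$ be sets of spectral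 densities, and let $f^0\in\mathcal D_f$, $g^0\in\mathcal D_g$ satisfy the minimality condition and solve the problem $$\mathcal E(f^0,g^0)=\max\{\mathcal E(f,g): f\in\mathcal D_f,\ g\in\mathcal D_g,\ (f,g)\text{ satisfies the minimality condition}\}.$$ Then: 1. For all $f\in\mathcal D_f$, $g\in\mathcal D_g$, all sequences $\vec\xi,\vec\eta$ as above on a probability space and each estimate $\widehat A$ with characteristic $h\in L(f,g)$, $E|A_N\vec\xi-\widehat A|^2=\Delta(h;f,g)$. 2. $h^0=h_{\mu,N}(f^0,g^0)$ lies in $L(f^0,g^0)$ and $\Delta(h^0;f^0,g^0)=\Delta(f^0,g^0)$. 3. If either all pairs in $\mathcal D_f\times\mathcal D_g$ satisfy the minimality condition, or $\mathcal D_f$ and $\mathcal D_g$ are convex, then $(f^0,g^0)$ is least favorable: $\Delta(f,g)\le\Delta(f^0,g^0)$ for all $f\in\mathcal D_f$, $g\in\mathcal D_g$. 4. If $\mathcal D_f$ and $\mathcal D_g$ are convex and $h^0\in H_{\mathcal D}=\bigcap_{f\in\mathcal D_f,\,g\in\mathcal D_g}L(f,g)$, then $h^0$ is minimax-robust: $\Delta(h^0;\cdot,\cdot)$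 attains its maximum over $\mathcal D_f\times\mathcal D_g$, and $$\max_{\mathcal D_f\times\mathcal D_g}\Delta(h^0;f,g)=\min_{h\in H_{\mathcal D}}\ \sup_{\mathcal D_f\times\mathcal D_g}\Delta(h;f,g).$$ -/

import Mathlib

open MeasureTheory
open scoped ComplexOrder

noncomputable section

namespace PeriodicIncrements

variable {T : ℕ}

/-- Lebesgue measure on the frequency interval `[-π, π)`. -/
def freq : Measure ℝ := volume.restrict (Set.Ico (-Real.pi) Real.pi)

/-- The normalised frequency integral `(1 / 2π) ∫_{-π}^{π} F(x) dx`. -/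
def avg (F : ℝ → ℂ) : ℂ := (1 / (2 * (Real.pi : ℂ))) * ∫ x, F x ∂freq

/-- The normalised frequency integral of an extended nonnegative function. -/
def lavg (F : ℝ → ENNReal) : ENNReal := ENNReal.ofReal (1 / (2 * Real.pi)) * ∫⁻ x, F x ∂freq

/-- The exponential `e^{i k x}`. -/
def ex (k : ℤ) (x : ℝ) : ℂ := Complex.exp (Complex.I * ((k : ℂ) * (x : ℂ)))

/-- The hermitian form `vᵀ M v̄`. -/
def quad (M : Matrix (Fin T) (Fin T) ℂ) (v : Fin T → ℂ) : ℝ :=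
  (dotProduct v (M.mulVec (star v))).re

/-- A spectral density: a matrix function on `[-π, π)` with integrable entries and
positive semidefinite (hermitian) values almost everywhere. -/
structure IsSpectralDensity (f : ℝ → Matrix (Fin T) (Fin T) ℂ) : Prop where
  posSemidef : ∀ᵐ x ∂freq, (f x).PosSemidef
  integrable : ∀ p q, Integrable (fun x => f x p q) freq

/-- The spectral density `p(x) = f(x) + x^{2n} g(x)` of the observed sequence. -/
def dens (n : ℕ) (f g : ℝ → Matrix (Fin T) (Fin T) ℂ) (x : ℝ) : Matrix (Fin T) (Fin T) ℂ :=
  f x + ((x : ℂ) ^ (2 * n)) • g x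

/-- The transfer function `(1 - e^{-i x μ})^n / (i x)^n` of the `n`th increment of step `μ`. -/
def chi (n μ : ℕ) (x : ℝ) : ℂ := (1 - ex (-(μ : ℤ)) x) ^ n / (Complex.I * (x : ℂ)) ^ n

/-- The weight `x^{2n} / |1 - e^{i x μ}|^{2n}`. -/
def weight (n μ : ℕ) (x : ℝ) : ℝ := x ^ (2 * n) / ‖1 - ex (μ : ℤ) x‖ ^ (2 * n)

/-- The minimality condition: `p` is invertible almost everywhere and
`∫ Tr [x^{2n} / |1 - e^{i x μ}|^{2n} p(x)⁻¹] dx < ∞`. -/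
def Minimality (n μ : ℕ) (f g : ℝ → Matrix (Fin T) (Fin T) ℂ) : Prop :=
  (∀ᵐ x ∂freq, IsUnit (dens n f g x).det) ∧
    Integrable (fun x => (((weight n μ x : ℝ) : ℂ) • (dens n f g x)⁻¹).trace) freq

/-! ### Coefficients of the functional -/

/-- The numbers `d_μ(k)`, given by `∑ d_μ(k) X^k = (∑ X^{μ j})^n`. -/
def dCoeff (n μ k : ℕ) : ℂ :=
  PowerSeries.coeff k ((PowerSeries.mk fun j => if μ ∣ j then (1 : ℂ) else 0) ^ n)

/-- `b(k) = ∑_{m=k}^{N} d_μ(m-k) a(m)` for `k ≤ N`, and `b(k) = 0` for `k > N`; so `b` restricted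
to `0, …, N + μ n` is the vector `D a` extended by zeros. -/
def bCoeff (n μ N : ℕ) (a : ℕ → Fin T → ℂ) (k : ℕ) : Fin T → ℂ :=
  ∑ m ∈ Finset.Icc k N, dCoeff n μ (m - k) • a m

/-- `a_μ(m) = ∑_l (-1)^l (n choose l) a(m - μ l)`, over the `0 ≤ l ≤ n` with
`0 ≤ m - μ l ≤ N`. -/
def aCoeff (n μ N : ℕ) (a : ℕ → Fin T → ℂ) (m : ℕ) : Fin T → ℂ :=
  ∑ l ∈ (Finset.range (n + 1)).filter (fun l => μ * l ≤ m ∧ m ≤ N + μ * l),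
    ((-1 : ℂ) ^ l * (n.choose l : ℂ)) • a (m - μ * l)

/-- `v(-k) = ∑_l (-1)^l (n choose l) b(l μ - k)`, over the `0 ≤ l ≤ n` with
`0 ≤ l μ - k ≤ N`, for `k = 1, …, μ n`. -/
def vCoeff (n μ N : ℕ) (a : ℕ → Fin T → ℂ) (k : ℕ) : Fin T → ℂ :=
  ∑ l ∈ (Finset.range (n + 1)).filter (fun l => k ≤ l * μ ∧ l * μ ≤ N + k),
    ((-1 : ℂ) ^ l * (n.choose l : ℂ)) • bCoeff n μ N a (l * μ - k)

/-- The vector trigonometric polynomial `∑_{k=0}^{K} u(k) e^{i k x}`. -/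
def poly (K : ℕ) (u : ℕ → Fin T → ℂ) (x : ℝ) : Fin T → ℂ :=
  ∑ k ∈ Finset.range (K + 1), ex (k : ℤ) x • u k

/-! ### Spectral characteristics and mean-square errors -/

/-- The indices `k` of the increments `ζ^{(n)}(k, μ)` that involve only the observed values
`ζ(m)`, `m < 0`, or only the observed values `ζ(m)`, `m > N`. -/
def obs (n μ N : ℕ) : Set ℤ := {k | k ≤ -1 ∨ (N : ℤ) + μ * n + 1 ≤ k}

/-- The spectral characteristic `(1 - e^{-i x μ})^n / (i x)^n ∑_k c(k) e^{i k x}` of the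
finite combination `∑_k c(k)ᵀ ζ^{(n)}(k, μ)`. -/
def finChar (n μ : ℕ) (c : ℤ →₀ (Fin T → ℂ)) (x : ℝ) : Fin T → ℂ :=
  chi n μ x • c.sum fun k v => ex k x • v

/-- The squared norm of `L₂(p)`: `∫ h(x)ᵀ p(x) h̄(x) dx`. -/
def sqNorm (p : ℝ → Matrix (Fin T) (Fin T) ℂ) (h : ℝ → Fin T → ℂ) : ENNReal :=
  ∫⁻ x, ENNReal.ofReal (quad (p x) (h x)) ∂freq

/-- The space of spectral characteristics: the closed linear span in `L₂(f + x^{2n} g)` of the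
functions `e^{i k x} (1 - e^{-i x μ})^n / (i x)^n δ_l`, where `k ≤ -1` or `k ≥ N + μ n + 1`. -/
def charSpace (n μ N : ℕ) (f g : ℝ → Matrix (Fin T) (Fin T) ℂ) : Set (ℝ → Fin T → ℂ) :=
  {h | AEMeasurable h freq ∧ ∀ ε : ENNReal, 0 < ε → ∃ c : ℤ →₀ (Fin T → ℂ),
    (c.support : Set ℤ) ⊆ obs n μ N ∧ sqNorm (dens n f g) (h - finChar n μ c) < ε}

/-- The mean-square error `Δ(h; f, g)` of the estimate with spectral characteristic `h`. The
estimation error is `∫ (B χ - h)ᵀ dZ_ξ + ∫ ((i x)^n (B χ - h) - A)ᵀ dZ_η`, with `A` and `B` the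
trigonometric polynomials with coefficients `a` and `b`, and `Z_ξ`, `Z_η` the uncorrelated
spectral processes of the increments of `ξ` and of `η`. -/
def mse (n μ N : ℕ) (a : ℕ → Fin T → ℂ) (h : ℝ → Fin T → ℂ)
    (f g : ℝ → Matrix (Fin T) (Fin T) ℂ) : ENNReal :=
  lavg (fun x => ENNReal.ofReal
    (quad (f x) (chi n μ x • poly N (bCoeff n μ N a) x - h x))) +
  lavg (fun x => ENNReal.ofReal
    (quad (g x) ((Complex.I * (x : ℂ)) ^ n • (chi n μ x • poly N (bCoeff n μ N a) x - h x)
      - poly N a x)))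

/-- The error `Δ(f, g)` of the optimal linear estimate. -/
def optError (n μ N : ℕ) (a : ℕ → Fin T → ℂ) (f g : ℝ → Matrix (Fin T) (Fin T) ℂ) : ENNReal :=
  ⨅ h ∈ charSpace n μ N f g, mse n μ N a h f g

/-- `h` is the spectral characteristic of the optimal linear estimate under `(f, g)`. -/
def IsOptimal (n μ N : ℕ) (a : ℕ → Fin T → ℂ) (f g : ℝ → Matrix (Fin T) (Fin T) ℂ)
    (h : ℝ → Fin T → ℂ) : Prop :=
  h ∈ charSpace n μ N f g ∧ mse n μ N a h f g = optError n μ N a f g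

/-- `(f₀, g₀)` is least favorable in `Df × Dg`. -/
def LeastFavorable (n μ N : ℕ) (a : ℕ → Fin T → ℂ) (Df Dg : Set (ℝ → Matrix (Fin T) (Fin T) ℂ))
    (f₀ g₀ : ℝ → Matrix (Fin T) (Fin T) ℂ) : Prop :=
  f₀ ∈ Df ∧ g₀ ∈ Dg ∧
    ∀ f ∈ Df, ∀ g ∈ Dg, optError n μ N a f g ≤ optError n μ N a f₀ g₀

/-- The set `H_D` of characteristics that are admissible for all pairs of the class. -/
def robustSpace (n μ N : ℕ) (Df Dg : Set (ℝ → Matrix (Fin T) (Fin T) ℂ)) :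
    Set (ℝ → Fin T → ℂ) :=
  {h | ∀ f ∈ Df, ∀ g ∈ Dg, h ∈ charSpace n μ N f g}

/-- `h₀` is minimax-robust: it lies in `H_D`, its maximal error over `Df × Dg` is attained, and
no `h ∈ H_D` has a smaller maximal (supremal) error. -/
def MinimaxRobust (n μ N : ℕ) (a : ℕ → Fin T → ℂ) (Df Dg : Set (ℝ → Matrix (Fin T) (Fin T) ℂ))
    (h₀ : ℝ → Fin T → ℂ) : Prop :=
  h₀ ∈ robustSpace n μ N Df Dg ∧
  (∃ f₁ ∈ Df, ∃ g₁ ∈ Dg, ∀ f ∈ Df, ∀ g ∈ Dg, mse n μ N a h₀ f g ≤ mse n μ N a h₀ f₁ g₁) ∧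
  ∀ h ∈ robustSpace n μ N Df Dg,
    (⨆ f ∈ Df, ⨆ g ∈ Dg, mse n μ N a h₀ f g) ≤ ⨆ f ∈ Df, ⨆ g ∈ Dg, mse n μ N a h f g

/-! ### The matrices and the explicit formulas

The block with number `(j, k)` is the Fourier coefficient
`(1 / 2π) ∫ e^{i x (k - j)} M(x)ᵀ dx`, which is the matrix of the map that sends the coefficients
of a vector polynomial `u` to the Fourier coefficients of `u(x)ᵀ M(x)`. -/

/-- The matrix `P`, for `M = x^{2n} / |1 - e^{i x μ}|^{2n} p⁻¹`. -/
def PMat (n μ N : ℕ) (f g : ℝ → Matrix (Fin T) (Fin T) ℂ) :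
    Matrix (Fin (N + μ * n + 1) × Fin T) (Fin (N + μ * n + 1) × Fin T) ℂ :=
  fun i k => avg fun x => ex ((k.1 : ℤ) - (i.1 : ℤ)) x *
    ((weight n μ x : ℂ) * (dens n f g x)⁻¹ k.2 i.2)

/-- The matrix `T`, for `M = x^{2n} / |1 - e^{i x μ}|^{2n} g p⁻¹`. -/
def TMat (n μ N : ℕ) (f g : ℝ → Matrix (Fin T) (Fin T) ℂ) :
    Matrix (Fin (N + μ * n + 1) × Fin T) (Fin (N + μ * n + 1) × Fin T) ℂ :=
  fun i k => avg fun x => ex ((k.1 : ℤ) - (i.1 : ℤ)) x *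
    ((weight n μ x : ℂ) * (g x * (dens n f g x)⁻¹) k.2 i.2)

/-- The matrix `Q`, for `M = f p⁻¹ g`. -/
def QMat (n N : ℕ) (f g : ℝ → Matrix (Fin T) (Fin T) ℂ) :
    Matrix (Fin (N + 1) × Fin T) (Fin (N + 1) × Fin T) ℂ :=
  fun i k => avg fun x => ex ((k.1 : ℤ) - (i.1 : ℤ)) x *
    (f x * (dens n f g x)⁻¹ * g x) k.2 i.2

/-- The vector `T a_μ`, computed under one integral. The minimality condition makes this integral
converge, because `∑_m a_μ(m) e^{i m x} = (1 - e^{i x μ})^n A(e^{i x})`, while the entries of `T`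
may diverge one by one; where they converge, see `TVec_eq`. -/
def TVec (n μ N : ℕ) (a : ℕ → Fin T → ℂ) (f g : ℝ → Matrix (Fin T) (Fin T) ℂ) :
    Fin (N + μ * n + 1) × Fin T → ℂ :=
  fun i => avg fun x => ex (-(i.1 : ℤ)) x * ((weight n μ x : ℂ) *
    (Matrix.vecMul (poly (N + μ * n) (aCoeff n μ N a) x) (g x * (dens n f g x)⁻¹)) i.2)

/-- The vector `a_μ = (a_μ(0), …, a_μ(N + μ n))`. -/
def aVec (n μ N : ℕ) (a : ℕ → Fin T → ℂ) : Fin (N + μ * n + 1) × Fin T → ℂ :=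
  fun i => aCoeff n μ N a i.1 i.2

/-- Where the Fourier coefficients that form `T` exist, `TVec` is the product of `T` and `a_μ`. -/
theorem TVec_eq (n μ N : ℕ) (a : ℕ → Fin T → ℂ) (f g : ℝ → Matrix (Fin T) (Fin T) ℂ)
    (hT : ∀ p q : Fin T, ∀ k : ℤ, Integrable (fun x => ex k x *
      ((weight n μ x : ℂ) * (g x * (dens n f g x)⁻¹) p q)) freq) :
    TVec n μ N a f g = (TMat n μ N f g).mulVec (aVec n μ N a) := by
  funext i
  simp only [TVec, TMat, Matrix.mulVec, dotProduct, aVec, avg, mul_assoc]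
  rw [← Finset.mul_sum]
  congr 1
  simp only [← integral_mul_const]
  rw [← integral_finsetSum _ (fun k _ => (hT k.2 i.2 ((k.1 : ℤ) - (i.1 : ℤ))).mul_const _)]
  congr 1
  funext x
  have hex : ∀ k l : ℤ, ex (k - l) x = ex k x * ex (-l) x := by
    intro k l
    simp only [ex, ← Complex.exp_add]
    congr 1
    push_cast
    ring
  rw [Fintype.sum_prod_type, Finset.sum_comm]
  simp only [Matrix.vecMul, dotProduct, poly, Finset.sum_apply, Pi.smul_apply, smul_eq_mul,
    Finset.mul_sum, Finset.sum_mul]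
  refine Finset.sum_congr rfl fun q _ => ?_
  rw [Finset.sum_range]
  refine Finset.sum_congr rfl fun m _ => ?_
  rw [hex]
  ring

/-- The vector `[D a]` extended by zeros, minus `T a_μ`. -/
def rhsVec (n μ N : ℕ) (a : ℕ → Fin T → ℂ) (f g : ℝ → Matrix (Fin T) (Fin T) ℂ) :
    Fin (N + μ * n + 1) × Fin T → ℂ :=
  fun i => bCoeff n μ N a i.1 i.2 - TVec n μ N a f g i

/-- The coefficients `c = P⁻¹ [D a] - P⁻¹ T a_μ`. -/
def cVec (n μ N : ℕ) (a : ℕ → Fin T → ℂ) (f g : ℝ → Matrix (Fin T) (Fin T) ℂ) :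
    Fin (N + μ * n + 1) × Fin T → ℂ :=
  (PMat n μ N f g)⁻¹.mulVec (rhsVec n μ N a f g)

/-- The error expression
`⟨[D a] - T a_μ, P⁻¹ [D a] - P⁻¹ T a_μ⟩ + ⟨Q a, a⟩`, where `⟨u, v⟩ = ∑ u v̄`. -/
def errorExpr (n μ N : ℕ) (a : ℕ → Fin T → ℂ) (f g : ℝ → Matrix (Fin T) (Fin T) ℂ) : ℝ :=
  (dotProduct (rhsVec n μ N a f g) (star (cVec n μ N a f g))).re +
  (dotProduct ((QMat n N f g).mulVec fun i => a i.1 i.2)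
    (star fun i : Fin (N + 1) × Fin T => a i.1 i.2)).re

/-- The spectral characteristic
`hᵀ = Bᵀ (1 - e^{-i x μ})^n / (i x)^n - Aᵀ g (-i x)^n p⁻¹
  - (-i x)^n / (1 - e^{i x μ})^n Cᵀ p⁻¹`, with `C = ∑_k c(k) e^{i k x}`. -/
def specChar (n μ N : ℕ) (a : ℕ → Fin T → ℂ) (f g : ℝ → Matrix (Fin T) (Fin T) ℂ) (x : ℝ) :
    Fin T → ℂ :=
  chi n μ x • poly N (bCoeff n μ N a) x
  - (-Complex.I * (x : ℂ)) ^ n • Matrix.vecMul (poly N a x) (g x * (dens n f g x)⁻¹)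
  - ((-Complex.I * (x : ℂ)) ^ n / (1 - ex (μ : ℤ) x) ^ n) •
      Matrix.vecMul (∑ k : Fin (N + μ * n + 1), ex (k : ℤ) x • fun p => cVec n μ N a f g (k, p))
        (dens n f g x)⁻¹

/-! ### The stochastic sequences -/

/-- The `n`th increment `∑_l (-1)^l (n choose l) ξ_p(m - l ν)` of step `ν`. -/
def incr {Ω : Type*} (n : ℕ) (ξ : ℤ → Fin T → Ω → ℂ) (m ν : ℤ) (p : Fin T) (ω : Ω) : ℂ :=
  ∑ l ∈ Finset.range (n + 1), (-1 : ℂ) ^ l * (n.choose l : ℂ) * ξ (m - l * ν) p ω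

/-- `ξ` has stationary `n`th increments with mean zero and spectral density `f`, and `η` is
stationary with mean zero and spectral density `g`, uncorrelated with the increments of `ξ`. -/
structure IsModel {Ω : Type*} [MeasurableSpace Ω] (n : ℕ) (P : Measure Ω)
    (ξ η : ℤ → Fin T → Ω → ℂ) (f g : ℝ → Matrix (Fin T) (Fin T) ℂ) : Prop where
  aemeasurable : ∀ m p, AEMeasurable (ξ m p) P
  memLp_incr : ∀ m ν p, MemLp (incr n ξ m ν p) 2 P
  memLp_noise : ∀ m p, MemLp (η m p) 2 P
  mean_incr : ∀ m ν p, ∫ ω, incr n ξ m ν p ω ∂P = 0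
  mean_noise : ∀ m p, ∫ ω, η m p ω ∂P = 0
  cov_incr : ∀ m₀ m ν₁ ν₂ p q,
    ∫ ω, incr n ξ (m₀ + m) ν₁ p ω * star (incr n ξ m₀ ν₂ q ω) ∂P =
      avg fun x => ex m x * (1 - ex (-ν₁) x) ^ n * (1 - ex ν₂ x) ^ n
        * (1 / (x : ℂ) ^ (2 * n)) * f x p q
  cov_noise : ∀ m₀ m p q, ∫ ω, η (m₀ + m) p ω * star (η m₀ q ω) ∂P =
      avg fun x => ex m x * g x p q
  uncorrelated : ∀ m ν k p q, ∫ ω, incr n ξ m ν p ω * star (η k q ω) ∂P = 0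

/-- The functional `∑_{k=0}^{N} a(k)ᵀ ξ(k)`. -/
def functional {Ω : Type*} (N : ℕ) (a : ℕ → Fin T → ℂ) (ξ : ℤ → Fin T → Ω → ℂ) (ω : Ω) : ℂ :=
  ∑ k ∈ Finset.range (N + 1), ∑ p, a k p * ξ k p ω

/-- The functional `V ζ = ∑_{k=-μ n}^{-1} v(k)ᵀ ζ(k)` of the initial values. -/
def initFunctional {Ω : Type*} (n μ N : ℕ) (a : ℕ → Fin T → ℂ) (ζ : ℤ → Fin T → Ω → ℂ)
    (ω : Ω) : ℂ :=
  ∑ k ∈ Finset.Icc 1 (μ * n), ∑ p, vCoeff n μ N a k p * ζ (-(k : ℤ)) p ω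

/-- `Y` is the random variable `∫ hᵀ dZ` with spectral characteristic `h`: the pair `(h, Y)` is a
limit, in `L₂(f + x^{2n} g)` and in `L₂(P)`, of the pairs formed by a finite combination of
observed increments of `ζ` and its spectral characteristic. -/
def HasChar {Ω : Type*} [MeasurableSpace Ω] (n μ N : ℕ) (P : Measure Ω)
    (ζ : ℤ → Fin T → Ω → ℂ) (f g : ℝ → Matrix (Fin T) (Fin T) ℂ) (h : ℝ → Fin T → ℂ)
    (Y : Ω → ℂ) : Prop :=
  AEMeasurable h freq ∧ AEMeasurable Y P ∧ ∀ ε : ENNReal, 0 < ε → ∃ c : ℤ →₀ (Fin T → ℂ),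
    (c.support : Set ℤ) ⊆ obs n μ N ∧ sqNorm (dens n f g) (h - finChar n μ c) < ε ∧
    ∫⁻ ω, ‖Y ω - c.sum fun k v => ∑ p, v p * incr n ζ k μ p ω‖ₑ ^ 2 ∂P < ε

end PeriodicIncrements

end

noncomputable section

namespace PeriodicIncrements

variable {T : ℕ}

/-! Write `p` for the observed density and `u = B χ - h` for the residual of a characteristic `h`.
Completing the square pointwise turns the error into the squared `L₂(p)` distance of `u` from
`noiseResidual`, plus a term free of `h` (`errDensity_eq_sq`). Optimal estimation is thus an
orthogonal projection onto the space of characteristics.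

Minimality makes that space explicit. By Cauchy–Schwarz `|v_q|² ≤ (vᵀ p v̄) (p⁻¹)_{qq}`, and the
weight is `1 / |χ|²`; hence `h / χ` is integrable for `h` in `L₂(p)`, with Fourier coefficients
continuous in `h`. The generators are `χ` times exponentials outside the gap `0, …, N + μ n`, so the
gap coefficients of `h / χ` vanish on the whole space. Conversely, an element of `L₂(p)` orthogonal
to all generators becomes, after multiplication by `p` and `χ̄`, a trigonometric polynomial with gap
frequencies only; it is therefore orthogonal to every `h` with vanishing gap coefficients, and the
double orthogonal complement finishes the argument (`mem_charSpace_of_charCoef_eq_zero`).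

The system `P c = b - T a_μ` says exactly that the gap coefficients of `specChar` vanish
(`charCoef_specChar`), and the part `Cᵀ p⁻¹ / χ̄` of its residual is orthogonal to the space
(`integral_sesq_gapResidual`). Pythagoras (`mse_eq_add`) gives optimality, with excess error
proportional to `‖h⁰ - h‖²` in `L₂(p)`. Evaluating the minimum gives `optError_eq_errorExpr`.

For the minimax statements let `V` be the optimal error at the maximising pair. A mixture of that
pair, with weight `1 - t`, and an arbitrary pair, with weight `t`, dominates a multiple of the first
density; so it satisfies minimality even if the second pair does not, and its optimal error is at
most `V`. Its optimal characteristic is admissible for both pairs, and for a fixed characteristic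
the error is affine in the densities (`exists_mixture_char`). Since the error at the maximising pair
is at least `V`, the error at the other pair is at most `V`: the maximising pair is least favorable.
Pythagoras also forces these characteristics to converge to `h⁰` as `t → 0`, and Fatou's lemma
carries the bound `V` over to `h⁰` (`mse_specChar_le`). This is the saddle point inequality.

That `mse` is a genuine mean-square error rests on an isometry: covariances and spectral integrals
agree on generators, hence on spans (`integral_mul_star_eq_avg`). As `d_μ` inverts `(1 - X^μ)^n`,
the functional plus the initial-value correction is a combination of increments
(`sum_bCoeff_mul_incr`); the error then splits into uncorrelated signal and noise parts, and a limit
passes from finite combinations to all estimates. -/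

/-- The sesquilinear form `uᵀ M v̄`. -/
def sesq (M : Matrix (Fin T) (Fin T) ℂ) (u v : Fin T → ℂ) : ℂ :=
  dotProduct u (M.mulVec (star v))

/-! ### Hermitian forms and Cauchy–Schwarz inequalities for a single matrix. -/

section Pointwise

variable {M M' : Matrix (Fin T) (Fin T) ℂ} {u v w : Fin T → ℂ}

lemma quad_eq_sesq (M : Matrix (Fin T) (Fin T) ℂ) (v : Fin T → ℂ) : quad M v = (sesq M v v).re :=
  rfl

lemma sesq_add_left (M : Matrix (Fin T) (Fin T) ℂ) (u v w : Fin T → ℂ) :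
    sesq M (u + v) w = sesq M u w + sesq M v w := add_dotProduct _ _ _

lemma sesq_smul_left (M : Matrix (Fin T) (Fin T) ℂ) (c : ℂ) (u w : Fin T → ℂ) :
    sesq M (c • u) w = c * sesq M u w := smul_dotProduct _ _ _

lemma sesq_add_right (M : Matrix (Fin T) (Fin T) ℂ) (u v w : Fin T → ℂ) :
    sesq M u (v + w) = sesq M u v + sesq M u w := by
  simp [sesq, Matrix.mulVec_add, dotProduct_add]

lemma sesq_smul_right (M : Matrix (Fin T) (Fin T) ℂ) (c : ℂ) (u w : Fin T → ℂ) :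
    sesq M u (c • w) = star c * sesq M u w := by
  simp [sesq, Matrix.mulVec_smul, dotProduct_smul]

lemma sesq_neg_left (M : Matrix (Fin T) (Fin T) ℂ) (u w : Fin T → ℂ) :
    sesq M (-u) w = -sesq M u w := by
  simp [sesq]

lemma sesq_neg_right (M : Matrix (Fin T) (Fin T) ℂ) (u w : Fin T → ℂ) :
    sesq M u (-w) = -sesq M u w := by
  simp [sesq, Matrix.mulVec_neg]

lemma sesq_sub_right (M : Matrix (Fin T) (Fin T) ℂ) (u v w : Fin T → ℂ) :
    sesq M u (v - w) = sesq M u v - sesq M u w := by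
  simp [sesq, Matrix.mulVec_sub, dotProduct_sub]

@[simp] lemma sesq_zero_left (M : Matrix (Fin T) (Fin T) ℂ) (w : Fin T → ℂ) :
    sesq M 0 w = 0 := by
  simp [sesq]

@[simp] lemma sesq_zero_right (M : Matrix (Fin T) (Fin T) ℂ) (w : Fin T → ℂ) :
    sesq M w 0 = 0 := by
  simp [sesq]

lemma sesq_eq_vecMul (M : Matrix (Fin T) (Fin T) ℂ) (u v : Fin T → ℂ) :
    sesq M u v = dotProduct (Matrix.vecMul u M) (star v) :=
  Matrix.dotProduct_mulVec _ _ _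

lemma sesq_eq_sum (M : Matrix (Fin T) (Fin T) ℂ) (u v : Fin T → ℂ) :
    sesq M u v = ∑ p, ∑ q, u p * M p q * star (v q) := by
  simp [sesq, Matrix.mulVec, dotProduct, Finset.mul_sum, mul_assoc]

lemma sesq_single (M : Matrix (Fin T) (Fin T) ℂ) (p q : Fin T) :
    sesq M (Pi.single p 1) (Pi.single q 1) = M p q := by
  rw [sesq_eq_sum, Finset.sum_eq_single p, Finset.sum_eq_single q]
  · simp
  · intro b _ hb; simp [hb]
  · simp
  · intro b _ hb; simp [hb]
  · simp

lemma star_sesq (hM : M.IsHermitian) (u v : Fin T → ℂ) : star (sesq M u v) = sesq M v u := by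
  rw [sesq_eq_sum, sesq_eq_sum, star_sum, Finset.sum_comm]
  refine Finset.sum_congr rfl fun p _ => ?_
  rw [star_sum]
  refine Finset.sum_congr rfl fun q _ => ?_
  simp only [star_mul', star_star]
  rw [hM.apply q p]
  ring

lemma sesq_self_im (hM : M.IsHermitian) (v : Fin T → ℂ) : (sesq M v v).im = 0 := by
  have := congrArg Complex.im (star_sesq hM v v)
  simp at this
  linarith

lemma sesq_self (hM : M.IsHermitian) (v : Fin T → ℂ) : sesq M v v = (quad M v : ℂ) :=
  Complex.ext rfl (by simpa using sesq_self_im hM v)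

lemma quad_nonneg (hM : M.PosSemidef) (v : Fin T → ℂ) : 0 ≤ quad M v := by
  have h := hM.dotProduct_mulVec_nonneg (star v)
  rw [star_star] at h
  exact (Complex.le_def.1 h).1

lemma quad_add (hM : M.IsHermitian) (u v : Fin T → ℂ) :
    quad M (u + v) = quad M u + quad M v + 2 * (sesq M u v).re := by
  simp only [quad_eq_sesq, sesq_add_left, sesq_add_right, Complex.add_re]
  have := congrArg Complex.re (star_sesq hM u v)
  simp only [Complex.star_def, Complex.conj_re] at this
  linarith

lemma quad_neg (M : Matrix (Fin T) (Fin T) ℂ) (v : Fin T → ℂ) : quad M (-v) = quad M v := by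
  simp [quad_eq_sesq, sesq_neg_left, sesq_neg_right]

lemma quad_sub (hM : M.IsHermitian) (u v : Fin T → ℂ) :
    quad M (u - v) = quad M u + quad M v - 2 * (sesq M u v).re := by
  rw [sub_eq_add_neg, quad_add hM, quad_neg, sesq_neg_right, Complex.neg_re]
  ring

lemma quad_smul (M : Matrix (Fin T) (Fin T) ℂ) (c : ℂ) (v : Fin T → ℂ) :
    quad M (c • v) = ‖c‖ ^ 2 * quad M v := by
  have : c * star c = ((‖c‖ ^ 2 : ℝ) : ℂ) := by
    rw [Complex.star_def, Complex.mul_conj, Complex.normSq_eq_norm_sq]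
  rw [quad_eq_sesq, sesq_smul_left, sesq_smul_right, ← mul_assoc, this, Complex.re_ofReal_mul]
  rfl

lemma quad_zero (M : Matrix (Fin T) (Fin T) ℂ) : quad M 0 = 0 := by
  simp [quad_eq_sesq]

lemma quad_matrix_add (M M' : Matrix (Fin T) (Fin T) ℂ) (v : Fin T → ℂ) :
    quad (M + M') v = quad M v + quad M' v := by
  simp [quad, Matrix.add_mulVec, dotProduct_add]

lemma quad_matrix_smul (t : ℝ) (M : Matrix (Fin T) (Fin T) ℂ) (v : Fin T → ℂ) :
    quad ((t : ℂ) • M) v = t * quad M v := by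
  simp [quad, Matrix.smul_mulVec, dotProduct_smul]

/-- Cauchy–Schwarz in additive form: the free parameter `s` allows the bound to be integrated
pointwise, without square roots, and optimised afterwards. -/
lemma two_norm_sesq_le (hM : M.PosSemidef) {s : ℝ} (hs : 0 < s) (u v : Fin T → ℂ) :
    2 * ‖sesq M u v‖ ≤ s * quad M u + s⁻¹ * quad M v := by
  obtain ⟨c, hc, hc'⟩ : ∃ c : ℂ, ‖c‖ = 1 ∧ c * sesq M u v = ‖sesq M u v‖ := by
    by_cases h : sesq M u v = 0
    · exact ⟨1, by simp, by simp [h]⟩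
    · refine ⟨star (sesq M u v) / ‖sesq M u v‖, ?_, ?_⟩
      · rw [norm_div, norm_star, Complex.norm_real, norm_norm, div_self (norm_ne_zero_iff.2 h)]
      · have h' : ((‖sesq M u v‖ : ℝ) : ℂ) ≠ 0 := by simpa using h
        rw [div_mul_eq_mul_div, div_eq_iff h', Complex.star_def, mul_comm, Complex.mul_conj,
          Complex.normSq_eq_norm_sq]
        push_cast
        ring
  have h := quad_nonneg hM ((c * (s : ℂ)) • u - v)
  rw [quad_sub hM.1, quad_smul, sesq_smul_left, mul_right_comm, hc', norm_mul, hc,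
    Complex.norm_real, Real.norm_of_nonneg hs.le, one_mul] at h
  rw [← Complex.ofReal_mul, Complex.ofReal_re] at h
  have h2 : 0 ≤ s⁻¹ * (s ^ 2 * quad M u + quad M v - 2 * (‖sesq M u v‖ * s)) :=
    mul_nonneg (inv_pos.2 hs).le h
  have h3 : s⁻¹ * (s ^ 2 * quad M u + quad M v - 2 * (‖sesq M u v‖ * s)) =
      s * quad M u + s⁻¹ * quad M v - 2 * ‖sesq M u v‖ := by
    field_simp
  linarith

lemma quad_add_le (hM : M.PosSemidef) {s : ℝ} (hs : 0 < s) (u v : Fin T → ℂ) :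
    quad M (u + v) ≤ (1 + s) * quad M u + (1 + s⁻¹) * quad M v := by
  rw [quad_add hM.1]
  have h1 := two_norm_sesq_le hM hs u v
  have h2 := Complex.re_le_norm (sesq M u v)
  linarith

/-- The diagonal controls everything: `2 |M_{pq}| ≤ M_{pp} + M_{qq}`. This converts the trace in the
minimality condition into entrywise integrability. -/
lemma norm_entry_le_trace (hM : M.PosSemidef) (p q : Fin T) : ‖M p q‖ ≤ M.trace.re := by
  have h1 := two_norm_sesq_le hM one_pos (Pi.single p 1) (Pi.single q 1)
  have h2 : ∀ r, quad M (Pi.single r 1) ≤ M.trace.re := by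
    intro r
    rw [Matrix.trace, Complex.re_sum]
    have h3 : ∀ i, (Matrix.diag M i).re = quad M (Pi.single i 1) := fun i => by
      rw [quad_eq_sesq, sesq_single]; rfl
    simp only [h3]
    exact Finset.single_le_sum (f := fun i => quad M (Pi.single i 1))
      (fun i _ => quad_nonneg hM _) (Finset.mem_univ r)
  rw [sesq_single] at h1
  have := h2 p
  have := h2 q
  simp only [one_mul, inv_one] at h1
  linarith

/-- The bound `|v_q|² ≤ (vᵀ M v̄) (M⁻¹)_{qq}` in additive form. -/
lemma two_norm_apply_le (hM : M.PosSemidef) (hd : IsUnit M.det) {s : ℝ} (hs : 0 < s)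
    (v : Fin T → ℂ) (q : Fin T) : 2 * ‖v q‖ ≤ s * quad M v + s⁻¹ * (M⁻¹ q q).re := by
  -- This `y` represents the `q`th coordinate with respect to the form: `M ȳ = e_q`.
  set y : Fin T → ℂ := star (M⁻¹.mulVec (Pi.single q 1)) with hy
  have hMy : M.mulVec (star y) = Pi.single q 1 := by
    rw [hy, star_star, Matrix.mulVec_mulVec, Matrix.mul_nonsing_inv _ hd, Matrix.one_mulVec]
  have h1 := two_norm_sesq_le hM hs v y
  have h2 : sesq M v y = v q := by
    rw [sesq, hMy, dotProduct_single, mul_one]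
  have h3 : quad M y = (M⁻¹ q q).re := by
    rw [quad, hMy, dotProduct_single, mul_one, hy]
    simp
  rwa [h2, h3] at h1

lemma quad_inv_vecMul (hM : M.IsHermitian) (hd : IsUnit M.det) (c : Fin T → ℂ) :
    quad M (Matrix.vecMul c M⁻¹) = quad M⁻¹ c := by
  rw [quad, quad]
  congr 1
  have h : M.mulVec (star (Matrix.vecMul c M⁻¹)) = star c := by
    rw [Matrix.star_vecMul, hM.inv.eq, Matrix.mulVec_mulVec, Matrix.mul_nonsing_inv _ hd,
      Matrix.one_mulVec]
  rw [h, ← Matrix.dotProduct_mulVec]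

/-- In Cauchy–Schwarz for the form `M`, the cross term of `c M'⁻¹` and `c M⁻¹` is again `quad M'⁻¹
c`. The hypothesis bounds `s` times the first square by the same quantity, which is then absorbed on
the left. -/
lemma quad_inv_antitone {s : ℝ} (hs : 0 < s) (hM : M.PosSemidef) (hM' : M'.PosSemidef)
    (hd : IsUnit M.det) (hd' : IsUnit M'.det) (hle : ∀ v, s * quad M v ≤ quad M' v)
    (c : Fin T → ℂ) : s * quad M'⁻¹ c ≤ quad M⁻¹ c := by
  have key := two_norm_sesq_le hM hs (Matrix.vecMul c M'⁻¹) (Matrix.vecMul c M⁻¹)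
  have h1 : sesq M (Matrix.vecMul c M'⁻¹) (Matrix.vecMul c M⁻¹) = sesq M'⁻¹ c c := by
    have h : M.mulVec (star (Matrix.vecMul c M⁻¹)) = star c := by
      rw [Matrix.star_vecMul, hM.1.inv.eq, Matrix.mulVec_mulVec, Matrix.mul_nonsing_inv _ hd,
        Matrix.one_mulVec]
    rw [sesq, h, ← Matrix.dotProduct_mulVec, sesq]
  have h2 := hle (Matrix.vecMul c M'⁻¹)
  rw [quad_inv_vecMul hM'.1 hd'] at h2
  rw [h1, quad_inv_vecMul hM.1 hd] at key
  have h3 := Complex.re_le_norm (sesq M'⁻¹ c c)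
  rw [← quad_eq_sesq] at h3
  have h4 : quad M'⁻¹ c ≤ s⁻¹ * quad M⁻¹ c := by linarith
  rwa [le_inv_mul_iff₀ hs] at h4

/-- If `t G ≤ M` and `t ≥ 0` then `t G M⁻¹ G ≤ G`. -/
lemma quad_conj_inv_le {G : Matrix (Fin T) (Fin T) ℂ} {t : ℝ} (ht : 0 ≤ t)
    (hG : G.PosSemidef) (hd : IsUnit M.det) (hle : ∀ v, t * quad G v ≤ quad M v)
    (c : Fin T → ℂ) : t * quad M (Matrix.vecMul c (G * M⁻¹)) ≤ quad G c := by
  set y := Matrix.vecMul c (G * M⁻¹) with hy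
  have h1 : sesq G c y = sesq M y y := by
    rw [sesq_eq_vecMul, sesq_eq_vecMul]
    congr 1
    rw [hy, Matrix.vecMul_vecMul, Matrix.mul_assoc, Matrix.nonsing_inv_mul _ hd, Matrix.mul_one]
  -- Expanding at `c - t y` gives the cross term `2 t · quad M y`; half of it absorbs `t² · quad G
  -- y`, by `t G ≤ M`.
  have h2 := quad_nonneg hG (c - (t : ℂ) • y)
  rw [quad_sub hG.1, sesq_smul_right, quad_smul, h1, Complex.star_def, Complex.conj_ofReal,
    Complex.re_ofReal_mul, ← quad_eq_sesq, Complex.norm_real, Real.norm_of_nonneg ht] at h2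
  have h3 := mul_le_mul_of_nonneg_left (hle y) ht
  nlinarith

end Pointwise

/-! ### Exponentials on the frequency interval -/

instance : IsFiniteMeasure freq := by
  unfold freq; infer_instance

lemma continuous_ex (k : ℤ) : Continuous (ex k) := by
  unfold ex; fun_prop

lemma norm_ex (k : ℤ) (x : ℝ) : ‖ex k x‖ = 1 := by
  rw [ex, ← Complex.ofReal_intCast, ← Complex.ofReal_mul, mul_comm]
  exact Complex.norm_exp_ofReal_mul_I _

lemma ex_add (k l : ℤ) (x : ℝ) : ex (k + l) x = ex k x * ex l x := by
  simp only [ex, ← Complex.exp_add]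
  congr 1
  push_cast
  ring

lemma ex_zero (x : ℝ) : ex 0 x = 1 := by simp [ex]

lemma star_ex (k : ℤ) (x : ℝ) : star (ex k x) = ex (-k) x := by
  simp only [ex, Complex.star_def, ← Complex.exp_conj]
  congr 1
  simp

lemma ex_mul_nat (k : ℤ) (m : ℕ) (x : ℝ) : ex (k * m) x = ex k x ^ m := by
  rw [ex, ex, ← Complex.exp_nat_mul]
  congr 1
  push_cast
  ring

lemma measurable_ex (k : ℤ) : Measurable (ex k) := (continuous_ex k).measurable

lemma integrable_ex_mul {F : ℝ → ℂ} (hF : Integrable F freq) (k : ℤ) :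
    Integrable (fun x => ex k x * F x) freq :=
  hF.bdd_mul (measurable_ex k).aestronglyMeasurable (Filter.Eventually.of_forall fun x =>
    (norm_ex k x).le)

lemma integral_ex (k : ℤ) : ∫ x, ex k x ∂freq = if k = 0 then 2 * (Real.pi : ℂ) else 0 := by
  have hpi : -Real.pi ≤ Real.pi := by linarith [Real.pi_pos]
  rw [freq, setIntegral_congr_set Ico_ae_eq_Ioc, ← intervalIntegral.integral_of_le hpi]
  split_ifs with h
  · subst h
    simp only [ex_zero, intervalIntegral.integral_const, sub_neg_eq_add, ← two_mul]
    simp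
  · have hk : Complex.I * (k : ℂ) ≠ 0 := by simp [h]
    have := integral_exp_mul_complex (a := -Real.pi) (b := Real.pi) hk
    simp only [ex, ← mul_assoc]
    rw [this, div_eq_zero_iff]
    left
    have h1 : Complex.I * (k : ℂ) * (Real.pi : ℂ) =
        Complex.I * (k : ℂ) * ((-Real.pi : ℝ) : ℂ) + k * (2 * Real.pi * Complex.I) := by
      push_cast; ring
    rw [h1, Complex.exp_add, Complex.exp_int_mul_two_pi_mul_I, mul_one, sub_self]

/-- An integrable function on the frequency interval is determined by its Fourier coefficients. -/
theorem ae_eq_zero_of_fourier_eq_zero {F : ℝ → ℂ} (hF : Integrable F freq)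
    (h : ∀ k : ℤ, ∫ x, ex k x * F x ∂freq = 0) : F =ᵐ[freq] 0 := by
  have hpi := Real.pi_pos
  have : Fact (0 < 2 * Real.pi) := ⟨by positivity⟩
  -- The open interval is enough: the left endpoint is a null set.
  have key : ∀ᵐ x ∂(volume : Measure ℝ), x ∈ Set.Ioo (-Real.pi) Real.pi → F x = 0 := by
    refine isOpen_Ioo.ae_eq_zero_of_integral_contDiff_smul_eq_zero ?_ ?_
    · have : IntegrableOn F (Set.Ico (-Real.pi) Real.pi) := hF
      exact (this.mono_set Set.Ioo_subset_Ico_self).locallyIntegrableOn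
    · intro g hg _ hsupp
      have hg0 : ∀ x, x ∉ Set.Ioo (-Real.pi) Real.pi → g x = 0 := fun x hx =>
        image_eq_zero_of_notMem_tsupport fun hx' => hx (hsupp hx')
      have hint : Integrable (fun x => (g x : ℂ) * F x) freq := by
        obtain ⟨C, hC⟩ := (isCompact_Icc (a := -Real.pi) (b := Real.pi)).exists_bound_of_continuousOn
          hg.continuous.continuousOn
        refine hF.bdd_mul (c := C) (Complex.continuous_ofReal.comp hg.continuous
          |>.aestronglyMeasurable) ?_
        refine (ae_restrict_iff' measurableSet_Ico).2 (Filter.Eventually.of_forall fun x hx => ?_)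
        simpa using hC x (Set.Ico_subset_Icc_self hx)
      have hset : ∫ x, g x • F x = ∫ x, (g x : ℂ) * F x ∂freq := by
        rw [freq, setIntegral_eq_integral_of_forall_compl_eq_zero]
        · simp
        · intro x hx
          rw [hg0 x fun hx' => hx (Set.Ioo_subset_Ico_self hx')]
          simp
      rw [hset]
      set G : ℝ → ℂ := fun x => (g x : ℂ) with hG
      have hper : -Real.pi + 2 * Real.pi = Real.pi := by ring
      -- The test function vanishes at both endpoints, so it descends to a continuous function on
      -- the circle, where trigonometric polynomials are dense.
      let φ : C(AddCircle (2 * Real.pi), ℂ) :=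
        ⟨AddCircle.liftIco (2 * Real.pi) (-Real.pi) G, AddCircle.liftIco_continuous
          (by simp [hG, hper, hg0]) (Complex.continuous_ofReal.comp hg.continuous).continuousOn⟩
      have hφ : ∀ x ∈ Set.Ico (-Real.pi) Real.pi, φ (x : AddCircle (2 * Real.pi)) = G x := by
        intro x hx
        exact AddCircle.liftIco_coe_apply (f := G) (by rwa [hper])
      let J : C(AddCircle (2 * Real.pi), ℂ) → ℂ := fun ψ =>
        ∫ x, ψ (x : AddCircle (2 * Real.pi)) * F x ∂freq
      have hψ : ∀ ψ : C(AddCircle (2 * Real.pi), ℂ),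
          Integrable (fun x : ℝ => ψ (x : AddCircle (2 * Real.pi)) * F x) freq := fun ψ =>
        hF.bdd_mul (c := ‖ψ‖) (ψ.continuous.comp (AddCircle.continuous_mk' _)).aestronglyMeasurable
          (Filter.Eventually.of_forall fun x => ψ.norm_coe_le_norm _)
      have hspan : ∀ ψ ∈ Submodule.span ℂ (Set.range <| @fourier (2 * Real.pi)), J ψ = 0 := by
        intro ψ hψ'
        induction hψ' using Submodule.span_induction with
        | mem ψ h' =>
          obtain ⟨k, rfl⟩ := h'
          rw [← h k]
          refine integral_congr_ae (Filter.Eventually.of_forall fun x => ?_)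
          simp only [fourier_coe_apply, ex]
          congr 2
          have : (Real.pi : ℂ) ≠ 0 := by exact_mod_cast Real.pi_ne_zero
          push_cast
          field_simp
        | zero => simp [J]
        | add ψ ψ' _ _ h1 h2 =>
          simp only [J, ContinuousMap.add_apply, add_mul]
          rw [integral_add (hψ ψ) (hψ ψ')]
          simp only [J] at h1 h2
          rw [h1, h2, add_zero]
        | smul c ψ _ h1 =>
          simp only [J, ContinuousMap.smul_apply, smul_eq_mul, mul_assoc]
          simp only [J] at h1
          rw [integral_const_mul, h1, mul_zero]
      -- The functional `J` is Lipschitz in the supremum norm with constant `‖F‖₁` and vanishes on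
      -- the dense span of the exponentials.
      have hJφ : J φ = 0 := by
        have hcont : Continuous J := by
          refine (LipschitzWith.of_dist_le_mul (K := (∫ x, ‖F x‖ ∂freq).toNNReal)
            fun ψ ψ' => ?_).continuous
          rw [dist_eq_norm, dist_eq_norm, Real.coe_toNNReal _ (integral_nonneg fun _ =>
            norm_nonneg _), ← integral_sub (hψ ψ) (hψ ψ'),
            mul_comm (∫ x, ‖F x‖ ∂freq), ← integral_const_mul]
          refine norm_integral_le_of_norm_le (hF.norm.const_mul _)
            (Filter.Eventually.of_forall fun x => ?_)
          rw [← sub_mul, norm_mul]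
          exact mul_le_mul_of_nonneg_right ((ψ - ψ').norm_coe_le_norm _) (norm_nonneg _)
        have hcl : IsClosed {ψ | J ψ = 0} := isClosed_eq hcont continuous_const
        have : φ ∈ (Submodule.span ℂ (Set.range <| @fourier (2 * Real.pi))).topologicalClosure := by
          rw [span_fourier_closure_eq_top]; trivial
        exact closure_minimal hspan hcl this
      rw [← hJφ]
      refine integral_congr_ae ?_
      refine (ae_restrict_iff' measurableSet_Ico).2 (Filter.Eventually.of_forall fun x hx => ?_)
      simp only [hφ x hx]
      rfl
  have h2 : ∀ᵐ x ∂(volume : Measure ℝ), x ≠ -Real.pi := by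
    simp [ae_iff, measure_singleton]
  refine (ae_restrict_iff' measurableSet_Ico).2 ?_
  filter_upwards [key, h2] with x hx hx2 hx3
  exact hx ⟨lt_of_le_of_ne hx3.1 (Ne.symm hx2), hx3.2⟩

/-- An integrable function whose Fourier coefficients vanish outside a finite set is a
trigonometric polynomial. -/
theorem ae_eq_sum_of_fourier_eq_zero {F : ℝ → ℂ} (hF : Integrable F freq) (s : Finset ℤ)
    (h : ∀ k ∉ s, ∫ x, ex k x * F x ∂freq = 0) :
    F =ᵐ[freq] fun x => ∑ k ∈ s, avg (fun y => ex k y * F y) * ex (-k) x := by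
  have hsum : ∀ k, Integrable (fun x => avg (fun y => ex k y * F y) * ex (-k) x) freq := fun k =>
    Integrable.const_mul (by
      simpa using integrable_ex_mul (integrable_const (μ := freq) (1 : ℂ)) (-k)) _
  have hS := integrable_finsetSum s fun k _ => hsum k
  have := ae_eq_zero_of_fourier_eq_zero (hF.sub hS) fun l => by
    simp only [Pi.sub_apply, mul_sub]
    rw [integral_sub (integrable_ex_mul hF l) (integrable_ex_mul hS l)]
    simp only [Finset.mul_sum]
    rw [integral_finsetSum _ fun k _ => integrable_ex_mul (hsum k) l]
    have h1 : ∀ k, ∫ x, ex l x * (avg (fun y => ex k y * F y) * ex (-k) x) ∂freq =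
        if l = k then ∫ x, ex k x * F x ∂freq else 0 := by
      intro k
      have : ∀ x, ex l x * (avg (fun y => ex k y * F y) * ex (-k) x) =
          avg (fun y => ex k y * F y) * ex (l - k) x := fun x => by
        rw [sub_eq_add_neg, ex_add]; ring
      simp only [this]
      rw [integral_const_mul, integral_ex]
      have hp : (Real.pi : ℂ) ≠ 0 := by exact_mod_cast Real.pi_ne_zero
      simp only [sub_eq_zero]
      split_ifs
      · rw [avg]; field_simp
      · simp
    simp only [h1, Finset.sum_ite_eq]
    split_ifs with hl
    · simp
    · rw [h l hl]; simp
  filter_upwards [this] with x hx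
  simpa [sub_eq_zero] using hx

/-! ### Measurable square roots of positive semidefinite matrix fields. -/

section MatrixSqrt

/-- The positive semidefinite matrices of trace at most one, as arrays. -/
def subunitDensity (T : ℕ) : Set (Fin T → Fin T → ℂ) :=
  {A | (Matrix.of A).PosSemidef ∧ (Matrix.of A).trace.re ≤ 1}

lemma isClosed_subunitDensity : IsClosed (subunitDensity T) := by
  have h : subunitDensity T = {A | ∀ i j, star (A j i) = A i j} ∩
      ({A | ∀ v, 0 ≤ dotProduct (star v) ((Matrix.of A).mulVec v)} ∩
        {A | (Matrix.of A).trace.re ≤ 1}) := by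
    ext A
    simp only [subunitDensity, Set.mem_ofPred_eq, Set.mem_inter_iff, ← and_assoc]
    refine and_congr_left fun _ => ⟨fun h => ⟨fun i j => h.1.apply i j,
      fun v => h.dotProduct_mulVec_nonneg v⟩, fun h => ?_⟩
    exact Matrix.PosSemidef.of_dotProduct_mulVec_nonneg (Matrix.IsHermitian.ext h.1) h.2
  rw [h]
  refine IsClosed.inter ?_ (IsClosed.inter ?_ ?_)
  · simp only [Set.ofPred_forall]
    exact isClosed_iInter fun i => isClosed_iInter fun j =>
      isClosed_eq (by fun_prop) (by fun_prop)
  · simp only [Set.ofPred_forall, Matrix.mulVec, dotProduct, Matrix.of_apply]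
    exact isClosed_iInter fun v => isClosed_le (by fun_prop) (by fun_prop)
  · simp only [Matrix.trace, Matrix.diag, Matrix.of_apply]
    exact isClosed_le (by fun_prop) (by fun_prop)

open scoped Matrix.Norms.L2Operator MatrixOrder

/-- The continuous functional calculus depends continuously on the matrix as long as the spectra
stay in one fixed compact set. This is why densities are first scaled to trace at most one. -/
lemma continuousOn_matrix_sqrt :
    ContinuousOn (fun A : Matrix (Fin T) (Fin T) ℂ => cfc Real.sqrt A)
      {A | IsSelfAdjoint A ∧ spectrum ℝ A ⊆ Set.Icc 0 1} :=
  continuousOn_cfc (𝕜 := ℝ) (Matrix (Fin T) (Fin T) ℂ) isCompact_Icc Real.sqrt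
    Real.continuous_sqrt.continuousOn

lemma spectrum_subset_of_trace_le {A : Matrix (Fin T) (Fin T) ℂ} (hA : A.PosSemidef)
    (h : A.trace.re ≤ 1) : spectrum ℝ A ⊆ Set.Icc 0 1 := by
  rw [hA.1.spectrum_real_eq_range_eigenvalues]
  rintro _ ⟨i, rfl⟩
  refine ⟨hA.eigenvalues_nonneg i, le_trans ?_ h⟩
  rw [hA.1.trace_eq_sum_eigenvalues, Complex.re_sum]
  simpa using Finset.single_le_sum (f := hA.1.eigenvalues)
    (fun j _ => hA.eigenvalues_nonneg j) (Finset.mem_univ i)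

lemma matrix_sqrt_mul_self {A : Matrix (Fin T) (Fin T) ℂ} (hA : A.PosSemidef) :
    cfc Real.sqrt A * cfc Real.sqrt A = A := by
  have hsa : IsSelfAdjoint A := hA.1
  rw [← cfc_mul Real.sqrt Real.sqrt A Real.continuous_sqrt.continuousOn
    Real.continuous_sqrt.continuousOn]
  conv_rhs => rw [← cfc_id ℝ A hsa]
  refine cfc_congr fun t ht => ?_
  rw [hA.1.spectrum_real_eq_range_eigenvalues] at ht
  obtain ⟨i, rfl⟩ := ht
  exact Real.mul_self_sqrt (hA.eigenvalues_nonneg i)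

/-- The entry `(i, j)` of the square root is a Borel function on the subunit density matrices. -/
lemma exists_measurable_sqrt_entry (i j : Fin T) : ∃ φ : (Fin T → Fin T → ℂ) → ℂ, Measurable φ ∧
    ∀ A ∈ subunitDensity T, φ A = (cfc Real.sqrt (Matrix.of A)) i j := by
  classical
  refine ⟨(subunitDensity T).piecewise (fun A => (cfc Real.sqrt (Matrix.of A)) i j) 0,
    ContinuousOn.measurable_piecewise ?_ continuousOn_const
      isClosed_subunitDensity.measurableSet, fun A hA => Set.piecewise_eq_of_mem _ _ _ hA⟩
  have h1 : ContinuousOn (fun A : Fin T → Fin T → ℂ => cfc Real.sqrt (Matrix.of A))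
      (subunitDensity T) :=
    ContinuousOn.comp continuousOn_matrix_sqrt (continuous_id (X := Fin T → Fin T → ℂ)).continuousOn
      fun A hA => ⟨hA.1.1, spectrum_subset_of_trace_le hA.1 hA.2⟩
  exact ContinuousOn.comp (g := fun A : Matrix (Fin T) (Fin T) ℂ => A i j)
    (continuous_apply_apply i j).continuousOn h1 (Set.mapsTo_univ _ _)

/-- A measurable field of positive semidefinite matrices has a measurable square root. -/
theorem exists_aemeasurable_sqrt {p : ℝ → Matrix (Fin T) (Fin T) ℂ}
    (hp : ∀ᵐ x ∂freq, (p x).PosSemidef) (hm : ∀ i j, AEMeasurable (fun x => p x i j) freq) :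
    ∃ S : ℝ → Matrix (Fin T) (Fin T) ℂ, (∀ i j, AEMeasurable (fun x => S x i j) freq) ∧
      ∀ᵐ x ∂freq, (S x).IsHermitian ∧ S x * S x = p x := by
  choose φ hφ hφ' using exists_measurable_sqrt_entry (T := T)
  -- Dividing by one plus the trace, rather than by the trace, avoids a zero denominator where `p`
  -- vanishes.
  set r : ℝ → ℝ := fun x => 1 + (p x).trace.re with hr
  set B : ℝ → Matrix (Fin T) (Fin T) ℂ := fun x => ((r x)⁻¹ : ℂ) • p x with hB
  have hrm : AEMeasurable r freq := by
    simp only [hr, Matrix.trace, Matrix.diag]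
    exact (Complex.measurable_re.comp_aemeasurable
      (Finset.aemeasurable_fun_sum _ fun i _ => hm i i)).const_add _
  have hBm : AEMeasurable (β := Fin T → Fin T → ℂ) B freq := by
    refine aemeasurable_pi_lambda _ fun i => aemeasurable_pi_lambda _ fun j => ?_
    exact (Complex.measurable_ofReal.comp_aemeasurable hrm).inv.mul (hm i j)
  refine ⟨fun x => Matrix.of fun i j => ((Real.sqrt (r x) : ℝ) : ℂ) * φ i j (B x), fun i j => ?_, ?_⟩
  · exact (Complex.measurable_ofReal.comp_aemeasurable
      (Real.continuous_sqrt.measurable.comp_aemeasurable hrm)).mul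
      ((hφ i j).comp_aemeasurable hBm)
  · filter_upwards [hp] with x hx
    have htr : 0 ≤ (p x).trace.re := (Complex.le_def.1 hx.trace_nonneg).1
    have hr0 : 0 < r x := by simp only [hr]; linarith
    have hBp : (B x).PosSemidef := by
      have : (0 : ℂ) ≤ ((r x)⁻¹ : ℂ) := by
        rw [← Complex.ofReal_inv]; exact_mod_cast (inv_pos.2 hr0).le
      exact hx.smul this
    have hBmem : (B x : Fin T → Fin T → ℂ) ∈ subunitDensity T := by
      refine ⟨hBp, ?_⟩
      have : (Matrix.of (B x)).trace.re = (r x)⁻¹ * (p x).trace.re := by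
        change (B x).trace.re = _
        simp only [hB]
        rw [Matrix.trace_smul, ← Complex.ofReal_inv, smul_eq_mul, Complex.re_ofReal_mul]
      rw [this, inv_mul_le_iff₀ hr0]
      simp [hr]
    have hS : (Matrix.of fun i j => ((Real.sqrt (r x) : ℝ) : ℂ) * φ i j (B x)) =
        ((Real.sqrt (r x) : ℝ) : ℂ) • cfc Real.sqrt (B x) := by
      ext i j
      simp only [Matrix.of_apply, Matrix.smul_apply, smul_eq_mul]
      rw [hφ' i j _ hBmem]
      rfl
    rw [hS]
    constructor
    · have h1 : IsSelfAdjoint (cfc Real.sqrt (B x)) := cfc_predicate _ _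
      have h2 : (cfc Real.sqrt (B x)).IsHermitian := h1
      rw [Matrix.IsHermitian, Matrix.conjTranspose_smul, h2.eq]
      simp
    · rw [Matrix.smul_mul, Matrix.mul_smul, matrix_sqrt_mul_self hBp, smul_smul, ←
        Complex.ofReal_mul, Real.mul_self_sqrt hr0.le]
      simp only [hB, smul_smul]
      rw [mul_inv_cancel₀ (by exact_mod_cast hr0.ne'), one_smul]

end MatrixSqrt

/-! ### The transfer function and the weight -/

lemma norm_one_sub_ex_le (k : ℤ) (x : ℝ) : ‖1 - ex k x‖ ≤ |(k : ℝ)| * |x| := by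
  rw [norm_sub_rev, ex, ← Complex.ofReal_intCast, ← Complex.ofReal_mul]
  have := Real.norm_exp_I_mul_ofReal_sub_one_le (x := (k : ℝ) * x)
  simpa [abs_mul] using this

lemma norm_one_sub_ex_neg (k : ℤ) (x : ℝ) : ‖1 - ex (-k) x‖ = ‖1 - ex k x‖ := by
  rw [← star_ex, ← norm_star (1 - ex k x)]
  simp

lemma norm_chi_le (n μ : ℕ) (x : ℝ) : ‖chi n μ x‖ ≤ (μ : ℝ) ^ n := by
  rw [chi, ← div_pow, norm_pow, norm_div]
  refine pow_le_pow_left₀ (by positivity) ?_ n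
  refine div_le_of_le_mul₀ (norm_nonneg _) (by positivity) ?_
  simpa using norm_one_sub_ex_le (-(μ : ℤ)) x

lemma measurable_chi (n μ : ℕ) : Measurable (chi n μ) := by
  unfold chi
  have := measurable_ex (-(μ : ℤ))
  fun_prop

lemma measurable_weight (n μ : ℕ) : Measurable (weight n μ) := by
  unfold weight
  have := measurable_ex (μ : ℤ)
  fun_prop

lemma ae_regular {μ : ℕ} (hμ : 0 < μ) : ∀ᵐ x ∂freq, x ≠ 0 ∧ 1 - ex (μ : ℤ) x ≠ 0 := by
  have hc : Set.Countable ({0} ∪ Set.range fun k : ℤ => k * (2 * Real.pi) / μ : Set ℝ) :=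
    (Set.countable_singleton _).union (Set.countable_range _)
  refine ae_restrict_of_ae ?_
  filter_upwards [hc.ae_notMem volume] with x hx
  refine ⟨fun h => hx (Or.inl h), fun h => hx (Or.inr ?_)⟩
  rw [sub_eq_zero, eq_comm, ex, Complex.exp_eq_one_iff] at h
  obtain ⟨k, hk⟩ := h
  refine ⟨k, ?_⟩
  have h2 : Complex.I * (((μ : ℝ) * x : ℝ) : ℂ) = Complex.I * ((k * (2 * Real.pi) : ℝ) : ℂ) := by
    push_cast
    rw [Int.cast_natCast] at hk
    rw [hk]; ring
  have h3 := Complex.ofReal_injective (mul_left_cancel₀ Complex.I_ne_zero h2)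
  have : (μ : ℝ) ≠ 0 := by positivity
  simp only
  rw [← h3]
  field_simp

section Regular

variable {n μ : ℕ} {x : ℝ}

lemma one_sub_ex_neg_ne_zero {k : ℤ} (h : 1 - ex k x ≠ 0) : 1 - ex (-k) x ≠ 0 := by
  rwa [← norm_ne_zero_iff, norm_one_sub_ex_neg, norm_ne_zero_iff]

lemma chi_ne_zero (hx : x ≠ 0 ∧ 1 - ex (μ : ℤ) x ≠ 0) : chi n μ x ≠ 0 := by
  unfold chi
  have h1 := one_sub_ex_neg_ne_zero hx.2
  have h2 : (x : ℂ) ≠ 0 := by exact_mod_cast hx.1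
  exact div_ne_zero (pow_ne_zero _ h1) (pow_ne_zero _ (mul_ne_zero Complex.I_ne_zero h2))

/-- The weight in the minimality condition is exactly the price of dividing by `χ`. No regularity of
`x` is needed, since division by zero yields zero on both sides. -/
lemma weight_eq_inv_norm_sq (n μ : ℕ) (x : ℝ) : weight n μ x = (‖chi n μ x‖ ^ 2)⁻¹ := by
  rw [weight, chi, norm_div, norm_pow, norm_pow, norm_one_sub_ex_neg, norm_mul, Complex.norm_I,
    one_mul, Complex.norm_real, Real.norm_eq_abs, div_pow, inv_div, ← pow_mul, ← pow_mul,
    mul_comm n 2, Even.pow_abs (even_two_mul n)]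

lemma weight_eq_inv (n μ : ℕ) (x : ℝ) :
    (weight n μ x : ℂ) = (chi n μ x * star (chi n μ x))⁻¹ := by
  rw [weight_eq_inv_norm_sq, Complex.star_def, Complex.mul_conj, Complex.normSq_eq_norm_sq]
  push_cast
  rfl

lemma weight_nonneg (n μ : ℕ) (x : ℝ) : 0 ≤ weight n μ x := by
  unfold weight
  exact div_nonneg ((even_two_mul n).pow_nonneg x) (by positivity)

lemma star_chi (n μ : ℕ) (x : ℝ) :
    star (chi n μ x) = (1 - ex (μ : ℤ) x) ^ n / (-Complex.I * (x : ℂ)) ^ n := by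
  rw [chi, star_div₀, star_pow, star_pow, star_sub, star_one, star_ex, neg_neg, star_mul']
  simp

end Regular

/-! ### Measurability and integrability of matrix expressions -/

/-- A matrix function with almost everywhere measurable entries. -/
def AEMeasEntries (f : ℝ → Matrix (Fin T) (Fin T) ℂ) : Prop :=
  ∀ i j, AEMeasurable (fun x => f x i j) freq

lemma IsSpectralDensity.aemeasEntries {f : ℝ → Matrix (Fin T) (Fin T) ℂ}
    (hf : IsSpectralDensity f) : AEMeasEntries f := fun i j =>
  (hf.integrable i j).aestronglyMeasurable.aemeasurable

section Measurability

variable {f g : ℝ → Matrix (Fin T) (Fin T) ℂ} {h k : ℝ → Fin T → ℂ}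

lemma AEMeasEntries.mul (hf : AEMeasEntries f) (hg : AEMeasEntries g) :
    AEMeasEntries fun x => f x * g x := fun i j => by
  simp only [Matrix.mul_apply]
  exact Finset.aemeasurable_fun_sum _ fun l _ => (hf i l).mul (hg l j)

lemma aemeasurable_det (hf : AEMeasEntries f) : AEMeasurable (fun x => (f x).det) freq := by
  simp only [Matrix.det_apply]
  exact Finset.aemeasurable_fun_sum _ fun σ _ =>
    (Finset.aemeasurable_fun_prod _ fun i _ => hf _ _).const_smul _

lemma AEMeasEntries.inv (hf : AEMeasEntries f) : AEMeasEntries fun x => (f x)⁻¹ := fun i j => by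
  simp only [Matrix.inv_def, Matrix.smul_apply, Ring.inverse_eq_inv', smul_eq_mul,
    Matrix.adjugate_apply]
  refine (aemeasurable_det hf).inv.mul (aemeasurable_det fun k l => ?_)
  by_cases hk : k = j
  · subst hk; simp
  · simpa [Matrix.updateRow_ne hk] using hf k l

lemma aemeasurable_vecMul (hf : AEMeasEntries f) (hh : AEMeasurable h freq) :
    AEMeasurable (fun x => Matrix.vecMul (h x) (f x)) freq :=
  aemeasurable_pi_lambda _ fun i => by
    simp only [Matrix.vecMul, dotProduct]
    exact Finset.aemeasurable_fun_sum _ fun l _ => ((aemeasurable_pi_iff.1 hh) l).mul (hf l i)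

lemma aemeasurable_sesq (hf : AEMeasEntries f) (hh : AEMeasurable h freq)
    (hk : AEMeasurable k freq) : AEMeasurable (fun x => sesq (f x) (h x) (k x)) freq := by
  simp only [sesq_eq_sum]
  exact Finset.aemeasurable_fun_sum _ fun i _ => Finset.aemeasurable_fun_sum _ fun j _ =>
    (((aemeasurable_pi_iff.1 hh) i).mul (hf i j)).mul
      (continuous_star.measurable.comp_aemeasurable ((aemeasurable_pi_iff.1 hk) j))

lemma aemeasurable_quad (hf : AEMeasEntries f) (hh : AEMeasurable h freq) :
    AEMeasurable (fun x => quad (f x) (h x)) freq :=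
  Complex.measurable_re.comp_aemeasurable (aemeasurable_sesq hf hh hh)

lemma sqNorm_eq_ofReal (hf : ∀ᵐ x ∂freq, (f x).PosSemidef)
    (hi : Integrable (fun x => quad (f x) (h x)) freq) :
    sqNorm f h = ENNReal.ofReal (∫ x, quad (f x) (h x) ∂freq) := by
  rw [sqNorm, ofReal_integral_eq_lintegral_ofReal hi]
  filter_upwards [hf] with x hx using quad_nonneg hx _

lemma integrable_quad_of_sqNorm_lt_top (hf : IsSpectralDensity f) (hh : AEMeasurable h freq)
    (hi : sqNorm f h < ⊤) : Integrable (fun x => quad (f x) (h x)) freq := by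
  refine ⟨(aemeasurable_quad hf.aemeasEntries hh).aestronglyMeasurable, ?_⟩
  rw [hasFiniteIntegral_iff_ofReal]
  · exact hi
  · filter_upwards [hf.posSemidef] with x hx using quad_nonneg hx _

lemma integrable_sesq (hf : ∀ᵐ x ∂freq, (f x).PosSemidef) (hfm : AEMeasEntries f)
    (hh : AEMeasurable h freq) (hk : AEMeasurable k freq)
    (hhi : Integrable (fun x => quad (f x) (h x)) freq)
    (hki : Integrable (fun x => quad (f x) (k x)) freq) :
    Integrable (fun x => sesq (f x) (h x) (k x)) freq := by
  refine (hhi.add hki).mono' (aemeasurable_sesq hfm hh hk).aestronglyMeasurable ?_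
  filter_upwards [hf] with x hx
  have h1 := two_norm_sesq_le hx one_pos (h x) (k x)
  simp only [one_mul, inv_one] at h1
  have h2 := norm_nonneg (sesq (f x) (h x) (k x))
  simp only [Pi.add_apply]
  linarith

lemma integrable_quad_add (hf : ∀ᵐ x ∂freq, (f x).PosSemidef) (hfm : AEMeasEntries f)
    (hh : AEMeasurable h freq) (hk : AEMeasurable k freq)
    (hhi : Integrable (fun x => quad (f x) (h x)) freq)
    (hki : Integrable (fun x => quad (f x) (k x)) freq) :
    Integrable (fun x => quad (f x) (h x + k x)) freq := by
  refine ((hhi.const_mul 2).add (hki.const_mul 2)).mono'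
    (aemeasurable_quad hfm (hh.add hk)).aestronglyMeasurable ?_
  filter_upwards [hf] with x hx
  have h1 := quad_add_le hx one_pos (h x) (k x)
  rw [Real.norm_of_nonneg (quad_nonneg hx _)]
  simp only [Pi.add_apply]
  linarith

lemma integrable_quad_sub (hf : ∀ᵐ x ∂freq, (f x).PosSemidef) (hfm : AEMeasEntries f)
    (hh : AEMeasurable h freq) (hk : AEMeasurable k freq)
    (hhi : Integrable (fun x => quad (f x) (h x)) freq)
    (hki : Integrable (fun x => quad (f x) (k x)) freq) :
    Integrable (fun x => quad (f x) (h x - k x)) freq := by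
  have := integrable_quad_add hf hfm hh hk.neg hhi (by simpa [quad_neg] using hki)
  simpa [sub_eq_add_neg] using this

/-- The form of a matrix function with integrable entries is integrable on bounded functions. -/
lemma integrable_sesq_of_bounded (hfi : ∀ i j, Integrable (fun x => f x i j) freq)
    (hh : AEMeasurable h freq) (hk : AEMeasurable k freq) {C : ℝ}
    (hhC : ∀ᵐ x ∂freq, ∀ i, ‖h x i‖ ≤ C) (hkC : ∀ᵐ x ∂freq, ∀ i, ‖k x i‖ ≤ C) :
    Integrable (fun x => sesq (f x) (h x) (k x)) freq := by
  simp only [sesq_eq_sum]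
  refine integrable_finsetSum _ fun i _ => integrable_finsetSum _ fun j _ => ?_
  have h1 := (hfi i j).bdd_mul (c := C) (f := fun x => h x i)
    ((aemeasurable_pi_iff.1 hh) i).aestronglyMeasurable (hhC.mono fun x hx => hx i)
  refine h1.mul_bdd (c := C) (g := fun x => star (k x j)) ?_ ?_
  · exact (continuous_star.measurable.comp_aemeasurable
      ((aemeasurable_pi_iff.1 hk) j)).aestronglyMeasurable
  · filter_upwards [hkC] with x hx
    rw [norm_star]; exact hx j

lemma integrable_quad_of_bounded (hfi : ∀ i j, Integrable (fun x => f x i j) freq)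
    (hh : AEMeasurable h freq) {C : ℝ} (hhC : ∀ᵐ x ∂freq, ∀ i, ‖h x i‖ ≤ C) :
    Integrable (fun x => quad (f x) (h x)) freq :=
  (integrable_sesq_of_bounded hfi hh hh hhC hhC).re

end Measurability

/-! ### Elementary properties of the observed density. -/

lemma ae_abs_le_pi : ∀ᵐ x ∂freq, |x| ≤ Real.pi :=
  (ae_restrict_iff' measurableSet_Ico).2 (Filter.Eventually.of_forall fun _ hx =>
    abs_le.2 ⟨hx.1, hx.2.le⟩)

lemma norm_pow_le_of_abs_le_pi {x : ℝ} (hx : |x| ≤ Real.pi) (m : ℕ) :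
    ‖(x : ℂ) ^ m‖ ≤ Real.pi ^ m := by
  rw [norm_pow, Complex.norm_real]
  exact pow_le_pow_left₀ (abs_nonneg x) hx m

lemma dens_eq (n : ℕ) (f g : ℝ → Matrix (Fin T) (Fin T) ℂ) (x : ℝ) :
    dens n f g x = f x + ((x ^ (2 * n) : ℝ) : ℂ) • g x := by
  rw [dens]; push_cast; rfl

lemma quad_dens (n : ℕ) (f g : ℝ → Matrix (Fin T) (Fin T) ℂ) (x : ℝ) (v : Fin T → ℂ) :
    quad (dens n f g x) v = quad (f x) v + x ^ (2 * n) * quad (g x) v := by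
  rw [dens_eq, quad_matrix_add, quad_matrix_smul]

lemma IsSpectralDensity.dens {f g : ℝ → Matrix (Fin T) (Fin T) ℂ} (hf : IsSpectralDensity f)
    (hg : IsSpectralDensity g) (n : ℕ) : IsSpectralDensity (dens n f g) where
  posSemidef := by
    filter_upwards [hf.posSemidef, hg.posSemidef] with x h1 h2
    rw [dens_eq]
    exact h1.add (h2.smul (by exact_mod_cast (even_two_mul n).pow_nonneg x))
  integrable p q := by
    refine (hf.integrable p q).add ?_
    refine (hg.integrable p q).bdd_mul (c := Real.pi ^ (2 * n)) (by fun_prop) ?_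
    filter_upwards [ae_abs_le_pi] with x hx using norm_pow_le_of_abs_le_pi hx _

section Minimality

variable {n μ : ℕ} {f g : ℝ → Matrix (Fin T) (Fin T) ℂ}

/-- The entries of `x^{2n} / |1 - e^{i x μ}|^{2n} p⁻¹` are integrable. -/
lemma Minimality.integrable_entry (hm : Minimality n μ f g) (hf : IsSpectralDensity f)
    (hg : IsSpectralDensity g) (i j : Fin T) :
    Integrable (fun x => (weight n μ x : ℂ) * (PeriodicIncrements.dens n f g x)⁻¹ i j) freq := by
  have hp := hf.dens hg n
  refine hm.2.re.mono' ?_ ?_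
  · exact (((Complex.measurable_ofReal.comp (measurable_weight n μ)).aemeasurable).mul
      (hp.aemeasEntries.inv i j)).aestronglyMeasurable
  · filter_upwards [hp.posSemidef] with x hx
    have := norm_entry_le_trace (hx.inv.smul (a := (weight n μ x : ℂ))
      (by exact_mod_cast weight_nonneg n μ x)) i j
    simpa using this

end Minimality

/-! ### The space of spectral characteristics under the minimality condition -/

/-- The Fourier coefficients of `h_q / χ`, up to the factor `2π`. -/
def charCoef (n μ : ℕ) (h : ℝ → Fin T → ℂ) (j : ℤ) (q : Fin T) : ℂ :=
  ∫ x, ex (-j) x * (h x q / chi n μ x) ∂freq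

section CharCoef

variable {n μ N : ℕ} {f g : ℝ → Matrix (Fin T) (Fin T) ℂ} {h k : ℝ → Fin T → ℂ}

lemma two_norm_div_chi_le {x : ℝ} {M : Matrix (Fin T) (Fin T) ℂ} (hM : M.PosSemidef)
    (hd : IsUnit M.det) (hx : x ≠ 0 ∧ 1 - ex (μ : ℤ) x ≠ 0) {s : ℝ} (hs : 0 < s)
    (v : Fin T → ℂ) (q : Fin T) :
    2 * ‖v q / chi n μ x‖ ≤ s * quad M v + s⁻¹ * (weight n μ x * (M⁻¹ q q).re) := by
  have hc : 0 < ‖chi n μ x‖ := norm_pos_iff.2 (chi_ne_zero hx)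
  -- With parameter `s ‖χ‖`, division by `‖χ‖` leaves `s` in front of the form and puts the factor
  -- `‖χ‖⁻²`, the weight, in front of `M⁻¹`.
  have h1 := two_norm_apply_le hM hd (mul_pos hs hc) v q
  rw [norm_div, weight_eq_inv_norm_sq]
  have h2 : 2 * (‖v q‖ / ‖chi n μ x‖) = ‖chi n μ x‖⁻¹ * (2 * ‖v q‖) := by
    field_simp
  have h3 : s * quad M v + s⁻¹ * ((‖chi n μ x‖ ^ 2)⁻¹ * (M⁻¹ q q).re) =
      ‖chi n μ x‖⁻¹ * (s * ‖chi n μ x‖ * quad M v + (s * ‖chi n μ x‖)⁻¹ * (M⁻¹ q q).re) := by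
    field_simp
  rw [h2, h3]
  exact mul_le_mul_of_nonneg_left h1 (inv_nonneg.2 hc.le)

lemma ae_two_norm_div_chi_le (hμ : 0 < μ) (hf : IsSpectralDensity f) (hg : IsSpectralDensity g)
    (hm : Minimality n μ f g) {s : ℝ} (hs : 0 < s) (h : ℝ → Fin T → ℂ) (q : Fin T) :
    ∀ᵐ x ∂freq, 2 * ‖h x q / chi n μ x‖ ≤ s * quad (dens n f g x) (h x) +
      s⁻¹ * ((weight n μ x : ℂ) * (dens n f g x)⁻¹ q q).re := by
  filter_upwards [(hf.dens hg n).posSemidef, hm.1, ae_regular hμ] with x h1 h2 h3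
  rw [Complex.re_ofReal_mul]
  exact two_norm_div_chi_le h1 h2 h3 hs _ _

lemma integrable_div_chi (hμ : 0 < μ) (hf : IsSpectralDensity f) (hg : IsSpectralDensity g)
    (hm : Minimality n μ f g) (hh : AEMeasurable h freq)
    (hi : Integrable (fun x => quad (dens n f g x) (h x)) freq) (q : Fin T) :
    Integrable (fun x => h x q / chi n μ x) freq := by
  refine (hi.add (hm.integrable_entry hf hg q q).re).mono'
    (((aemeasurable_pi_iff.1 hh) q).div (measurable_chi n μ).aemeasurable).aestronglyMeasurable ?_
  filter_upwards [ae_two_norm_div_chi_le hμ hf hg hm one_pos h q] with x hx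
  have := norm_nonneg (h x q / chi n μ x)
  simp only [one_mul, inv_one] at hx
  simp only [Pi.add_apply]
  exact le_trans (by linarith) hx

lemma charCoef_sub (hμ : 0 < μ) (hf : IsSpectralDensity f) (hg : IsSpectralDensity g)
    (hm : Minimality n μ f g) (hh : AEMeasurable h freq)
    (hi : Integrable (fun x => quad (dens n f g x) (h x)) freq) (hk : AEMeasurable k freq)
    (hki : Integrable (fun x => quad (dens n f g x) (k x)) freq) (j : ℤ) (q : Fin T) :
    charCoef n μ (fun x => h x - k x) j q = charCoef n μ h j q - charCoef n μ k j q := by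
  rw [charCoef, charCoef, charCoef, ← integral_sub]
  · simp only [Pi.sub_apply, sub_div, mul_sub]
  · exact integrable_ex_mul (integrable_div_chi hμ hf hg hm hh hi q) _
  · exact integrable_ex_mul (integrable_div_chi hμ hf hg hm hk hki q) _

/-- Continuity of the Fourier coefficients of `h / χ` on `L₂(p)`: the second integral is finite by
minimality, and a large `s` makes its contribution small. -/
lemma two_norm_charCoef_le (hμ : 0 < μ) (hf : IsSpectralDensity f) (hg : IsSpectralDensity g)
    (hm : Minimality n μ f g) (hi : Integrable (fun x => quad (dens n f g x) (h x)) freq)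
    {s : ℝ} (hs : 0 < s) (j : ℤ) (q : Fin T) :
    2 * ‖charCoef n μ h j q‖ ≤ s * ∫ x, quad (dens n f g x) (h x) ∂freq +
      s⁻¹ * ∫ x, ((weight n μ x : ℂ) * (dens n f g x)⁻¹ q q).re ∂freq := by
  have hr : Integrable (fun x => ((weight n μ x : ℂ) * (dens n f g x)⁻¹ q q).re) freq :=
    (hm.integrable_entry hf hg q q).re
  have h1 : ‖charCoef n μ h j q‖ ≤ ∫ x, (1 / 2) * (s * quad (dens n f g x) (h x) +
      s⁻¹ * ((weight n μ x : ℂ) * (dens n f g x)⁻¹ q q).re) ∂freq := by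
    refine norm_integral_le_of_norm_le (((hi.const_mul s).add (hr.const_mul s⁻¹)).const_mul _) ?_
    filter_upwards [ae_two_norm_div_chi_le hμ hf hg hm hs h q] with x hx
    rw [norm_mul, norm_ex, one_mul]
    linarith
  rw [integral_const_mul, integral_add (hi.const_mul s) (hr.const_mul s⁻¹), integral_const_mul,
    integral_const_mul] at h1
  linarith

end CharCoef

/-! ### Finite combinations, and the vanishing of the gap coefficients on their closure. -/

section FinChar

variable {n μ N : ℕ} {f g : ℝ → Matrix (Fin T) (Fin T) ℂ} {h k : ℝ → Fin T → ℂ}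

lemma finChar_apply (n μ : ℕ) (c : ℤ →₀ (Fin T → ℂ)) (x : ℝ) (q : Fin T) :
    finChar n μ c x q = chi n μ x * ∑ k ∈ c.support, ex k x * c k q := by
  simp [finChar, Finsupp.sum, Finset.sum_apply]

lemma finChar_add (n μ : ℕ) (c d : ℤ →₀ (Fin T → ℂ)) (x : ℝ) :
    finChar n μ (c + d) x = finChar n μ c x + finChar n μ d x := by
  rw [finChar, Finsupp.sum_add_index' (by simp) (by simp), smul_add]
  rfl

lemma finChar_smul (n μ : ℕ) (a : ℂ) (c : ℤ →₀ (Fin T → ℂ)) (x : ℝ) :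
    finChar n μ (a • c) x = a • finChar n μ c x := by
  rw [finChar, Finsupp.sum_smul_index' (by simp), finChar, Finsupp.sum, Finsupp.sum,
    smul_comm a, Finset.smul_sum (r := a)]
  congr 1
  exact Finset.sum_congr rfl fun k _ => smul_comm (ex k x) a (c k)

lemma finChar_single (n μ : ℕ) (k : ℤ) (v : Fin T → ℂ) (x : ℝ) :
    finChar n μ (Finsupp.single k v) x = chi n μ x • ex k x • v := by
  simp [finChar]

lemma measurable_finChar (n μ : ℕ) (c : ℤ →₀ (Fin T → ℂ)) : Measurable (finChar n μ c) := by
  refine measurable_pi_iff.2 fun q => ?_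
  simp only [finChar_apply]
  have := measurable_chi n μ
  have := measurable_ex
  fun_prop

lemma norm_finChar_apply_le (n μ : ℕ) (c : ℤ →₀ (Fin T → ℂ)) :
    ∃ C : ℝ, ∀ x q, ‖finChar n μ c x q‖ ≤ C := by
  refine ⟨(μ : ℝ) ^ n * ∑ k ∈ c.support, ‖c k‖, fun x q => ?_⟩
  rw [finChar_apply, norm_mul]
  refine mul_le_mul (norm_chi_le n μ x) ((norm_sum_le _ _).trans (Finset.sum_le_sum fun k _ => ?_))
    (norm_nonneg _) (by positivity)
  rw [norm_mul, norm_ex, one_mul]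
  exact norm_le_pi_norm (c k) q

lemma integrable_quad_finChar (hf : IsSpectralDensity f) (n μ : ℕ) (c : ℤ →₀ (Fin T → ℂ)) :
    Integrable (fun x => quad (f x) (finChar n μ c x)) freq := by
  obtain ⟨C, hC⟩ := norm_finChar_apply_le n μ c
  exact integrable_quad_of_bounded hf.integrable (measurable_finChar n μ c).aemeasurable
    (Filter.Eventually.of_forall fun x => hC x)

/-- Division by `χ` leaves a trigonometric polynomial whose frequencies all avoid the gap `0, …, N +
μ n`. -/
lemma charCoef_finChar (hμ : 0 < μ) {c : ℤ →₀ (Fin T → ℂ)} (hc : (c.support : Set ℤ) ⊆ obs n μ N)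
    {j : ℕ} (hj : j < N + μ * n + 1) (q : Fin T) : charCoef n μ (finChar n μ c) j q = 0 := by
  have h1 : charCoef n μ (finChar n μ c) j q =
      ∫ x, ∑ k ∈ c.support, c k q * ex (k - j) x ∂freq := by
    refine integral_congr_ae ?_
    filter_upwards [ae_regular hμ] with x hx
    rw [finChar_apply, mul_div_cancel_left₀ _ (chi_ne_zero hx), Finset.mul_sum]
    refine Finset.sum_congr rfl fun k _ => ?_
    rw [sub_eq_add_neg, ex_add]
    ring
  rw [h1, integral_finsetSum]
  · refine Finset.sum_eq_zero fun k hk => ?_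
    rw [integral_const_mul, integral_ex, if_neg, mul_zero]
    have := hc hk
    simp only [obs, Set.mem_ofPred_eq] at this
    have hj' : (j : ℤ) < N + μ * n + 1 := by exact_mod_cast hj
    omega
  · intro k _
    refine Integrable.const_mul ?_ _
    simpa using integrable_ex_mul (integrable_const (μ := freq) (1 : ℂ)) (k - j)

/-- `charSpace` itself asks only for measurability and approximability. One finite combination at
finite distance suffices, because its characteristic is bounded. -/
lemma integrable_quad_of_mem_charSpace (hf : IsSpectralDensity f) (hg : IsSpectralDensity g)
    (hh : h ∈ charSpace n μ N f g) : Integrable (fun x => quad (dens n f g x) (h x)) freq := by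
  obtain ⟨hm, hε⟩ := hh
  have hp := hf.dens hg n
  obtain ⟨c, -, hc⟩ := hε 1 one_pos
  have h1 := integrable_quad_of_sqNorm_lt_top hp
    (hm.sub (measurable_finChar n μ c).aemeasurable) (hc.trans ENNReal.one_lt_top)
  have h2 := integrable_quad_add hp.posSemidef hp.aemeasEntries
    (hm.sub (measurable_finChar n μ c).aemeasurable) (measurable_finChar n μ c).aemeasurable
    h1 (integrable_quad_finChar hp n μ c)
  simpa using h2

lemma charCoef_eq_zero_of_mem_charSpace (hμ : 0 < μ) (hf : IsSpectralDensity f)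
    (hg : IsSpectralDensity g) (hm : Minimality n μ f g) (hh : h ∈ charSpace n μ N f g)
    {j : ℕ} (hj : j < N + μ * n + 1) (q : Fin T) : charCoef n μ h j q = 0 := by
  have hi := integrable_quad_of_mem_charSpace hf hg hh
  have hp := hf.dens hg n
  set R := ∫ x, ((weight n μ x : ℂ) * (dens n f g x)⁻¹ q q).re ∂freq with hR
  have key : ∀ s : ℝ, 0 < s → 2 * ‖charCoef n μ h j q‖ ≤ s⁻¹ * (1 + R) := by
    intro s hs
    -- Accuracy `s⁻²` makes the term `s ∫ quad` as small as the other term, of order `s⁻¹`; then `s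
    -- → ∞`.
    obtain ⟨c, hc, hε⟩ := hh.2 (ENNReal.ofReal ((s⁻¹) ^ 2)) (by positivity)
    have hcm := (measurable_finChar n μ c).aemeasurable (μ := freq)
    have hci := integrable_quad_finChar hp n μ c
    have hdi := integrable_quad_sub hp.posSemidef hp.aemeasEntries hh.1 hcm hi hci
    have h1 := two_norm_charCoef_le hμ hf hg hm hdi hs j q
    rw [charCoef_sub hμ hf hg hm hh.1 hi hcm hci, charCoef_finChar hμ hc hj, sub_zero] at h1
    have h2 : sqNorm (dens n f g) (h - finChar n μ c) =
        ENNReal.ofReal (∫ x, quad (dens n f g x) (h x - finChar n μ c x) ∂freq) :=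
      sqNorm_eq_ofReal hp.posSemidef hdi
    rw [h2, ENNReal.ofReal_lt_ofReal_iff (by positivity)] at hε
    have h3 := mul_le_mul_of_nonneg_left hε.le hs.le
    have h4 : s * s⁻¹ ^ 2 = s⁻¹ := by field_simp
    linarith
  have hlim : Filter.Tendsto (fun s : ℝ => s⁻¹ * (1 + R)) Filter.atTop (nhds 0) := by
    simpa using tendsto_inv_atTop_zero.mul_const (1 + R)
  have := ge_of_tendsto hlim ((Filter.eventually_gt_atTop 0).mono key)
  exact norm_le_zero_iff.1 (by linarith)

end FinChar

/-! ### The converse: vanishing gap coefficients imply membership. -/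

section Duality

variable {n μ N : ℕ} {f g : ℝ → Matrix (Fin T) (Fin T) ℂ} {h : ℝ → Fin T → ℂ}

/-- With `p = S * S` and `S` hermitian, `h ↦ h S` is an isometry of `L₂(p)` into the ordinary
vector-valued `L₂`, where orthogonal complements are available. -/
lemma sesq_mul_self {S : Matrix (Fin T) (Fin T) ℂ} (hS : S.IsHermitian) (u v : Fin T → ℂ) :
    sesq (S * S) u v = dotProduct (Matrix.vecMul u S) (star (Matrix.vecMul v S)) := by
  rw [sesq_eq_vecMul, ← Matrix.vecMul_vecMul, ← Matrix.dotProduct_mulVec, Matrix.star_vecMul, hS.eq]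

/-- The image of `h` in `L₂` under the square root `S` of the density. -/
def sqrtImage (S : ℝ → Matrix (Fin T) (Fin T) ℂ) (h : ℝ → Fin T → ℂ) (x : ℝ) :
    EuclideanSpace ℂ (Fin T) := WithLp.toLp 2 (Matrix.vecMul (h x) (S x))

variable {S p : ℝ → Matrix (Fin T) (Fin T) ℂ}

lemma aemeasurable_sqrtImage (hS : AEMeasEntries S) (hh : AEMeasurable h freq) :
    AEMeasurable (sqrtImage S h) freq :=
  (WithLp.measurable_toLp 2 (Fin T → ℂ)).comp_aemeasurable (aemeasurable_vecMul hS hh)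

lemma norm_sqrtImage_sq {x : ℝ} (hS : (S x).IsHermitian ∧ S x * S x = p x) :
    ‖sqrtImage S h x‖ ^ 2 = quad (p x) (h x) := by
  rw [← hS.2, quad_eq_sesq, sesq_mul_self hS.1, EuclideanSpace.norm_sq_eq, dotProduct,
    Complex.re_sum]
  refine Finset.sum_congr rfl fun i _ => ?_
  rw [Pi.star_apply, Complex.star_def, Complex.mul_conj, Complex.ofReal_re,
    Complex.normSq_eq_norm_sq]
  rfl

lemma memLp_sqrtImage (hS : AEMeasEntries S)
    (hSp : ∀ᵐ x ∂freq, (S x).IsHermitian ∧ S x * S x = p x) (hh : AEMeasurable h freq)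
    (hi : Integrable (fun x => quad (p x) (h x)) freq) : MemLp (sqrtImage S h) 2 freq := by
  rw [memLp_two_iff_integrable_sq_norm (aemeasurable_sqrtImage hS hh).aestronglyMeasurable]
  refine hi.congr ?_
  filter_upwards [hSp] with x hx using (norm_sqrtImage_sq hx).symm

/-- The squared column norm of `S` is a diagonal entry of `p`, which is integrable. -/
lemma memLp_sqrt_entry (hS : AEMeasEntries S)
    (hSp : ∀ᵐ x ∂freq, (S x).IsHermitian ∧ S x * S x = p x) (hp : IsSpectralDensity p)
    (i j : Fin T) : MemLp (fun x => S x i j) 2 freq := by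
  rw [memLp_two_iff_integrable_sq_norm (hS i j).aestronglyMeasurable]
  refine (hp.integrable j j).re.mono' ((hS i j).norm.pow_const 2).aestronglyMeasurable ?_
  filter_upwards [hSp] with x hx
  have h1 : p x j j = ∑ l, ((‖S x l j‖ ^ 2 : ℝ) : ℂ) := by
    rw [← hx.2, Matrix.mul_apply]
    refine Finset.sum_congr rfl fun l _ => ?_
    rw [← hx.1.apply j l, Complex.star_def, mul_comm, Complex.mul_conj, Complex.normSq_eq_norm_sq]
  have h2 : RCLike.re (p x j j) = ∑ l, ‖S x l j‖ ^ 2 := by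
    rw [h1, ← Complex.ofReal_sum]; exact Complex.ofReal_re _
  rw [h2, Real.norm_of_nonneg (by positivity)]
  exact Finset.single_le_sum (f := fun l => ‖S x l j‖ ^ 2) (fun _ _ => by positivity)
    (Finset.mem_univ i)

lemma inner_sqrtImage {x : ℝ} (hS : (S x).IsHermitian) (y : EuclideanSpace ℂ (Fin T))
    (h : ℝ → Fin T → ℂ) : inner ℂ (sqrtImage S h x) y =
      ∑ q, Matrix.vecMul y (S x) q * star (h x q) := by
  rw [EuclideanSpace.inner_eq_star_dotProduct, sqrtImage, WithLp.ofLp_toLp, Matrix.star_vecMul,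
    hS.eq, Matrix.dotProduct_mulVec]
  rfl

/-- The image in `L₂` of the characteristics of finite combinations of observed increments. -/
def finCharSubmodule (n μ N : ℕ) (S : ℝ → Matrix (Fin T) (Fin T) ℂ) :
    Submodule ℂ (Lp (EuclideanSpace ℂ (Fin T)) 2 freq) where
  carrier := {y | ∃ c : ℤ →₀ (Fin T → ℂ), (c.support : Set ℤ) ⊆ obs n μ N ∧
    y =ᵐ[freq] sqrtImage S (finChar n μ c)}
  zero_mem' := by
    refine ⟨0, by simp, ?_⟩
    filter_upwards [Lp.coeFn_zero (EuclideanSpace ℂ (Fin T)) 2 freq] with x hx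
    rw [hx]
    simp [sqrtImage, finChar]
  add_mem' := by
    rintro y z ⟨c, hc, hy⟩ ⟨d, hd, hz⟩
    refine ⟨c + d, fun k hk => ?_, ?_⟩
    · rcases Finset.mem_union.1 (Finsupp.support_add hk) with h | h
      exacts [hc h, hd h]
    · filter_upwards [Lp.coeFn_add y z, hy, hz] with x h1 h2 h3
      rw [h1, Pi.add_apply, h2, h3]
      simp only [sqrtImage, finChar_add, Matrix.add_vecMul, WithLp.toLp_add]
  smul_mem' := by
    rintro a y ⟨c, hc, hy⟩
    refine ⟨a • c, fun k hk => hc (Finsupp.support_smul hk), ?_⟩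
    filter_upwards [Lp.coeFn_smul a y, hy] with x h1 h2
    rw [h1, Pi.smul_apply, h2]
    simp only [sqrtImage, finChar_smul, Matrix.smul_vecMul, WithLp.toLp_smul]

lemma norm_sub_sq_eq_integral {y z : Lp (EuclideanSpace ℂ (Fin T)) 2 freq} {k : ℝ → Fin T → ℂ}
    (hSp : ∀ᵐ x ∂freq, (S x).IsHermitian ∧ S x * S x = p x) (hy : y =ᵐ[freq] sqrtImage S h)
    (hz : z =ᵐ[freq] sqrtImage S k) :
    ‖y - z‖ ^ 2 = ∫ x, quad (p x) (h x - k x) ∂freq := by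
  have h1 : ‖y - z‖ ^ 2 = RCLike.re (inner ℂ (y - z) (y - z)) := norm_sq_eq_re_inner _
  have h2 : inner ℂ (y - z) (y - z) = ∫ x, ((quad (p x) (h x - k x) : ℝ) : ℂ) ∂freq := by
    rw [L2.inner_def]
    refine integral_congr_ae ?_
    filter_upwards [Lp.coeFn_sub y z, hy, hz, hSp] with x h3 h4 h5 h6
    have h7 : sqrtImage S h x - sqrtImage S k x = sqrtImage S (fun x => h x - k x) x := by
      simp only [sqrtImage, Matrix.sub_vecMul, WithLp.toLp_sub]
    rw [h3, Pi.sub_apply, h4, h5, h7, inner_self_eq_norm_sq_to_K,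
      ← norm_sqrtImage_sq (h := fun x => h x - k x) h6]
    simp
  rw [h1, h2]
  exact (congrArg Complex.re integral_complex_ofReal).trans (Complex.ofReal_re _)

/-- Under the minimality condition, the characteristics are the elements `h` of `L₂(p)` such that
the Fourier coefficients of `h / χ` with numbers `0, …, N + μ n` vanish. -/
theorem mem_charSpace_of_charCoef_eq_zero {f g : ℝ → Matrix (Fin T) (Fin T) ℂ} (hμ : 0 < μ)
    (hf : IsSpectralDensity f) (hg : IsSpectralDensity g) (hm : Minimality n μ f g)
    (hh : AEMeasurable h freq) (hi : Integrable (fun x => quad (dens n f g x) (h x)) freq)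
    (h0 : ∀ j : ℕ, j < N + μ * n + 1 → ∀ q, charCoef n μ h j q = 0) : h ∈ charSpace n μ N f g := by
  have hp := hf.dens hg n
  obtain ⟨S, hS, hSp⟩ := exists_aemeasurable_sqrt hp.posSemidef hp.aemeasEntries
  have hL := memLp_sqrtImage hS hSp hh hi
  have hx0 := hL.coeFn_toLp
  set x0 := hL.toLp (sqrtImage S h)
  have hfin : ∀ c, MemLp (sqrtImage S (finChar n μ c)) 2 freq := fun c =>
    memLp_sqrtImage hS hSp (measurable_finChar n μ c).aemeasurable (integrable_quad_finChar hp n μ c)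
  have hcl : x0 ∈ (finCharSubmodule n μ N S).topologicalClosure := by
    -- A closed span is a double orthogonal complement; it remains to show that every `y` orthogonal
    -- to the generators is orthogonal to the image of `h`.
    rw [← Submodule.orthogonal_orthogonal_eq_closure, Submodule.mem_orthogonal]
    intro y hy
    rw [Submodule.mem_orthogonal] at hy
    -- `F` has only the Fourier coefficients with the numbers of the unobserved increments
    set F : Fin T → ℝ → ℂ := fun q x => star (chi n μ x) * Matrix.vecMul (y x) (S x) q with hF
    have hyi : ∀ i, MemLp (fun x => y x i) 2 freq := fun i =>
      (Lp.memLp y).of_le_mul (c := 1)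
        ((aemeasurable_pi_iff.1 ((WithLp.measurable_ofLp 2 (Fin T → ℂ)).comp_aemeasurable
          (Lp.memLp y).1.aemeasurable)) i).aestronglyMeasurable
        (Filter.Eventually.of_forall fun x => by
          rw [one_mul]; exact PiLp.norm_apply_le (y x) i)
    have hFi : ∀ q, Integrable (F q) freq := by
      intro q
      refine Integrable.bdd_mul (c := (μ : ℝ) ^ n) ?_
        (continuous_star.measurable.comp (measurable_chi n μ)).aestronglyMeasurable
        (Filter.Eventually.of_forall fun x => by rw [norm_star]; exact norm_chi_le n μ x)
      simp only [Matrix.vecMul, dotProduct]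
      exact integrable_finsetSum _ fun i _ =>
        (hyi i).integrable_mul (memLp_sqrt_entry hS hSp hp i q)
    have hF0 : ∀ q, ∀ k ∈ obs n μ N, ∫ x, ex (-k) x * F q x ∂freq = 0 := by
      intro q k hk
      rw [← hy ((hfin (Finsupp.single k (Pi.single q 1))).toLp _)
        ⟨_, fun l hl => by
          have := Finsupp.support_single_subset hl
          rw [Finset.mem_singleton] at this
          rwa [this], (hfin _).coeFn_toLp⟩, L2.inner_def]
      refine integral_congr_ae ?_
      filter_upwards [hSp, (hfin (Finsupp.single k (Pi.single q 1))).coeFn_toLp] with x h1 h2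
      rw [h2, inner_sqrtImage h1.1, Finset.sum_eq_single q]
      · rw [finChar_single, ← star_ex]
        simp only [hF, Pi.smul_apply, Pi.single_eq_same, smul_eq_mul, mul_one, star_mul']
        ring
      · intro b _ hb
        rw [finChar_single]
        simp [hb]
      · simp
    -- Only the gap coefficients of `F q` can survive, so `F q` is a trigonometric polynomial with
    -- frequencies `0, …, N + μ n`. The signs are reversed twice: coefficients are indexed by `-j`,
    -- exponentials by `j`.
    have hFsum : ∀ q, F q =ᵐ[freq] fun x => ∑ j ∈ Finset.range (N + μ * n + 1),
        avg (fun y => ex (-(j : ℤ)) y * F q y) * ex j x := by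
      intro q
      have h1 := ae_eq_sum_of_fourier_eq_zero (hFi q)
        ((Finset.range (N + μ * n + 1)).image fun j : ℕ => -(j : ℤ)) fun k hk => by
          rw [← neg_neg k]
          refine hF0 q _ ?_
          by_contra h2
          refine hk (Finset.mem_image.2 ⟨(-k).toNat, ?_, ?_⟩)
          all_goals
            simp only [obs, Set.mem_ofPred_eq, not_or, not_le] at h2
          · rw [Finset.mem_range, Int.toNat_lt (by omega)]
            push_cast
            omega
          · omega
      refine h1.trans (Filter.Eventually.of_forall fun x => ?_)
      simp only
      rw [Finset.sum_image (fun a _ b _ hab => by simpa using hab)]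
      simp only [neg_neg]
    -- Writing `y S = F / χ̄` moves the denominator to `h`: the inner product is a finite
    -- combination of conjugated gap coefficients of `h / χ`, all zero.
    have hconj : inner ℂ x0 y = 0 := by
      rw [L2.inner_def]
      have hdiv : ∀ q, Integrable (fun x => h x q / chi n μ x) freq := fun q =>
        integrable_div_chi hμ hf hg hm hh hi q
      have h1 : ∫ x, inner ℂ (x0 x) (y x) ∂freq = ∫ x, ∑ q, ∑ j ∈ Finset.range (N + μ * n + 1),
          avg (fun y => ex (-(j : ℤ)) y * F q y) *
            star (ex (-(j : ℤ)) x * (h x q / chi n μ x)) ∂freq := by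
        refine integral_congr_ae ?_
        filter_upwards [hx0, hSp, ae_regular hμ, ae_all_iff.2 hFsum] with x h2 h3 h4 h5
        rw [h2, inner_sqrtImage h3.1]
        refine Finset.sum_congr rfl fun q _ => ?_
        have h6 : star (chi n μ x) ≠ 0 := star_ne_zero.2 (chi_ne_zero h4)
        have h7 : Matrix.vecMul (y x) (S x) q = F q x / star (chi n μ x) := by
          simp only [hF]; field_simp
        rw [h7, h5 q, Finset.sum_div, Finset.sum_mul]
        refine Finset.sum_congr rfl fun j _ => ?_
        rw [star_mul', star_ex, neg_neg, star_div₀]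
        field_simp
      rw [h1, integral_finsetSum]
      · refine Finset.sum_eq_zero fun q _ => ?_
        rw [integral_finsetSum]
        · refine Finset.sum_eq_zero fun j hj => ?_
          have h2 : ∫ x, star (ex (-(j : ℤ)) x * (h x q / chi n μ x)) ∂freq =
              star (charCoef n μ h j q) := integral_conj
          rw [integral_const_mul, h2, h0 j (Finset.mem_range.1 hj) q, star_zero, mul_zero]
        · intro j _
          exact ((Complex.conjCLE.toContinuousLinearMap).integrable_comp
            (integrable_ex_mul (hdiv q) _)).const_mul _
      · intro q _
        exact integrable_finsetSum _ fun j _ => ((Complex.conjCLE.toContinuousLinearMap).integrable_comp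
            (integrable_ex_mul (hdiv q) _)).const_mul _
    rw [← inner_conj_symm, hconj, map_zero]
  refine ⟨hh, fun ε hε => ?_⟩
  obtain ⟨δ, hδ, hδε⟩ : ∃ δ : ℝ, 0 < δ ∧ ENNReal.ofReal (δ ^ 2) < ε := by
    obtain ⟨r, hr0, hr⟩ := ENNReal.lt_iff_exists_nnreal_btwn.1 hε
    refine ⟨Real.sqrt r, Real.sqrt_pos.2 (by exact_mod_cast hr0), ?_⟩
    rw [Real.sq_sqrt r.coe_nonneg]
    simpa using hr
  obtain ⟨z, ⟨c, hc, hz⟩, hxz⟩ := Metric.mem_closure_iff.1 hcl δ hδ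
  refine ⟨c, hc, ?_⟩
  have hdi := integrable_quad_sub hp.posSemidef hp.aemeasEntries hh
    (measurable_finChar n μ c).aemeasurable hi (integrable_quad_finChar hp n μ c)
  have h2 : sqNorm (dens n f g) (h - finChar n μ c) =
      ENNReal.ofReal (∫ x, quad (dens n f g x) (h x - finChar n μ c x) ∂freq) :=
    sqNorm_eq_ofReal hp.posSemidef hdi
  rw [h2, ← norm_sub_sq_eq_integral hSp hx0 hz]
  refine lt_of_le_of_lt (ENNReal.ofReal_le_ofReal ?_) hδε
  rw [dist_eq_norm] at hxz
  exact pow_le_pow_left₀ (norm_nonneg _) hxz.le 2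

end Duality

/-! ### Identities between the coefficients -/

lemma one_sub_X_pow_mul_mk {μ : ℕ} (hμ : 0 < μ) :
    (1 - PowerSeries.X ^ μ) * PowerSeries.mk (fun j => if μ ∣ j then (1 : ℂ) else 0) = 1 := by
  ext k
  rw [sub_mul, one_mul, map_sub, PowerSeries.coeff_mk, PowerSeries.coeff_X_pow_mul',
    PowerSeries.coeff_one]
  rcases lt_or_ge k μ with h | h
  · rw [if_neg (not_le.2 h), sub_zero]
    congr 1
    exact propext ⟨fun hd => Nat.eq_zero_of_dvd_of_lt hd h, fun h0 => h0 ▸ dvd_zero _⟩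
  · rw [if_pos h, PowerSeries.coeff_mk, if_neg (by omega : k ≠ 0)]
    have : μ ∣ k - μ ↔ μ ∣ k := by
      rw [← Nat.dvd_add_self_right (m := μ) (n := k - μ), Nat.sub_add_cancel h]
    simp [this]

/-- The numbers `d_μ` are the coefficients of the inverse of `(1 - X^μ)^n`. -/
lemma sum_choose_mul_dCoeff (n : ℕ) {μ : ℕ} (hμ : 0 < μ) (r : ℕ) :
    ∑ l ∈ (Finset.range (n + 1)).filter (fun l => l * μ ≤ r),
      ((-1 : ℂ) ^ l * (n.choose l : ℂ)) * dCoeff n μ (r - l * μ) = if r = 0 then 1 else 0 := by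
  have h1 : (1 - PowerSeries.X ^ μ) ^ n *
      (PowerSeries.mk (fun j => if μ ∣ j then (1 : ℂ) else 0)) ^ n = 1 := by
    rw [← mul_pow, one_sub_X_pow_mul_mk hμ, one_pow]
  have h2 : ((1 : PowerSeries ℂ) - PowerSeries.X ^ μ) ^ n = ∑ l ∈ Finset.range (n + 1),
      PowerSeries.C ((-1 : ℂ) ^ l * (n.choose l : ℂ)) * PowerSeries.X ^ (l * μ) := by
    rw [sub_eq_neg_add, add_pow]
    refine Finset.sum_congr rfl fun l _ => ?_
    rw [neg_pow, ← pow_mul, one_pow, mul_comm μ l]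
    simp only [map_mul, map_pow, map_neg, map_one, map_natCast]
    ring
  have h3 := congrArg (PowerSeries.coeff r) h1
  rw [h2, Finset.sum_mul, map_sum, PowerSeries.coeff_one] at h3
  rw [← h3, Finset.sum_filter]
  refine Finset.sum_congr rfl fun l _ => ?_
  rw [mul_assoc (PowerSeries.C _), PowerSeries.coeff_C_mul, PowerSeries.coeff_X_pow_mul', dCoeff]
  simp

/-- The vector `b` is `a` acted on by the inverse of the difference operator `(1 - X^μ)^n` in the
forward direction, so taking differences of `b` recovers `a`. -/
lemma sum_choose_smul_bCoeff (n : ℕ) {μ : ℕ} (hμ : 0 < μ) {N m : ℕ} (a : ℕ → Fin T → ℂ)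
    (hm : m ≤ N) :
    ∑ l ∈ (Finset.range (n + 1)).filter (fun l => m + l * μ ≤ N),
      ((-1 : ℂ) ^ l * (n.choose l : ℂ)) • bCoeff n μ N a (m + l * μ) = a m := by
  have h1 : ∀ l, ∑ r ∈ Finset.Icc (m + l * μ) N, dCoeff n μ (r - (m + l * μ)) • a r =
      ∑ r ∈ Finset.Icc m N, if l * μ ≤ r - m then dCoeff n μ (r - m - l * μ) • a r else 0 := by
    intro l
    rw [← Finset.sum_filter]
    refine Finset.sum_congr ?_ fun r _ => by rw [Nat.sub_sub]
    ext r
    simp only [Finset.mem_Icc, Finset.mem_filter]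
    omega
  -- Beyond `N` the coefficients `b` vanish, so the truncation of the sum over `l` costs nothing.
  have h2 : ∀ l ∈ Finset.range (n + 1), ¬ m + l * μ ≤ N → bCoeff n μ N a (m + l * μ) = 0 := by
    intro l _ hl
    rw [bCoeff, Finset.Icc_eq_empty hl, Finset.sum_empty]
  rw [Finset.sum_filter]
  have h3 : ∀ l ∈ Finset.range (n + 1), (if m + l * μ ≤ N then
      ((-1 : ℂ) ^ l * (n.choose l : ℂ)) • bCoeff n μ N a (m + l * μ) else 0) =
      ∑ r ∈ Finset.Icc m N, if l * μ ≤ r - m then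
        (((-1 : ℂ) ^ l * (n.choose l : ℂ)) * dCoeff n μ (r - m - l * μ)) • a r else 0 := by
    intro l hl
    have h4 : (if m + l * μ ≤ N then
        ((-1 : ℂ) ^ l * (n.choose l : ℂ)) • bCoeff n μ N a (m + l * μ) else 0) =
        ((-1 : ℂ) ^ l * (n.choose l : ℂ)) • bCoeff n μ N a (m + l * μ) := by
      split_ifs with h
      · rfl
      · rw [h2 l hl h, smul_zero]
    rw [h4, bCoeff, h1, Finset.smul_sum]
    refine Finset.sum_congr rfl fun r _ => ?_
    split_ifs
    · rw [smul_smul]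
    · simp
  rw [Finset.sum_congr rfl h3, Finset.sum_comm]
  have h5 : ∀ r ∈ Finset.Icc m N, (∑ l ∈ Finset.range (n + 1), if l * μ ≤ r - m then
      (((-1 : ℂ) ^ l * (n.choose l : ℂ)) * dCoeff n μ (r - m - l * μ)) • a r else 0) =
      if r = m then a r else 0 := by
    intro r hr
    rw [← Finset.sum_filter, ← Finset.sum_smul, sum_choose_mul_dCoeff n hμ]
    have : r - m = 0 ↔ r = m := by
      have := (Finset.mem_Icc.1 hr).1
      omega
    simp only [this]
    split_ifs <;> simp
  rw [Finset.sum_congr rfl h5, Finset.sum_ite_eq' _ m, if_pos (Finset.mem_Icc.2 ⟨le_rfl, hm⟩)]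

/-- Rearrangement of a sum of increments according to the sign of the index. -/
lemma sum_mul_increment (n μ N : ℕ) (β s : ℕ → ℂ) (ξ : ℤ → ℂ) :
    ∑ k ∈ Finset.range (N + 1), β k * ∑ l ∈ Finset.range (n + 1), s l * ξ ((k : ℤ) - l * (μ : ℤ)) =
      (∑ m ∈ Finset.range (N + 1),
        (∑ l ∈ (Finset.range (n + 1)).filter (fun l => m + l * μ ≤ N), s l * β (m + l * μ)) *
          ξ m) +
      ∑ k ∈ Finset.Icc 1 (μ * n),
        (∑ l ∈ (Finset.range (n + 1)).filter (fun l => k ≤ l * μ ∧ l * μ ≤ N + k),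
          s l * β (l * μ - k)) * ξ (-(k : ℤ)) := by
  simp only [Finset.mul_sum, Finset.sum_mul, Finset.sum_filter]
  rw [Finset.sum_comm, Finset.sum_comm (s := Finset.range (N + 1)),
    Finset.sum_comm (s := Finset.Icc 1 (μ * n)), ← Finset.sum_add_distrib]
  refine Finset.sum_congr rfl fun l hl => ?_
  -- For fixed `l` the time `k - l μ` is nonnegative or lies in `-μ n, …, -1`; the first case gives
  -- the functional, the second the initial values.
  rw [← Finset.sum_filter_add_sum_filter_not _ (fun k => l * μ ≤ k)]
  simp only [ite_mul, zero_mul]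
  rw [← Finset.sum_filter, ← Finset.sum_filter]
  have hl' : l * μ ≤ μ * n := by
    rw [mul_comm]
    exact Nat.mul_le_mul_left _ (Nat.lt_succ_iff.1 (Finset.mem_range.1 hl))
  congr 1
  · refine Finset.sum_bij' (fun k _ => k - l * μ) (fun m _ => m + l * μ) ?_ ?_ ?_ ?_ ?_
    · intro k hk
      simp only [Finset.mem_filter, Finset.mem_range] at hk ⊢
      omega
    · intro m hm
      simp only [Finset.mem_filter, Finset.mem_range] at hm ⊢
      omega
    · intro k hk
      simp only [Finset.mem_filter, Finset.mem_range] at hk ⊢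
      omega
    · intro m hm
      simp
    · intro k hk
      simp only [Finset.mem_filter, Finset.mem_range] at hk
      rw [Nat.sub_add_cancel hk.2, Nat.cast_sub hk.2]
      push_cast
      ring
  · refine Finset.sum_bij' (fun k _ => l * μ - k) (fun m _ => l * μ - m) ?_ ?_ ?_ ?_ ?_
    · intro k hk
      simp only [Finset.mem_filter, Finset.mem_range, Finset.mem_Icc] at hk ⊢
      omega
    · intro m hm
      simp only [Finset.mem_filter, Finset.mem_range, Finset.mem_Icc] at hm ⊢
      omega
    · intro k hk
      simp only [Finset.mem_filter, Finset.mem_range] at hk ⊢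
      omega
    · intro m hm
      simp only [Finset.mem_filter, Finset.mem_Icc] at hm ⊢
      omega
    · intro k hk
      simp only [Finset.mem_filter, Finset.mem_range, not_le] at hk
      rw [Nat.sub_sub_self hk.2.le, Nat.cast_sub hk.2.le]
      push_cast
      rw [neg_sub]
      ring

/-- The functional and the functional of the initial values add up to a functional of the
increments. -/
lemma sum_bCoeff_mul_incr {Ω : Type*} (n : ℕ) {μ : ℕ} (hμ : 0 < μ) (N : ℕ) (a : ℕ → Fin T → ℂ)
    (ξ : ℤ → Fin T → Ω → ℂ) (ω : Ω) :
    ∑ k ∈ Finset.range (N + 1), ∑ p, bCoeff n μ N a k p * incr n ξ k μ p ω =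
      functional N a ξ ω + initFunctional n μ N a ξ ω := by
  rw [functional, initFunctional, Finset.sum_comm, Finset.sum_comm (s := Finset.range (N + 1)),
    Finset.sum_comm (s := Finset.Icc 1 (μ * n)), ← Finset.sum_add_distrib]
  refine Finset.sum_congr rfl fun p _ => ?_
  simp only [incr]
  rw [sum_mul_increment n μ N (fun k => bCoeff n μ N a k p)
    (fun l => (-1 : ℂ) ^ l * (n.choose l : ℂ)) fun m => ξ m p ω]
  congr 1
  · refine Finset.sum_congr rfl fun m hm => ?_
    have := congrFun (sum_choose_smul_bCoeff n hμ a
      (Nat.lt_succ_iff.1 (Finset.mem_range.1 hm))) p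
    rw [← this]
    simp [Finset.sum_apply]
  · refine Finset.sum_congr rfl fun k _ => ?_
    simp [vCoeff, Finset.sum_apply]

lemma one_sub_pow_eq_sum (n : ℕ) (z : ℂ) :
    (1 - z) ^ n = ∑ l ∈ Finset.range (n + 1), (-1 : ℂ) ^ l * (n.choose l : ℂ) * z ^ l := by
  rw [sub_eq_neg_add, add_pow]
  refine Finset.sum_congr rfl fun l _ => ?_
  rw [neg_pow, one_pow]
  ring

/-- Multiplication by `(1 - e^{ixμ})^n` is a convolution of coefficients, and it raises the degree
by `μ n`, so the cutoff `N + μ n` loses nothing. -/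
lemma poly_aCoeff (n μ N : ℕ) (a : ℕ → Fin T → ℂ) (x : ℝ) :
    poly (N + μ * n) (aCoeff n μ N a) x = (1 - ex (μ : ℤ) x) ^ n • poly N a x := by
  simp only [poly, aCoeff, Finset.smul_sum, Finset.sum_filter]
  rw [Finset.sum_comm, one_sub_pow_eq_sum]
  simp only [Finset.sum_smul]
  rw [Finset.sum_comm (s := Finset.range (N + 1))]
  refine Finset.sum_congr rfl fun l hl => ?_
  have hl' : μ * l ≤ μ * n :=
    Nat.mul_le_mul_left _ (Nat.lt_succ_iff.1 (Finset.mem_range.1 hl))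
  simp only [smul_ite, smul_zero]
  rw [← Finset.sum_filter]
  refine Finset.sum_bij' (fun k _ => k - μ * l) (fun m _ => m + μ * l) ?_ ?_ ?_ ?_ ?_
  · intro k hk
    simp only [Finset.mem_filter, Finset.mem_range] at hk ⊢
    omega
  · intro m hm
    simp only [Finset.mem_filter, Finset.mem_range] at hm ⊢
    omega
  · intro k hk
    simp only [Finset.mem_filter, Finset.mem_range] at hk ⊢
    omega
  · intro m hm
    simp
  · intro k hk
    simp only [Finset.mem_filter, Finset.mem_range] at hk
    have h1 : ex (k : ℤ) x = ex ((k - μ * l : ℕ) : ℤ) x * ex (μ : ℤ) x ^ l := by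
      rw [← ex_mul_nat, ← ex_add]
      congr 1
      rw [Nat.cast_sub hk.2.1]
      push_cast
      ring
    rw [h1, smul_smul, smul_smul]
    congr 1
    ring

/-! ### Vector trigonometric polynomials and block Toeplitz matrices -/

/-- The vector trigonometric polynomial with a given vector of coefficients. -/
def tpoly {K : ℕ} (c : Fin K × Fin T → ℂ) (x : ℝ) : Fin T → ℂ :=
  ∑ k : Fin K, ex (k : ℤ) x • fun p => c (k, p)

section Tpoly

variable {K : ℕ} (c : Fin K × Fin T → ℂ)

lemma tpoly_apply (x : ℝ) (q : Fin T) : tpoly c x q = ∑ k : Fin K, ex (k : ℤ) x * c (k, q) := by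
  simp [tpoly, Finset.sum_apply]

lemma poly_eq_tpoly (N : ℕ) (a : ℕ → Fin T → ℂ) :
    poly N a = tpoly fun i : Fin (N + 1) × Fin T => a i.1 i.2 := by
  funext x
  rw [poly, tpoly, Finset.sum_range]

lemma measurable_tpoly : Measurable (tpoly c) := by
  refine measurable_pi_iff.2 fun q => ?_
  simp only [tpoly_apply]
  have := measurable_ex
  fun_prop

lemma norm_tpoly_apply_le : ∃ C : ℝ, ∀ x q, ‖tpoly c x q‖ ≤ C := by
  refine ⟨∑ q, ∑ k, ‖c (k, q)‖, fun x q => ?_⟩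
  rw [tpoly_apply]
  refine (norm_sum_le _ _).trans ?_
  simp only [norm_mul, norm_ex, one_mul]
  exact Finset.single_le_sum (f := fun q => ∑ k, ‖c (k, q)‖)
    (fun _ _ => Finset.sum_nonneg fun _ _ => norm_nonneg _) (Finset.mem_univ q)

lemma measurable_poly (N : ℕ) (a : ℕ → Fin T → ℂ) : Measurable (poly N a) := by
  rw [poly_eq_tpoly]; exact measurable_tpoly _

lemma norm_poly_apply_le (N : ℕ) (a : ℕ → Fin T → ℂ) : ∃ C : ℝ, ∀ x q, ‖poly N a x q‖ ≤ C := by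
  rw [poly_eq_tpoly]; exact norm_tpoly_apply_le _

variable {c} {M : ℝ → Matrix (Fin T) (Fin T) ℂ}

lemma integrable_sesq_tpoly (hM : ∀ i j, Integrable (fun x => M x i j) freq) :
    Integrable (fun x => sesq (M x) (tpoly c x) (tpoly c x)) freq := by
  obtain ⟨C, hC⟩ := norm_tpoly_apply_le c
  exact integrable_sesq_of_bounded hM (measurable_tpoly c).aemeasurable
    (measurable_tpoly c).aemeasurable (Filter.Eventually.of_forall hC)
    (Filter.Eventually.of_forall hC)

/-- The hermitian form of a block Toeplitz matrix is an integral. -/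
lemma toeplitz_dotProduct (hM : ∀ i j, Integrable (fun x => M x i j) freq) :
    dotProduct ((Matrix.of fun i k : Fin K × Fin T => avg fun x =>
      ex ((k.1 : ℤ) - (i.1 : ℤ)) x * M x k.2 i.2).mulVec c) (star c) =
      avg fun x => sesq (M x) (tpoly c x) (tpoly c x) := by
  have hint : ∀ i k : Fin K × Fin T,
      Integrable (fun x => ex ((k.1 : ℤ) - (i.1 : ℤ)) x * M x k.2 i.2) freq := fun i k =>
    integrable_ex_mul (hM k.2 i.2) _
  have h1 : ∀ x, sesq (M x) (tpoly c x) (tpoly c x) = ∑ i : Fin K × Fin T, ∑ k : Fin K × Fin T,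
      (c k * star (c i)) * (ex ((k.1 : ℤ) - (i.1 : ℤ)) x * M x k.2 i.2) := by
    intro x
    simp only [Fintype.sum_prod_type_right, sesq_eq_sum, tpoly_apply, Finset.sum_mul, star_sum,
      Finset.mul_sum, star_mul', star_ex]
    rw [Finset.sum_comm]
    refine Finset.sum_congr rfl fun q _ => ?_
    rw [Finset.sum_comm]
    refine Finset.sum_congr rfl fun i _ => ?_
    refine Finset.sum_congr rfl fun p _ => ?_
    refine Finset.sum_congr rfl fun k _ => ?_
    rw [sub_eq_add_neg, ex_add]
    ring
  simp only [h1, avg]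
  rw [integral_finsetSum _ fun i _ => integrable_finsetSum _ fun k _ => (hint i k).const_mul _,
    Finset.mul_sum, dotProduct]
  refine Finset.sum_congr rfl fun i _ => ?_
  rw [integral_finsetSum _ fun k _ => (hint i k).const_mul _, Finset.mul_sum, Matrix.mulVec,
    dotProduct, Finset.sum_mul]
  refine Finset.sum_congr rfl fun k _ => ?_
  rw [integral_const_mul, Matrix.of_apply, Pi.star_apply]
  ring

lemma eq_zero_of_tpoly_ae_eq_zero (h : ∀ᵐ x ∂freq, tpoly c x = 0) : c = 0 := by
  funext ⟨k, q⟩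
  have h1 : ∫ x, ex (-(k : ℤ)) x * tpoly c x q ∂freq = 0 := by
    refine integral_eq_zero_of_ae ?_
    filter_upwards [h] with x hx
    simp [hx]
  have h2 : ∀ x, ex (-(k : ℤ)) x * tpoly c x q =
      ∑ l : Fin K, c (l, q) * ex ((l : ℤ) - (k : ℤ)) x := by
    intro x
    rw [tpoly_apply, Finset.mul_sum]
    refine Finset.sum_congr rfl fun l _ => ?_
    rw [sub_eq_add_neg, ex_add]
    ring
  simp only [h2] at h1
  rw [integral_finsetSum _ fun l _ => Integrable.const_mul (by
    simpa using integrable_ex_mul (integrable_const (μ := freq) (1 : ℂ)) _) _] at h1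
  simp only [integral_const_mul, integral_ex, sub_eq_zero, Nat.cast_inj, Fin.val_inj] at h1
  rw [Finset.sum_eq_single k] at h1
  · have : (Real.pi : ℂ) ≠ 0 := by exact_mod_cast Real.pi_ne_zero
    simpa [this] using h1
  · intro b _ hb
    simp [hb]
  · simp

end Tpoly

lemma eq_zero_of_quad_eq_zero {M : Matrix (Fin T) (Fin T) ℂ} (hM : M.PosSemidef)
    (hd : IsUnit M.det) {v : Fin T → ℂ} (hv : quad M v = 0) : v = 0 := by
  have hpos := hM.posDef_iff_isUnit.2 ((Matrix.isUnit_iff_isUnit_det M).2 hd)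
  by_contra hne
  have := hpos.dotProduct_mulVec_pos (x := star v) (by simpa using hne)
  rw [star_star] at this
  exact absurd hv (Complex.lt_def.1 this).1.ne'

/-! ### Invertibility of the block Toeplitz matrix `P`. -/

section PMat

variable {n μ N : ℕ} {f g : ℝ → Matrix (Fin T) (Fin T) ℂ}

lemma PMat_dotProduct (hf : IsSpectralDensity f) (hg : IsSpectralDensity g)
    (hm : Minimality n μ f g) (c : Fin (N + μ * n + 1) × Fin T → ℂ) :
    dotProduct ((PMat n μ N f g).mulVec c) (star c) =
      avg fun x => (weight n μ x : ℂ) * sesq ((dens n f g x)⁻¹) (tpoly c x) (tpoly c x) := by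
  have h := toeplitz_dotProduct (c := c) (M := fun x => (weight n μ x : ℂ) • (dens n f g x)⁻¹)
    fun i j => hm.integrable_entry hf hg i j
  refine h.trans ?_
  congr 1
  funext x
  rw [sesq, Matrix.smul_mulVec, dotProduct_smul, smul_eq_mul, sesq]

lemma integrable_weight_sesq (hf : IsSpectralDensity f) (hg : IsSpectralDensity g)
    (hm : Minimality n μ f g) {K : ℕ} (c : Fin K × Fin T → ℂ) :
    Integrable (fun x => (weight n μ x : ℂ) *
      sesq (dens n f g x)⁻¹ (tpoly c x) (tpoly c x)) freq := by
  refine (integrable_sesq_tpoly (c := c) (M := fun x => (weight n μ x : ℂ) • (dens n f g x)⁻¹)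
    fun i j => hm.integrable_entry hf hg i j).congr (Filter.Eventually.of_forall fun x => ?_)
  simp only
  rw [sesq, Matrix.smul_mulVec, dotProduct_smul, smul_eq_mul, sesq]

/-- Under the minimality condition the matrix `P` is invertible. -/
lemma isUnit_det_PMat (hμ : 0 < μ) (hf : IsSpectralDensity f) (hg : IsSpectralDensity g)
    (hm : Minimality n μ f g) : IsUnit (PMat n μ N f g).det := by
  rw [isUnit_iff_ne_zero]
  intro h0
  obtain ⟨c, hc, hPc⟩ := Matrix.exists_mulVec_eq_zero_iff.2 h0
  refine hc (eq_zero_of_tpoly_ae_eq_zero ?_)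
  have hp := hf.dens hg n
  have h1 := PMat_dotProduct (N := N) hf hg hm c
  have hint := integrable_weight_sesq hf hg hm c
  have hpi : (1 / (2 * (Real.pi : ℂ))) ≠ 0 := by simp [Real.pi_ne_zero]
  rw [hPc, zero_dotProduct, avg, eq_comm, mul_eq_zero, or_iff_right hpi] at h1
  -- A kernel vector of `P` makes a nonnegative integrand have integral zero. Almost everywhere the
  -- weight is nonzero and `p⁻¹` is definite, so the polynomial itself vanishes.
  have h2 : ∫ x, weight n μ x * quad ((dens n f g x)⁻¹) (tpoly c x) ∂freq = 0 := by
    have h3 := congrArg Complex.re h1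
    have h4 := integral_re hint
    rw [Complex.zero_re] at h3
    rw [← h3]
    refine Eq.trans ?_ h4
    refine integral_congr_ae (Filter.Eventually.of_forall fun x => ?_)
    exact (Complex.re_ofReal_mul _ _).symm
  rw [integral_eq_zero_iff_of_nonneg_ae] at h2
  · filter_upwards [h2, hp.posSemidef, hm.1, ae_regular hμ] with x h3 h4 h5 h6
    have hw : weight n μ x ≠ 0 := by
      rw [weight_eq_inv_norm_sq]
      exact inv_ne_zero (pow_ne_zero _ (norm_ne_zero_iff.2 (chi_ne_zero h6)))
    exact eq_zero_of_quad_eq_zero h4.inv (Matrix.isUnit_nonsing_inv_det _ h5)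
      ((mul_eq_zero.1 h3).resolve_left hw)
  · filter_upwards [hp.posSemidef] with x h4
    exact mul_nonneg (weight_nonneg n μ x) (quad_nonneg h4.inv _)
  · refine hint.re.congr (Filter.Eventually.of_forall fun x => ?_)
    exact Complex.re_ofReal_mul _ _

lemma PMat_mulVec_cVec (hμ : 0 < μ) (hf : IsSpectralDensity f) (hg : IsSpectralDensity g)
    (hm : Minimality n μ f g) (a : ℕ → Fin T → ℂ) :
    (PMat n μ N f g).mulVec (cVec n μ N a f g) = rhsVec n μ N a f g := by
  rw [cVec, Matrix.mulVec_mulVec, Matrix.mul_nonsing_inv _ (isUnit_det_PMat hμ hf hg hm),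
    Matrix.one_mulVec]

end PMat

/-! ### The optimal characteristic -/

section Optimal

variable {n μ N : ℕ} {a : ℕ → Fin T → ℂ} {f g : ℝ → Matrix (Fin T) (Fin T) ℂ}

/-- The part of the residual `B χ - h` that comes from the noise. -/
def noiseResidual (n N : ℕ) (a : ℕ → Fin T → ℂ) (f g : ℝ → Matrix (Fin T) (Fin T) ℂ) (x : ℝ) :
    Fin T → ℂ :=
  (-Complex.I * (x : ℂ)) ^ n • Matrix.vecMul (poly N a x) (g x * (dens n f g x)⁻¹)

/-- The part of the residual `B χ - h` that comes from the missing observations. -/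
def gapResidual (n μ N : ℕ) (a : ℕ → Fin T → ℂ) (f g : ℝ → Matrix (Fin T) (Fin T) ℂ) (x : ℝ) :
    Fin T → ℂ :=
  (star (chi n μ x))⁻¹ • Matrix.vecMul (tpoly (cVec n μ N a f g) x) (dens n f g x)⁻¹

lemma specChar_eq (x : ℝ) : specChar n μ N a f g x =
    chi n μ x • poly N (bCoeff n μ N a) x - noiseResidual n N a f g x
      - gapResidual n μ N a f g x := by
  rw [gapResidual, star_chi, inv_div]
  rfl

lemma aemeasurable_noiseResidual (hf : IsSpectralDensity f) (hg : IsSpectralDensity g) :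
    AEMeasurable (noiseResidual n N a f g) freq :=
  AEMeasurable.smul (f := fun x : ℝ => (-Complex.I * (x : ℂ)) ^ n) (by fun_prop) (aemeasurable_vecMul
    (hg.aemeasEntries.mul (hf.dens hg n).aemeasEntries.inv) (measurable_poly N a).aemeasurable)

lemma aemeasurable_gapResidual (hf : IsSpectralDensity f) (hg : IsSpectralDensity g) :
    AEMeasurable (gapResidual n μ N a f g) freq :=
  AEMeasurable.smul (continuous_star.measurable.comp (measurable_chi n μ)).inv.aemeasurable
    (aemeasurable_vecMul (hf.dens hg n).aemeasEntries.inv (measurable_tpoly _).aemeasurable)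

lemma aemeasurable_chi_smul_poly (b : ℕ → Fin T → ℂ) :
    AEMeasurable (fun x => chi n μ x • poly N b x) freq :=
  ((measurable_chi n μ).smul (measurable_poly N b)).aemeasurable

lemma aemeasurable_specChar (hf : IsSpectralDensity f) (hg : IsSpectralDensity g) :
    AEMeasurable (specChar n μ N a f g) freq := by
  simp only [funext (specChar_eq (n := n) (μ := μ) (N := N) (a := a) (f := f) (g := g))]
  exact ((aemeasurable_chi_smul_poly _).sub (aemeasurable_noiseResidual hf hg)).sub
    (aemeasurable_gapResidual hf hg)

lemma quad_le_quad_dens {x : ℝ} (hf : (f x).PosSemidef) (v : Fin T → ℂ) :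
    x ^ (2 * n) * quad (g x) v ≤ quad (dens n f g x) v := by
  rw [quad_dens]
  linarith [quad_nonneg hf v]

lemma integrable_quad_poly (hg : IsSpectralDensity g) (b : ℕ → Fin T → ℂ) :
    Integrable (fun x => quad (g x) (poly N b x)) freq := by
  obtain ⟨C, hC⟩ := norm_poly_apply_le N b
  exact integrable_quad_of_bounded hg.integrable (measurable_poly N b).aemeasurable
    (Filter.Eventually.of_forall hC)

lemma integrable_quad_chi_smul_poly (hg : IsSpectralDensity g) (b : ℕ → Fin T → ℂ) :
    Integrable (fun x => quad (g x) (chi n μ x • poly N b x)) freq := by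
  obtain ⟨C, hC⟩ := norm_poly_apply_le N b
  refine integrable_quad_of_bounded hg.integrable (aemeasurable_chi_smul_poly b)
    (C := (μ : ℝ) ^ n * C) (Filter.Eventually.of_forall fun x q => ?_)
  rw [Pi.smul_apply, smul_eq_mul, norm_mul]
  exact mul_le_mul (norm_chi_le n μ x) (hC x q) (norm_nonneg _) (by positivity)

lemma norm_I_mul_pow_sq (x : ℝ) (n : ℕ) : ‖(Complex.I * (x : ℂ)) ^ n‖ ^ 2 = x ^ (2 * n) := by
  rw [norm_pow, norm_mul, Complex.norm_I, one_mul, Complex.norm_real, ← pow_mul, mul_comm n 2,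
    Real.norm_eq_abs, Even.pow_abs (even_two_mul n)]

lemma norm_neg_I_mul_pow_sq (x : ℝ) (n : ℕ) : ‖(-Complex.I * (x : ℂ)) ^ n‖ ^ 2 = x ^ (2 * n) := by
  rw [← norm_I_mul_pow_sq, neg_mul, neg_pow, norm_mul]
  simp

/-- From `x^{2n} g ≤ p` follows `x^{2n} g p⁻¹ g ≤ g`, so the form is dominated by that of `g` on a
bounded polynomial, however degenerate `p` may be. -/
lemma integrable_quad_noiseResidual (hf : IsSpectralDensity f) (hg : IsSpectralDensity g)
    (hm : Minimality n μ f g) :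
    Integrable (fun x => quad (dens n f g x) (noiseResidual n N a f g x)) freq := by
  have hp := hf.dens hg n
  refine (integrable_quad_poly (N := N) hg a).mono'
    (aemeasurable_quad hp.aemeasEntries (aemeasurable_noiseResidual hf hg)).aestronglyMeasurable ?_
  filter_upwards [hf.posSemidef, hg.posSemidef, hp.posSemidef, hm.1] with x h1 h2 h3 h4
  rw [Real.norm_of_nonneg (quad_nonneg h3 _), noiseResidual, quad_smul, norm_neg_I_mul_pow_sq]
  exact quad_conj_inv_le ((even_two_mul n).pow_nonneg x) h2 h4 (quad_le_quad_dens h1) _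

lemma quad_gapResidual {x : ℝ} (hp : (dens n f g x).PosSemidef) (hd : IsUnit (dens n f g x).det) :
    quad (dens n f g x) (gapResidual n μ N a f g x) =
      weight n μ x * quad (dens n f g x)⁻¹ (tpoly (cVec n μ N a f g) x) := by
  rw [gapResidual, quad_smul, quad_inv_vecMul hp.1 hd, norm_inv, norm_star,
    weight_eq_inv_norm_sq, inv_pow]

lemma integrable_weight_quad (hf : IsSpectralDensity f) (hg : IsSpectralDensity g)
    (hm : Minimality n μ f g) {K : ℕ} (c : Fin K × Fin T → ℂ) :
    Integrable (fun x => weight n μ x * quad (dens n f g x)⁻¹ (tpoly c x)) freq :=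
  (integrable_weight_sesq hf hg hm c).re.congr (Filter.Eventually.of_forall fun _ =>
    Complex.re_ofReal_mul _ _)

lemma integrable_quad_gapResidual (hf : IsSpectralDensity f) (hg : IsSpectralDensity g)
    (hm : Minimality n μ f g) :
    Integrable (fun x => quad (dens n f g x) (gapResidual n μ N a f g x)) freq := by
  refine (integrable_weight_quad hf hg hm (cVec n μ N a f g)).congr ?_
  filter_upwards [(hf.dens hg n).posSemidef, hm.1] with x h1 h2
  exact (quad_gapResidual h1 h2).symm

lemma integrable_quad_specChar (hf : IsSpectralDensity f) (hg : IsSpectralDensity g)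
    (hm : Minimality n μ f g) :
    Integrable (fun x => quad (dens n f g x) (specChar n μ N a f g x)) freq := by
  have hp := hf.dens hg n
  simp only [specChar_eq]
  exact integrable_quad_sub hp.posSemidef hp.aemeasEntries
    ((aemeasurable_chi_smul_poly _).sub (aemeasurable_noiseResidual hf hg))
    (aemeasurable_gapResidual hf hg)
    (integrable_quad_sub hp.posSemidef hp.aemeasEntries (aemeasurable_chi_smul_poly _)
      (aemeasurable_noiseResidual hf hg) (integrable_quad_chi_smul_poly hp _)
      (integrable_quad_noiseResidual hf hg hm)) (integrable_quad_gapResidual hf hg hm)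

/-- Since `(1 - e^{ixμ})^n = χ̄ (-ix)^n` and the weight is `1 / (χ χ̄)`, the noise residual divided
by `χ` is the integrand of `T a_μ`. -/
lemma neg_I_mul_pow_div_chi {x : ℝ} (hx : x ≠ 0 ∧ 1 - ex (μ : ℤ) x ≠ 0) :
    (-Complex.I * (x : ℂ)) ^ n / chi n μ x = (weight n μ x : ℂ) * (1 - ex (μ : ℤ) x) ^ n := by
  have h1 := chi_ne_zero (n := n) hx
  have h2 : star (chi n μ x) ≠ 0 := star_ne_zero.2 h1
  have h3 : (-Complex.I * (x : ℂ)) ^ n ≠ 0 := by simp [hx.1]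
  have h4 : (1 - ex (μ : ℤ) x) ^ n = star (chi n μ x) * (-Complex.I * (x : ℂ)) ^ n := by
    rw [star_chi, div_mul_cancel₀ _ h3]
  rw [h4, weight_eq_inv]
  field_simp

/-- The coefficients `c` are chosen so that the explicit characteristic is admissible. -/
lemma charCoef_specChar (hμ : 0 < μ) (hf : IsSpectralDensity f) (hg : IsSpectralDensity g)
    (hm : Minimality n μ f g) {j : ℕ} (hj : j < N + μ * n + 1) (q : Fin T) :
    charCoef n μ (specChar n μ N a f g) j q = 0 := by
  set i : Fin (N + μ * n + 1) × Fin T := (⟨j, hj⟩, q) with hi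
  have hpi : (Real.pi : ℂ) ≠ 0 := by exact_mod_cast Real.pi_ne_zero
  have hP := congrFun (PMat_mulVec_cVec (N := N) hμ hf hg hm a) i
  -- Up to the factor `2π`, the three parts of the characteristic contribute `b`, `T a_μ` and `P c`;
  -- their balance is the linear system `hP`.
  have hsplit : charCoef n μ (specChar n μ N a f g) j q =
      charCoef n μ (fun x => chi n μ x • poly N (bCoeff n μ N a) x) j q -
        charCoef n μ (noiseResidual n N a f g) j q -
        charCoef n μ (gapResidual n μ N a f g) j q := by
    have hp := hf.dens hg n
    have h1 := charCoef_sub hμ hf hg hm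
      (h := fun x => chi n μ x • poly N (bCoeff n μ N a) x - noiseResidual n N a f g x)
      (k := gapResidual n μ N a f g) ((aemeasurable_chi_smul_poly _).sub (aemeasurable_noiseResidual hf hg))
      (integrable_quad_sub hp.posSemidef hp.aemeasEntries (aemeasurable_chi_smul_poly _)
      (aemeasurable_noiseResidual hf hg) (integrable_quad_chi_smul_poly hp _)
      (integrable_quad_noiseResidual hf hg hm)) (aemeasurable_gapResidual hf hg)
      (integrable_quad_gapResidual hf hg hm) j q
    rw [← charCoef_sub hμ hf hg hm (aemeasurable_chi_smul_poly _)
      (integrable_quad_chi_smul_poly hp _) (aemeasurable_noiseResidual hf hg)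
      (integrable_quad_noiseResidual hf hg hm), ← h1]
    simp only [charCoef, specChar_eq]
  have hB : charCoef n μ (fun x => chi n μ x • poly N (bCoeff n μ N a) x) j q =
      2 * Real.pi * bCoeff n μ N a j q := by
    have h1 : charCoef n μ (fun x => chi n μ x • poly N (bCoeff n μ N a) x) j q =
        ∫ x, ∑ k ∈ Finset.range (N + 1), bCoeff n μ N a k q * ex ((k : ℤ) - j) x ∂freq := by
      refine integral_congr_ae ?_
      filter_upwards [ae_regular hμ] with x hx
      rw [Pi.smul_apply, smul_eq_mul, mul_div_cancel_left₀ _ (chi_ne_zero hx), poly,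
        Finset.sum_apply, Finset.mul_sum]
      refine Finset.sum_congr rfl fun k _ => ?_
      rw [sub_eq_add_neg, ex_add, Pi.smul_apply, smul_eq_mul]
      ring
    rw [h1, integral_finsetSum _ fun l _ => Integrable.const_mul (by
      simpa using integrable_ex_mul (integrable_const (μ := freq) (1 : ℂ)) _) _]
    simp only [integral_const_mul, integral_ex, sub_eq_zero, Nat.cast_inj, mul_ite, mul_zero]
    rw [Finset.sum_ite_eq']
    split_ifs with h
    · ring
    -- For `N < j ≤ N + μ n` the polynomial has no such frequency, in agreement with the zero
    -- extension of `b`.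
    · rw [bCoeff, Finset.Icc_eq_empty (by simpa using h)]
      simp
  have hT : charCoef n μ (noiseResidual n N a f g) j q = 2 * Real.pi * TVec n μ N a f g i := by
    rw [TVec, avg, ← mul_assoc, mul_one_div_cancel (by simp [hpi]), one_mul]
    refine integral_congr_ae ?_
    filter_upwards [ae_regular hμ] with x hx
    rw [noiseResidual, Pi.smul_apply, smul_eq_mul, mul_div_right_comm, neg_I_mul_pow_div_chi hx,
      poly_aCoeff, Matrix.smul_vecMul, Pi.smul_apply, smul_eq_mul]
    simp only [hi]
    ring
  have hG : charCoef n μ (gapResidual n μ N a f g) j q =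
      2 * Real.pi * (PMat n μ N f g).mulVec (cVec n μ N a f g) i := by
    have h1 : charCoef n μ (gapResidual n μ N a f g) j q =
        ∫ x, ∑ k : Fin (N + μ * n + 1) × Fin T, cVec n μ N a f g k *
          (ex ((k.1 : ℤ) - (i.1 : ℤ)) x * ((weight n μ x : ℂ) * (dens n f g x)⁻¹ k.2 i.2)) ∂freq := by
      refine integral_congr_ae ?_
      filter_upwards [ae_regular hμ] with x hx
      have h2 := chi_ne_zero (n := n) hx
      have h3 : star (chi n μ x) ≠ 0 := star_ne_zero.2 h2
      have h4 : ((star (chi n μ x))⁻¹ * Matrix.vecMul (tpoly (cVec n μ N a f g) x)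
          (dens n f g x)⁻¹ q) / chi n μ x = weight n μ x *
          Matrix.vecMul (tpoly (cVec n μ N a f g) x) (dens n f g x)⁻¹ q := by
        rw [weight_eq_inv]; field_simp
      rw [gapResidual, Pi.smul_apply, smul_eq_mul, h4, Matrix.vecMul, dotProduct, Finset.mul_sum,
        Finset.mul_sum, Fintype.sum_prod_type_right]
      refine Finset.sum_congr rfl fun p _ => ?_
      rw [tpoly_apply, Finset.sum_mul, Finset.mul_sum, Finset.mul_sum]
      refine Finset.sum_congr rfl fun k _ => ?_
      rw [sub_eq_add_neg, ex_add]
      simp only [hi]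
      ring
    rw [h1, integral_finsetSum _ fun k _ => Integrable.const_mul
      (integrable_ex_mul (hm.integrable_entry hf hg k.2 i.2) _) _, Matrix.mulVec, dotProduct,
      Finset.mul_sum]
    refine Finset.sum_congr rfl fun k _ => ?_
    rw [integral_const_mul, PMat, avg]
    field_simp
  rw [hsplit, hB, hT, hG, hP, rhsVec]
  simp only [hi]
  ring

lemma specChar_mem_charSpace (hμ : 0 < μ) (hf : IsSpectralDensity f) (hg : IsSpectralDensity g)
    (hm : Minimality n μ f g) : specChar n μ N a f g ∈ charSpace n μ N f g :=
  mem_charSpace_of_charCoef_eq_zero hμ hf hg hm (aemeasurable_specChar hf hg)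
    (integrable_quad_specChar hf hg hm) fun _ hj q => charCoef_specChar hμ hf hg hm hj q

end Optimal

/-! ### The mean-square error -/

/-- The integrand of the mean-square error, for the residual `u = B χ - h`. -/
def errDensity (n N : ℕ) (a : ℕ → Fin T → ℂ) (f g : ℝ → Matrix (Fin T) (Fin T) ℂ)
    (u : ℝ → Fin T → ℂ) (x : ℝ) : ℝ :=
  quad (f x) (u x) + quad (g x) ((Complex.I * (x : ℂ)) ^ n • u x - poly N a x)

/-- The residual `B χ - h`. -/
def residual (n μ N : ℕ) (a : ℕ → Fin T → ℂ) (h : ℝ → Fin T → ℂ) (x : ℝ) : Fin T → ℂ :=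
  chi n μ x • poly N (bCoeff n μ N a) x - h x

section ErrDensity

variable {n μ N : ℕ} {a : ℕ → Fin T → ℂ} {f g : ℝ → Matrix (Fin T) (Fin T) ℂ}
  {h u : ℝ → Fin T → ℂ}

lemma errDensity_nonneg {x : ℝ} (hf : (f x).PosSemidef) (hg : (g x).PosSemidef) :
    0 ≤ errDensity n N a f g u x :=
  add_nonneg (quad_nonneg hf _) (quad_nonneg hg _)

lemma aemeasurable_residual (hh : AEMeasurable h freq) :
    AEMeasurable (residual n μ N a h) freq :=
  (aemeasurable_chi_smul_poly _).sub hh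

lemma aemeasurable_noise_term (hu : AEMeasurable u freq) :
    AEMeasurable (fun x : ℝ => (Complex.I * (x : ℂ)) ^ n • u x - poly N a x) freq :=
  (AEMeasurable.smul (f := fun x : ℝ => (Complex.I * (x : ℂ)) ^ n) (by fun_prop) hu).sub
    (measurable_poly N a).aemeasurable

lemma aemeasurable_errDensity (hf : IsSpectralDensity f) (hg : IsSpectralDensity g)
    (hu : AEMeasurable u freq) : AEMeasurable (errDensity n N a f g u) freq :=
  (aemeasurable_quad hf.aemeasEntries hu).add
    (aemeasurable_quad hg.aemeasEntries (aemeasurable_noise_term hu))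

lemma mse_eq_lavg (hf : IsSpectralDensity f) (hg : IsSpectralDensity g)
    (hh : AEMeasurable h freq) :
    mse n μ N a h f g =
      lavg fun x => ENNReal.ofReal (errDensity n N a f g (residual n μ N a h) x) := by
  have hu := aemeasurable_residual (n := n) (μ := μ) (N := N) (a := a) hh
  rw [mse, lavg, lavg, lavg, ← mul_add, ← lintegral_add_left'
    (f := fun x => ENNReal.ofReal (quad (f x) (chi n μ x • poly N (bCoeff n μ N a) x - h x)))
    (aemeasurable_quad hf.aemeasEntries hu).ennreal_ofReal]
  congr 1
  refine lintegral_congr_ae ?_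
  filter_upwards [hf.posSemidef, hg.posSemidef] with x h1 h2
  rw [← ENNReal.ofReal_add (quad_nonneg h1 _) (quad_nonneg h2 _)]
  rfl

lemma integrable_errDensity (hf : IsSpectralDensity f) (hg : IsSpectralDensity g)
    (hu : AEMeasurable u freq) (hi : Integrable (fun x => quad (dens n f g x) (u x)) freq) :
    Integrable (errDensity n N a f g u) freq := by
  refine ((hi.const_mul 3).add ((integrable_quad_poly (N := N) hg a).const_mul 2)).mono'
    (aemeasurable_errDensity hf hg hu).aestronglyMeasurable ?_
  filter_upwards [hf.posSemidef, hg.posSemidef] with x h1 h2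
  rw [Real.norm_of_nonneg (errDensity_nonneg h1 h2), errDensity, sub_eq_add_neg]
  have h3 := quad_add_le h2 one_pos ((Complex.I * (x : ℂ)) ^ n • u x) (-poly N a x)
  rw [quad_neg, quad_smul, norm_I_mul_pow_sq] at h3
  have h4 := quad_dens n f g x (u x)
  have h5 := quad_nonneg h1 (u x)
  have h6 := mul_nonneg ((even_two_mul n).pow_nonneg x) (quad_nonneg h2 (u x))
  simp only [Pi.add_apply]
  linarith

lemma mse_eq_ofReal (hf : IsSpectralDensity f) (hg : IsSpectralDensity g)
    (hh : AEMeasurable h freq) (hi : Integrable (fun x => quad (dens n f g x) (h x)) freq) :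
    mse n μ N a h f g = ENNReal.ofReal
      (1 / (2 * Real.pi) * ∫ x, errDensity n N a f g (residual n μ N a h) x ∂freq) := by
  have hp := hf.dens hg n
  have h1 : Integrable (errDensity n N a f g (residual n μ N a h)) freq :=
    integrable_errDensity hf hg (aemeasurable_residual hh)
      (integrable_quad_sub hp.posSemidef hp.aemeasEntries (aemeasurable_chi_smul_poly _) hh
        (integrable_quad_chi_smul_poly hp _) hi)
  rw [mse_eq_lavg hf hg hh, lavg, ENNReal.ofReal_mul (by positivity),
    ofReal_integral_eq_lintegral_ofReal h1]
  filter_upwards [hf.posSemidef, hg.posSemidef] with x h1 h2 using errDensity_nonneg h1 h2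

lemma star_I_mul_pow (x : ℝ) : star ((Complex.I * (x : ℂ)) ^ n) = (-Complex.I * (x : ℂ)) ^ n := by
  simp

lemma errDensity_eq {x : ℝ} (hg : (g x).PosSemidef) :
    errDensity n N a f g u x = quad (dens n f g x) (u x) -
      2 * ((-Complex.I * (x : ℂ)) ^ n * sesq (g x) (poly N a x) (u x)).re +
      quad (g x) (poly N a x) := by
  rw [errDensity, quad_sub hg.1, quad_smul, norm_I_mul_pow_sq, quad_dens, ← star_sesq hg.1,
    sesq_smul_right, star_I_mul_pow, Complex.star_def, Complex.conj_re]
  ring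

lemma vecMul_noiseResidual {x : ℝ} (hd : IsUnit (dens n f g x).det) :
    Matrix.vecMul (noiseResidual n N a f g x) (dens n f g x) =
      (-Complex.I * (x : ℂ)) ^ n • Matrix.vecMul (poly N a x) (g x) := by
  rw [noiseResidual, Matrix.smul_vecMul, Matrix.vecMul_vecMul, Matrix.mul_assoc,
    Matrix.nonsing_inv_mul _ hd, Matrix.mul_one]

lemma vecMul_gapResidual {x : ℝ} (hd : IsUnit (dens n f g x).det) :
    Matrix.vecMul (gapResidual n μ N a f g x) (dens n f g x) =
      (star (chi n μ x))⁻¹ • tpoly (cVec n μ N a f g) x := by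
  rw [gapResidual, Matrix.smul_vecMul, Matrix.vecMul_vecMul, Matrix.nonsing_inv_mul _ hd,
    Matrix.vecMul_one]

lemma sesq_noiseResidual {x : ℝ} (hd : IsUnit (dens n f g x).det) (v : Fin T → ℂ) :
    sesq (dens n f g x) (noiseResidual n N a f g x) v =
      (-Complex.I * (x : ℂ)) ^ n * sesq (g x) (poly N a x) v := by
  rw [sesq_eq_vecMul, vecMul_noiseResidual hd, smul_dotProduct, smul_eq_mul, sesq_eq_vecMul]

lemma sesq_gapResidual {x : ℝ} (hd : IsUnit (dens n f g x).det) (v : Fin T → ℂ) :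
    sesq (dens n f g x) (gapResidual n μ N a f g x) v =
      (star (chi n μ x))⁻¹ * dotProduct (tpoly (cVec n μ N a f g) x) (star v) := by
  rw [sesq_eq_vecMul, vecMul_gapResidual hd, smul_dotProduct, smul_eq_mul]

lemma residual_specChar (x : ℝ) : residual n μ N a (specChar n μ N a f g) x =
    noiseResidual n N a f g x + gapResidual n μ N a f g x := by
  rw [residual, specChar_eq]
  abel

/-- Completion of the square in the integrand of the mean-square error. -/
lemma errDensity_eq_sq {x : ℝ} (hp : (dens n f g x).PosSemidef) (hg : (g x).PosSemidef)
    (hd : IsUnit (dens n f g x).det) :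
    errDensity n N a f g u x = quad (dens n f g x) (u x - noiseResidual n N a f g x) +
      (quad (g x) (poly N a x) - quad (dens n f g x) (noiseResidual n N a f g x)) := by
  rw [errDensity_eq hg, quad_sub hp.1, ← sesq_noiseResidual hd, ← star_sesq hp.1 (u x),
    Complex.star_def, Complex.conj_re]
  ring

/-- Both completed squares have the same remainder. After subtraction of the noise residual, what is
left at the explicit characteristic is `gapResidual`, so it alone enters the cross term. -/
lemma errDensity_residual {x : ℝ} (hp : (dens n f g x).PosSemidef) (hg : (g x).PosSemidef)
    (hd : IsUnit (dens n f g x).det) :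
    errDensity n N a f g (residual n μ N a h) x =
      errDensity n N a f g (residual n μ N a (specChar n μ N a f g)) x +
      (quad (dens n f g x) (specChar n μ N a f g x - h x) +
        2 * (sesq (dens n f g x) (gapResidual n μ N a f g x) (specChar n μ N a f g x - h x)).re)
      := by
  have h1 : residual n μ N a h x - noiseResidual n N a f g x =
      gapResidual n μ N a f g x + (specChar n μ N a f g x - h x) := by
    have h3 := residual_specChar (n := n) (μ := μ) (N := N) (a := a) (f := f) (g := g) x
    have h4 : residual n μ N a h x = residual n μ N a (specChar n μ N a f g) x +
        (specChar n μ N a f g x - h x) := by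
      simp only [residual]
      abel
    rw [h4, h3]
    abel
  have h2 : residual n μ N a (specChar n μ N a f g) x - noiseResidual n N a f g x =
      gapResidual n μ N a f g x := by
    rw [residual_specChar]
    abel
  rw [errDensity_eq_sq hp hg hd, errDensity_eq_sq hp hg hd, h1, h2, quad_add hp.1]
  ring

/-- The functions of `L₂(p)` of the form `Cᵀ p⁻¹ / χ̄` are orthogonal to the space of
characteristics. -/
lemma integral_sesq_gapResidual (hμ : 0 < μ) (hf : IsSpectralDensity f)
    (hg : IsSpectralDensity g) (hm : Minimality n μ f g) (hh : h ∈ charSpace n μ N f g) :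
    ∫ x, sesq (dens n f g x) (gapResidual n μ N a f g x) (h x) ∂freq = 0 := by
  have hdiv := integrable_div_chi hμ hf hg hm hh.1 (integrable_quad_of_mem_charSpace hf hg hh)
  have hconj : ∀ (k : ℤ) (q : Fin T), Integrable (fun x => star (ex (-k) x * (h x q / chi n μ x)))
      freq := fun k q => (Complex.conjCLE.toContinuousLinearMap).integrable_comp
        (integrable_ex_mul (hdiv q) _)
  have h1 : ∫ x, sesq (dens n f g x) (gapResidual n μ N a f g x) (h x) ∂freq =
      ∫ x, ∑ q, ∑ k : Fin (N + μ * n + 1), cVec n μ N a f g (k, q) *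
        star (ex (-(k : ℤ)) x * (h x q / chi n μ x)) ∂freq := by
    refine integral_congr_ae ?_
    filter_upwards [hm.1] with x h2
    -- Applying `p` cancels `p⁻¹`, which leaves the polynomial `C` against the conjugate of `h / χ`:
    -- a combination of conjugated gap coefficients.
    rw [sesq_gapResidual h2, dotProduct, Finset.mul_sum]
    refine Finset.sum_congr rfl fun q _ => ?_
    rw [tpoly_apply, Finset.sum_mul, Finset.mul_sum]
    refine Finset.sum_congr rfl fun k _ => ?_
    rw [star_mul', star_ex, neg_neg, star_div₀, Pi.star_apply]
    ring
  rw [h1, integral_finsetSum _ fun q _ => integrable_finsetSum _ fun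
    (k : Fin (N + μ * n + 1)) _ => (hconj (k : ℤ) q).const_mul _]
  refine Finset.sum_eq_zero fun q _ => ?_
  rw [integral_finsetSum _ fun (k : Fin (N + μ * n + 1)) _ => (hconj (k : ℤ) q).const_mul _]
  refine Finset.sum_eq_zero fun k _ => ?_
  have h2 : ∫ x, star (ex (-(k : ℤ)) x * (h x q / chi n μ x)) ∂freq =
      star (charCoef n μ h k q) := integral_conj
  rw [integral_const_mul, h2, charCoef_eq_zero_of_mem_charSpace hμ hf hg hm hh k.2 q, star_zero,
    mul_zero]

/-- The Pythagorean identity for the mean-square error. -/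
theorem mse_eq_add (hμ : 0 < μ) (hf : IsSpectralDensity f) (hg : IsSpectralDensity g)
    (hm : Minimality n μ f g) (hh : h ∈ charSpace n μ N f g) :
    mse n μ N a h f g = mse n μ N a (specChar n μ N a f g) f g +
      ENNReal.ofReal (1 / (2 * Real.pi)) *
        sqNorm (dens n f g) (fun x => specChar n μ N a f g x - h x) := by
  have hp := hf.dens hg n
  have h0 : specChar n μ N a f g ∈ charSpace n μ N f g := specChar_mem_charSpace hμ hf hg hm
  have hi := integrable_quad_of_mem_charSpace hf hg hh
  have h0i := integrable_quad_of_mem_charSpace hf hg h0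
  have hdi := integrable_quad_sub hp.posSemidef hp.aemeasEntries h0.1 hh.1 h0i hi
  have hgi := integrable_quad_gapResidual (N := N) (a := a) hf hg hm
  have hgm := aemeasurable_gapResidual (n := n) (μ := μ) (N := N) (a := a) hf hg
  have hEi : Integrable (errDensity n N a f g (residual n μ N a (specChar n μ N a f g))) freq :=
    integrable_errDensity hf hg (aemeasurable_residual h0.1)
      (integrable_quad_sub hp.posSemidef hp.aemeasEntries (aemeasurable_chi_smul_poly _) h0.1
        (integrable_quad_chi_smul_poly hp _) h0i)
  have hs1 := integrable_sesq hp.posSemidef hp.aemeasEntries hgm h0.1 hgi h0i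
  have hs2 := integrable_sesq hp.posSemidef hp.aemeasEntries hgm hh.1 hgi hi
  have hs : Integrable (fun x => (sesq (dens n f g x) (gapResidual n μ N a f g x)
      (specChar n μ N a f g x - h x)).re) freq := by
    simp only [sesq_sub_right]
    exact (hs1.sub hs2).re
  have hcross : ∫ x, (sesq (dens n f g x) (gapResidual n μ N a f g x)
      (specChar n μ N a f g x - h x)).re ∂freq = 0 := by
    have h1 : ∫ x, sesq (dens n f g x) (gapResidual n μ N a f g x)
        (specChar n μ N a f g x - h x) ∂freq = 0 := by
      simp only [sesq_sub_right]
      rw [integral_sub hs1 hs2, integral_sesq_gapResidual hμ hf hg hm h0,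
        integral_sesq_gapResidual hμ hf hg hm hh, sub_zero]
    have h2 := integral_re (f := fun x => sesq (dens n f g x) (gapResidual n μ N a f g x)
        (specChar n μ N a f g x - h x)) (μ := freq) (𝕜 := ℂ)
        (by simp only [sesq_sub_right]; exact hs1.sub hs2)
    rw [h1] at h2
    simpa using h2
  have hint : ∫ x, errDensity n N a f g (residual n μ N a h) x ∂freq =
      ∫ x, errDensity n N a f g (residual n μ N a (specChar n μ N a f g)) x ∂freq +
      ∫ x, quad (dens n f g x) (specChar n μ N a f g x - h x) ∂freq := by
    have h1 : ∫ x, errDensity n N a f g (residual n μ N a h) x ∂freq =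
        ∫ x, (errDensity n N a f g (residual n μ N a (specChar n μ N a f g)) x +
      (quad (dens n f g x) (specChar n μ N a f g x - h x) +
        2 * (sesq (dens n f g x) (gapResidual n μ N a f g x)
          (specChar n μ N a f g x - h x)).re)) ∂freq := by
      refine integral_congr_ae ?_
      filter_upwards [hp.posSemidef, hg.posSemidef, hm.1] with x h1 h2 h3
      exact errDensity_residual h1 h2 h3
    have h2 := integral_add hEi (hdi.add (hs.const_mul 2))
    have h3 := integral_add hdi (hs.const_mul 2)
    simp only [Pi.add_apply] at h2
    rw [h1, h2, h3, integral_const_mul, hcross]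
    ring
  rw [mse_eq_ofReal hf hg hh.1 hi, mse_eq_ofReal hf hg h0.1 h0i,
    sqNorm_eq_ofReal hp.posSemidef hdi, hint, ← ENNReal.ofReal_mul (by positivity),
    ← ENNReal.ofReal_add, mul_add]
  · refine mul_nonneg (by positivity) (integral_nonneg_of_ae ?_)
    filter_upwards [hf.posSemidef, hg.posSemidef] with x h1 h2 using errDensity_nonneg h1 h2
  · refine mul_nonneg (by positivity) (integral_nonneg_of_ae ?_)
    filter_upwards [hp.posSemidef] with x h1 using quad_nonneg h1 _

theorem isOptimal_specChar (hμ : 0 < μ) (hf : IsSpectralDensity f) (hg : IsSpectralDensity g)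
    (hm : Minimality n μ f g) : IsOptimal n μ N a f g (specChar n μ N a f g) := by
  have h0 : specChar n μ N a f g ∈ charSpace n μ N f g := specChar_mem_charSpace hμ hf hg hm
  refine ⟨h0, le_antisymm (le_iInf₂ fun h hh => ?_) (iInf₂_le _ h0)⟩
  rw [mse_eq_add hμ hf hg hm hh]
  exact le_self_add

/-! ### The value of the optimal error -/

/-- Eliminating `f` by means of `f = p - x^{2n} g` identifies the matrix behind `Q` with the
remainder left by completing the square. -/
lemma cross_matrix_eq {x : ℝ} (hd : IsUnit (dens n f g x).det) :
    f x * (dens n f g x)⁻¹ * g x =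
      g x - ((x ^ (2 * n) : ℝ) : ℂ) • (g x * (dens n f g x)⁻¹ * g x) := by
  have h1 : f x = dens n f g x - ((x ^ (2 * n) : ℝ) : ℂ) • g x := by
    rw [dens_eq, add_sub_cancel_right]
  conv_lhs => rw [h1]
  rw [Matrix.sub_mul, Matrix.mul_nonsing_inv _ hd, Matrix.sub_mul, Matrix.one_mul,
    Matrix.smul_mul, Matrix.smul_mul]

lemma sesq_conj_inv {x : ℝ} (hp : (dens n f g x).PosSemidef) (hg : (g x).PosSemidef)
    (hd : IsUnit (dens n f g x).det) (u v : Fin T → ℂ) :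
    sesq (g x * (dens n f g x)⁻¹ * g x) u v = sesq (dens n f g x)
      (Matrix.vecMul u (g x * (dens n f g x)⁻¹)) (Matrix.vecMul v (g x * (dens n f g x)⁻¹)) := by
  have h1 : (g x * (dens n f g x)⁻¹).conjTranspose = (dens n f g x)⁻¹ * g x := by
    rw [Matrix.conjTranspose_mul, hp.1.inv.eq, hg.1.eq]
  rw [sesq_eq_vecMul (dens n f g x), Matrix.vecMul_vecMul,
    Matrix.nonsing_inv_mul_cancel_right _ _ hd, Matrix.star_vecMul, h1,
    ← Matrix.dotProduct_mulVec, Matrix.mulVec_mulVec, ← Matrix.mul_assoc, sesq]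

/-- Both terms of `g - x^{2n} g p⁻¹ g` are controlled by `g` alone: the second is dominated by the
diagonal of `g` through Cauchy–Schwarz. -/
lemma integrable_cross_matrix (hf : IsSpectralDensity f) (hg : IsSpectralDensity g)
    (hm : Minimality n μ f g) (i j : Fin T) :
    Integrable (fun x => (f x * (dens n f g x)⁻¹ * g x) i j) freq := by
  have hp := hf.dens hg n
  have hmeas : AEMeasEntries fun x => f x * (dens n f g x)⁻¹ * g x :=
    (hf.aemeasEntries.mul hp.aemeasEntries.inv).mul hg.aemeasEntries
  refine ((hg.integrable i j).norm.add ((hg.integrable i i).re.add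
    (hg.integrable j j).re)).mono' (hmeas i j).aestronglyMeasurable ?_
  filter_upwards [hf.posSemidef, hg.posSemidef, hp.posSemidef, hm.1] with x h1 h2 h3 h4
  rw [cross_matrix_eq h4, Matrix.sub_apply, Matrix.smul_apply, smul_eq_mul,
    ← sesq_single (g x * (dens n f g x)⁻¹ * g x), sesq_conj_inv h3 h2 h4]
  refine (norm_sub_le _ _).trans (add_le_add le_rfl ?_)
  have ht : 0 ≤ x ^ (2 * n) := (even_two_mul n).pow_nonneg x
  rw [norm_mul, Complex.norm_real, Real.norm_of_nonneg ht]
  have h5 := fun v => quad_conj_inv_le ht h2 h4 (quad_le_quad_dens h1) v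
  have h6 := two_norm_sesq_le h3 one_pos
    (Matrix.vecMul (Pi.single i 1) (g x * (dens n f g x)⁻¹))
    (Matrix.vecMul (Pi.single j 1) (g x * (dens n f g x)⁻¹))
  simp only [one_mul, inv_one] at h6
  have h7 := mul_le_mul_of_nonneg_left h6 ht
  have h8 := h5 (Pi.single i 1)
  have h9 := h5 (Pi.single j 1)
  have hq : ∀ k : Fin T, quad (g x) (Pi.single k 1) = (g x k k).re := fun k => by
    rw [quad_eq_sesq, sesq_single]
  have h10 := quad_nonneg h2 (Pi.single i 1)
  have h11 := quad_nonneg h2 (Pi.single j 1)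
  rw [hq] at h8 h9 h10 h11
  change _ ≤ (g x i i).re + (g x j j).re
  linarith

/-- The first summand is the price of the missing observations, the second that of the noise; they
integrate to the two terms of `errorExpr`. -/
lemma errDensity_specChar {x : ℝ} (hp : (dens n f g x).PosSemidef) (hg : (g x).PosSemidef)
    (hd : IsUnit (dens n f g x).det) :
    errDensity n N a f g (residual n μ N a (specChar n μ N a f g)) x =
      weight n μ x * quad (dens n f g x)⁻¹ (tpoly (cVec n μ N a f g) x) +
      (sesq (f x * (dens n f g x)⁻¹ * g x) (poly N a x) (poly N a x)).re := by
  have h2 : residual n μ N a (specChar n μ N a f g) x - noiseResidual n N a f g x =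
      gapResidual n μ N a f g x := by
    rw [residual_specChar]
    abel
  rw [errDensity_eq_sq hp hg hd, h2, quad_gapResidual hp hd, cross_matrix_eq hd]
  congr 1
  rw [noiseResidual, quad_smul, norm_neg_I_mul_pow_sq, quad_eq_sesq (dens n f g x),
    ← sesq_conj_inv hp hg hd, ← quad_eq_sesq, ← quad_eq_sesq, sub_eq_add_neg (g x),
    ← neg_smul, ← Complex.ofReal_neg, quad_matrix_add, quad_matrix_smul]
  ring

lemma errorExpr_eq (hμ : 0 < μ) (hf : IsSpectralDensity f) (hg : IsSpectralDensity g)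
    (hm : Minimality n μ f g) :
    errorExpr n μ N a f g = 1 / (2 * Real.pi) *
      ∫ x, errDensity n N a f g (residual n μ N a (specChar n μ N a f g)) x ∂freq := by
  have hp := hf.dens hg n
  have hQi := integrable_cross_matrix hf hg hm
  have hre : ∀ {F : ℝ → ℂ}, Integrable F freq →
      (avg F).re = 1 / (2 * Real.pi) * ∫ x, (F x).re ∂freq := by
    intro F hF
    have h1 : (1 / (2 * (Real.pi : ℂ))) = ((1 / (2 * Real.pi) : ℝ) : ℂ) := by push_cast; rfl
    have h2 : ∫ x, (F x).re ∂freq = (∫ x, F x ∂freq).re := integral_re hF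
    rw [avg, h1, Complex.re_ofReal_mul, h2]
  have hw := integrable_weight_sesq hf hg hm (cVec n μ N a f g)
  have hQ : Integrable (fun x => sesq (f x * (dens n f g x)⁻¹ * g x) (poly N a x) (poly N a x))
      freq := by
    rw [poly_eq_tpoly]; exact integrable_sesq_tpoly hQi
  have h1 := PMat_dotProduct (N := N) hf hg hm (cVec n μ N a f g)
  -- As `P c` is the right-hand side, its product with `c` is the Toeplitz form of `P` at `c`.
  rw [PMat_mulVec_cVec hμ hf hg hm] at h1
  have h2 : dotProduct ((QMat n N f g).mulVec fun i => a i.1 i.2)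
      (star fun i : Fin (N + 1) × Fin T => a i.1 i.2) =
      avg fun x => sesq (f x * (dens n f g x)⁻¹ * g x) (poly N a x) (poly N a x) := by
    rw [poly_eq_tpoly]
    exact toeplitz_dotProduct hQi
  rw [errorExpr, h1, h2, hre hw, hre hQ, ← mul_add, ← integral_add]
  · congr 1
    refine integral_congr_ae ?_
    filter_upwards [hg.posSemidef, hp.posSemidef, hm.1] with x h3 h4 h5
    rw [errDensity_specChar h4 h3 h5, Complex.re_ofReal_mul]
    rfl
  · exact hw.re
  · exact hQ.re

/-- Under the minimality condition the error expression is the optimal mean-square error. -/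
theorem optError_eq_errorExpr (hμ : 0 < μ) (hf : IsSpectralDensity f) (hg : IsSpectralDensity g)
    (hm : Minimality n μ f g) :
    optError n μ N a f g = ENNReal.ofReal (errorExpr n μ N a f g) := by
  rw [← (isOptimal_specChar hμ hf hg hm).2, errorExpr_eq hμ hf hg hm,
    mse_eq_ofReal hf hg (aemeasurable_specChar hf hg) (integrable_quad_specChar hf hg hm)]

end ErrDensity

/-! ### Least favorable densities and minimax characteristics -/

section Comparison

variable {n μ N : ℕ} {a : ℕ → Fin T → ℂ} {f g f' g' : ℝ → Matrix (Fin T) (Fin T) ℂ}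
  {h : ℝ → Fin T → ℂ} {s t : ℝ}

/-- The generators do not depend on the densities, and a larger density has a finer norm, hence a
smaller closure. -/
lemma charSpace_subset_of_le {c : ℝ} (hc : 0 < c)
    (hle : ∀ᵐ x ∂freq, ∀ v, c * quad (dens n f g x) v ≤ quad (dens n f' g' x) v) :
    charSpace n μ N f' g' ⊆ charSpace n μ N f g := by
  rintro h ⟨hm, hε⟩
  refine ⟨hm, fun ε hε0 => ?_⟩
  have hc0 : ENNReal.ofReal c ≠ 0 := by simpa using hc
  obtain ⟨d, hd, hlt⟩ := hε (ENNReal.ofReal c * ε) (ENNReal.mul_pos hc0 hε0.ne')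
  refine ⟨d, hd, ?_⟩
  have h1 : ENNReal.ofReal c * sqNorm (dens n f g) (h - finChar n μ d) ≤
      sqNorm (dens n f' g') (h - finChar n μ d) := by
    rw [sqNorm, sqNorm, ← lintegral_const_mul' _ _ ENNReal.ofReal_ne_top]
    refine lintegral_mono_ae ?_
    filter_upwards [hle] with x hx
    rw [← ENNReal.ofReal_mul hc.le]
    exact ENNReal.ofReal_le_ofReal (hx _)
  exact lt_of_mul_lt_mul_left' (h1.trans_lt hlt)

/-- A null vector of the larger density is a null vector of the smaller one, and inversion reverses
the order of forms. Thus one nondegenerate pair makes all its mixtures nondegenerate. -/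
lemma Minimality.of_le {c : ℝ} (hc : 0 < c) (hf : IsSpectralDensity f) (hg : IsSpectralDensity g)
    (hf' : IsSpectralDensity f') (hg' : IsSpectralDensity g') (hm : Minimality n μ f g)
    (hle : ∀ᵐ x ∂freq, ∀ v, c * quad (PeriodicIncrements.dens n f g x) v ≤
      quad (PeriodicIncrements.dens n f' g' x) v) : Minimality n μ f' g' := by
  have hp := hf.dens hg n
  have hp' := hf'.dens hg' n
  have hdet : ∀ᵐ x ∂freq, IsUnit (PeriodicIncrements.dens n f' g' x).det := by
    filter_upwards [hle, hp.posSemidef, hm.1] with x h1 h2 h3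
    rw [isUnit_iff_ne_zero]
    intro h0
    obtain ⟨y, hy, hy0⟩ := Matrix.exists_mulVec_eq_zero_iff.2 h0
    have h4 := h1 (star y)
    have h5 : quad (PeriodicIncrements.dens n f' g' x) (star y) = 0 := by
      rw [quad, star_star, hy0, dotProduct_zero, Complex.zero_re]
    have h6 : quad (PeriodicIncrements.dens n f g x) (star y) = 0 := by
      have := quad_nonneg h2 (star y)
      nlinarith
    exact hy (star_eq_zero.1 (eq_zero_of_quad_eq_zero h2 h3 h6))
  refine ⟨hdet, (hm.2.re.const_mul c⁻¹).mono' ?_ ?_⟩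
  · refine AEMeasurable.aestronglyMeasurable ?_
    simp only [Matrix.trace, Matrix.diag, Matrix.smul_apply]
    exact Finset.aemeasurable_fun_sum _ fun i _ => AEMeasurable.smul
      (f := fun x : ℝ => ((weight n μ x : ℝ) : ℂ))
      ((Complex.measurable_ofReal.comp (measurable_weight n μ)).aemeasurable)
      (hp'.aemeasEntries.inv i i)
  · filter_upwards [hle, hp.posSemidef, hp'.posSemidef, hm.1, hdet] with x h1 h2 h3 h4 h5
    have htr : ∀ M : Matrix (Fin T) (Fin T) ℂ, M.IsHermitian →
        (((weight n μ x : ℝ) : ℂ) • M).trace =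
          ((weight n μ x * ∑ i, quad M (Pi.single i 1) : ℝ) : ℂ) := by
      intro M hM
      rw [Matrix.trace_smul, smul_eq_mul, Complex.ofReal_mul, Complex.ofReal_sum, Matrix.trace]
      congr 1
      refine Finset.sum_congr rfl fun i _ => ?_
      rw [← sesq_self hM, sesq_single, Matrix.diag_apply]
    rw [htr _ h3.1.inv, htr _ h2.1.inv, Complex.norm_real]
    rw [RCLike.re_to_complex, Complex.ofReal_re, Real.norm_of_nonneg (mul_nonneg (weight_nonneg n μ x)
      (Finset.sum_nonneg fun i _ => quad_nonneg h3.inv _)), mul_left_comm]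
    refine mul_le_mul_of_nonneg_left ?_ (weight_nonneg n μ x)
    rw [Finset.mul_sum]
    refine Finset.sum_le_sum fun i _ => ?_
    rw [le_inv_mul_iff₀ hc]
    exact quad_inv_antitone hc h2 h3 h4 h5 h1 _

lemma quad_convex_comb (s t : ℝ) (M M' : Matrix (Fin T) (Fin T) ℂ) (v : Fin T → ℂ) :
    quad (s • M + t • M') v = s * quad M v + t * quad M' v := by
  have hr : ∀ (r : ℝ) (A : Matrix (Fin T) (Fin T) ℂ), r • A = (r : ℂ) • A := fun r A => by
    ext i j; simp
  rw [hr, hr, quad_matrix_add, quad_matrix_smul, quad_matrix_smul]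

lemma quad_dens_convex_comb (x : ℝ) (v : Fin T → ℂ) :
    quad (dens n (s • f + t • f') (s • g + t • g') x) v =
      s * quad (dens n f g x) v + t * quad (dens n f' g' x) v := by
  simp only [quad_dens, Pi.add_apply, Pi.smul_apply, quad_convex_comb]
  ring

lemma lavg_convex_comb (hs : 0 ≤ s) (ht : 0 ≤ t) {F G : ℝ → ℝ} (hF : AEMeasurable F freq)
    (hF0 : ∀ᵐ x ∂freq, 0 ≤ F x) (hG0 : ∀ᵐ x ∂freq, 0 ≤ G x) :
    lavg (fun x => ENNReal.ofReal (s * F x + t * G x)) =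
      ENNReal.ofReal s * lavg (fun x => ENNReal.ofReal (F x)) +
        ENNReal.ofReal t * lavg (fun x => ENNReal.ofReal (G x)) := by
  have h1 : ∫⁻ x, ENNReal.ofReal (s * F x + t * G x) ∂freq =
      ∫⁻ x, (ENNReal.ofReal s * ENNReal.ofReal (F x) +
        ENNReal.ofReal t * ENNReal.ofReal (G x)) ∂freq := by
    refine lintegral_congr_ae ?_
    filter_upwards [hF0, hG0] with x h1 h2
    rw [ENNReal.ofReal_add (mul_nonneg hs h1) (mul_nonneg ht h2), ENNReal.ofReal_mul hs,
      ENNReal.ofReal_mul ht]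
  rw [lavg, lavg, lavg, h1, lintegral_add_left' (hF.ennreal_ofReal.const_mul _),
    lintegral_const_mul' _ _ ENNReal.ofReal_ne_top, lintegral_const_mul' _ _ ENNReal.ofReal_ne_top]
  ring

/-- The residual of a fixed `h` does not involve the densities, which enter the two forms linearly.
Extended nonnegative values allow an infinite error at either pair. -/
lemma mse_convex_comb (hs : 0 ≤ s) (ht : 0 ≤ t) (hf : IsSpectralDensity f)
    (hg : IsSpectralDensity g) (hf' : IsSpectralDensity f') (hg' : IsSpectralDensity g')
    (hh : AEMeasurable h freq) :
    mse n μ N a h (s • f + t • f') (s • g + t • g') =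
      ENNReal.ofReal s * mse n μ N a h f g + ENNReal.ofReal t * mse n μ N a h f' g' := by
  have hu := aemeasurable_residual (n := n) (μ := μ) (N := N) (a := a) hh
  have hr : ∀ x, chi n μ x • poly N (bCoeff n μ N a) x - h x = residual n μ N a h x :=
    fun _ => rfl
  simp only [mse, hr, Pi.add_apply, Pi.smul_apply, quad_convex_comb]
  rw [lavg_convex_comb hs ht (aemeasurable_quad hf.aemeasEntries hu)
    (hf.posSemidef.mono fun x hx => quad_nonneg hx _)
    (hf'.posSemidef.mono fun x hx => quad_nonneg hx _),
    lavg_convex_comb hs ht (aemeasurable_quad hg.aemeasEntries (aemeasurable_noise_term hu))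
    (hg.posSemidef.mono fun x hx => quad_nonneg hx _)
    (hg'.posSemidef.mono fun x hx => quad_nonneg hx _)]
  ring

lemma ae_le_quad_dens_convex_comb (ht : 0 ≤ t) (hf' : IsSpectralDensity f')
    (hg' : IsSpectralDensity g') : ∀ᵐ x ∂freq, ∀ v, s * quad (dens n f g x) v ≤
      quad (dens n (s • f + t • f') (s • g + t • g') x) v := by
  filter_upwards [(hf'.dens hg' n).posSemidef] with x hx v
  rw [quad_dens_convex_comb]
  linarith [mul_nonneg ht (quad_nonneg hx v)]

lemma tendsto_zero_of_quad {M : Matrix (Fin T) (Fin T) ℂ} (hM : M.PosSemidef)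
    (hd : IsUnit M.det) {v : ℕ → Fin T → ℂ}
    (hv : Filter.Tendsto (fun k => quad M (v k)) Filter.atTop (nhds 0)) :
    Filter.Tendsto v Filter.atTop (nhds 0) := by
  refine tendsto_pi_nhds.2 fun q => ?_
  rw [Metric.tendsto_atTop]
  intro ε hε
  set R := |(M⁻¹ q q).re| + 1 with hR
  have hR0 : 0 < R := by positivity
  -- With the threshold `ε² / R` and the parameter `R / ε`, each of the two terms bounding `2 ‖v_q‖`
  -- is at most `ε`.
  obtain ⟨K, hK⟩ := Metric.tendsto_atTop.1 hv (ε ^ 2 / R) (by positivity)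
  refine ⟨K, fun k hk => ?_⟩
  have h1 := two_norm_apply_le hM hd (div_pos hR0 hε) (v k) q
  have h2 := hK k hk
  rw [dist_zero_right, Real.norm_of_nonneg (quad_nonneg hM _), lt_div_iff₀ hR0] at h2
  rw [Pi.zero_apply, dist_zero_right]
  have h3 : R / ε * quad M (v k) < ε := by
    rw [div_mul_eq_mul_div, div_lt_iff₀ hε]
    nlinarith
  have h4 : (R / ε)⁻¹ * (M⁻¹ q q).re ≤ ε := by
    rw [inv_div, div_mul_eq_mul_div, div_le_iff₀ hR0]
    have := le_abs_self (M⁻¹ q q).re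
    nlinarith
  linarith

lemma continuous_quad (M : Matrix (Fin T) (Fin T) ℂ) : Continuous (quad M) := by
  have : Continuous fun v => sesq M v v := by
    simp only [sesq_eq_sum]
    fun_prop
  exact Complex.continuous_re.comp this

/-- Lower semicontinuity of the mean-square error for convergence in `L₂` with respect to an
invertible density. -/
lemma mse_le_of_tendsto {f₀ g₀ : ℝ → Matrix (Fin T) (Fin T) ℂ} (hf₀ : IsSpectralDensity f₀)
    (hg₀ : IsSpectralDensity g₀) (hd : ∀ᵐ x ∂freq, IsUnit (dens n f₀ g₀ x).det)
    (hf : IsSpectralDensity f) (hg : IsSpectralDensity g) (hh : AEMeasurable h freq)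
    {u : ℕ → ℝ → Fin T → ℂ} (hu : ∀ k, AEMeasurable (u k) freq)
    (hsum : ∑' k, sqNorm (dens n f₀ g₀) (fun x => h x - u k x) ≠ ⊤) {V : ENNReal}
    (hV : ∀ k, mse n μ N a (u k) f g ≤ V) : mse n μ N a h f g ≤ V := by
  have hp := hf₀.dens hg₀ n
  have hmeas : ∀ k, AEMeasurable (fun x => ENNReal.ofReal
      (quad (dens n f₀ g₀ x) (h x - u k x))) freq := fun k =>
    (aemeasurable_quad hp.aemeasEntries (hh.sub (hu k))).ennreal_ofReal
  -- Summable squared distances have an almost everywhere finite sum, so the whole sequence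
  -- converges pointwise and no subsequence is needed.
  have hae : ∀ᵐ x ∂freq, ∑' k, ENNReal.ofReal (quad (dens n f₀ g₀ x) (h x - u k x)) < ⊤ := by
    refine ae_lt_top' (AEMeasurable.tsum hmeas) ?_
    rw [lintegral_tsum hmeas]
    exact hsum
  have hlim : ∀ᵐ x ∂freq, Filter.Tendsto (fun k => u k x) Filter.atTop (nhds (h x)) := by
    filter_upwards [hae, hp.posSemidef, hd] with x h1 h2 h3
    have h4 := ENNReal.tendsto_atTop_zero_of_tsum_ne_top h1.ne
    have h5 : Filter.Tendsto (fun k => quad (dens n f₀ g₀ x) (h x - u k x)) Filter.atTop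
        (nhds 0) := by
      have := (ENNReal.tendsto_toReal ENNReal.zero_ne_top).comp h4
      simpa [Function.comp_def, ENNReal.toReal_ofReal (quad_nonneg h2 _)] using this
    have h6 := tendsto_zero_of_quad h2 h3 h5
    simpa using (tendsto_const_nhds (x := h x)).sub h6
  have hE : ∀ᵐ x ∂freq, ENNReal.ofReal (errDensity n N a f g (residual n μ N a h) x) =
      Filter.liminf (fun k => ENNReal.ofReal (errDensity n N a f g (residual n μ N a (u k)) x))
        Filter.atTop := by
    filter_upwards [hlim] with x hx
    refine (Filter.Tendsto.liminf_eq ?_).symm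
    refine ENNReal.tendsto_ofReal ?_
    have h1 : Filter.Tendsto (fun k => residual n μ N a (u k) x) Filter.atTop
        (nhds (residual n μ N a h x)) := tendsto_const_nhds.sub hx
    exact (((continuous_quad _).tendsto _).comp h1).add (((continuous_quad _).tendsto _).comp
      ((h1.const_smul _).sub_const _))
  have hc0 : ENNReal.ofReal (1 / (2 * Real.pi)) ≠ 0 := by
    have := Real.pi_pos
    simp only [ne_eq, ENNReal.ofReal_eq_zero, not_le]
    positivity
  have hk : ∀ k, ∫⁻ x, ENNReal.ofReal (errDensity n N a f g (residual n μ N a (u k)) x) ∂freq ≤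
      V / ENNReal.ofReal (1 / (2 * Real.pi)) := by
    intro k
    rw [ENNReal.le_div_iff_mul_le (Or.inl hc0) (Or.inl ENNReal.ofReal_ne_top), mul_comm]
    have := hV k
    rwa [mse_eq_lavg hf hg (hu k)] at this
  rw [mse_eq_lavg hf hg hh, lavg, mul_comm, ← ENNReal.le_div_iff_mul_le (Or.inl hc0)
    (Or.inl ENNReal.ofReal_ne_top), lintegral_congr_ae hE]
  -- Fatou's lemma: the integrands converge almost everywhere by continuity of the two forms.
  refine (lintegral_liminf_le' fun k =>
    (aemeasurable_errDensity hf hg (aemeasurable_residual (hu k))).ennreal_ofReal).trans ?_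
  refine Filter.liminf_le_of_frequently_le' (Filter.Frequently.of_forall hk)

end Comparison

/-! ### The saddle point inequality from mixtures of pairs. -/

section Minimax

variable {n μ N : ℕ} {a : ℕ → Fin T → ℂ} {Df Dg : Set (ℝ → Matrix (Fin T) (Fin T) ℂ)}
  {f₀ g₀ f g : ℝ → Matrix (Fin T) (Fin T) ℂ} {s t : ℝ}

/-- The optimal characteristic of a mixture of a maximising pair with another pair, tested
against both pairs. -/
lemma exists_mixture_char (hμ : 0 < μ) (hDf : ∀ f ∈ Df, IsSpectralDensity f)
    (hDg : ∀ g ∈ Dg, IsSpectralDensity g) (hf₀ : f₀ ∈ Df) (hg₀ : g₀ ∈ Dg)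
    (hmin : Minimality n μ f₀ g₀)
    (hmax : ∀ f ∈ Df, ∀ g ∈ Dg, Minimality n μ f g →
      errorExpr n μ N a f g ≤ errorExpr n μ N a f₀ g₀)
    (hcf : Convex ℝ Df) (hcg : Convex ℝ Dg) (hf : f ∈ Df) (hg : g ∈ Dg)
    (hs : 0 < s) (ht : 0 < t) (hst : s + t = 1) :
    ∃ h ∈ charSpace n μ N f₀ g₀, h ∈ charSpace n μ N f g ∧
      ENNReal.ofReal s * mse n μ N a h f₀ g₀ + ENNReal.ofReal t * mse n μ N a h f g ≤
        optError n μ N a f₀ g₀ := by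
  have hft : s • f₀ + t • f ∈ Df := hcf hf₀ hf hs.le ht.le hst
  have hgt : s • g₀ + t • g ∈ Dg := hcg hg₀ hg hs.le ht.le hst
  have hle₀ : ∀ᵐ x ∂freq, ∀ v, s * quad (dens n f₀ g₀ x) v ≤
      quad (dens n (s • f₀ + t • f) (s • g₀ + t • g) x) v :=
    ae_le_quad_dens_convex_comb ht.le (hDf f hf) (hDg g hg)
  have hle : ∀ᵐ x ∂freq, ∀ v, t * quad (dens n f g x) v ≤
      quad (dens n (s • f₀ + t • f) (s • g₀ + t • g) x) v := by
    rw [add_comm (s • f₀), add_comm (s • g₀)]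
    exact ae_le_quad_dens_convex_comb hs.le (hDf f₀ hf₀) (hDg g₀ hg₀)
  -- Minimality of the mixture comes from the maximising pair alone, so the maximality hypothesis
  -- applies to it.
  have hm : Minimality n μ (s • f₀ + t • f) (s • g₀ + t • g) :=
    hmin.of_le hs (hDf f₀ hf₀) (hDg g₀ hg₀) (hDf _ hft) (hDg _ hgt) hle₀
  have hopt := isOptimal_specChar (N := N) (a := a) hμ (hDf _ hft) (hDg _ hgt) hm
  refine ⟨_, charSpace_subset_of_le hs hle₀ hopt.1, charSpace_subset_of_le ht hle hopt.1, ?_⟩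
  rw [← mse_convex_comb hs.le ht.le (hDf f₀ hf₀) (hDg g₀ hg₀) (hDf f hf) (hDg g hg) hopt.1.1,
    hopt.2, optError_eq_errorExpr hμ (hDf _ hft) (hDg _ hgt) hm,
    optError_eq_errorExpr hμ (hDf f₀ hf₀) (hDg g₀ hg₀) hmin]
  exact ENNReal.ofReal_le_ofReal (hmax _ hft _ hgt hm)

/-- Write `V` as `s V + t V` and cancel; the cancellation requires `V` to be finite. -/
lemma le_of_convex_comb_le {V X : ENNReal} (hV : V ≠ ⊤) (hs : 0 ≤ s) (ht : 0 < t)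
    (hst : s + t = 1) (h : ENNReal.ofReal s * V + ENNReal.ofReal t * X ≤ V) : X ≤ V := by
  have h1 : ENNReal.ofReal s * V + ENNReal.ofReal t * V = V := by
    rw [← add_mul, ← ENNReal.ofReal_add hs ht.le, hst, ENNReal.ofReal_one, one_mul]
  have h2 : ENNReal.ofReal s * V + ENNReal.ofReal t * X ≤
      ENNReal.ofReal s * V + ENNReal.ofReal t * V := by rwa [h1]
  have h3 := (ENNReal.add_le_add_iff_left (ENNReal.mul_ne_top ENNReal.ofReal_ne_top hV)).1 h2
  exact (ENNReal.mul_le_mul_iff_right (by simpa using ht) ENNReal.ofReal_ne_top).1 h3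

theorem leastFavorable_of_isMax (hμ : 0 < μ) (hDf : ∀ f ∈ Df, IsSpectralDensity f)
    (hDg : ∀ g ∈ Dg, IsSpectralDensity g) (hf₀ : f₀ ∈ Df) (hg₀ : g₀ ∈ Dg)
    (hmin : Minimality n μ f₀ g₀)
    (hmax : ∀ f ∈ Df, ∀ g ∈ Dg, Minimality n μ f g →
      errorExpr n μ N a f g ≤ errorExpr n μ N a f₀ g₀)
    (h : (∀ f ∈ Df, ∀ g ∈ Dg, Minimality n μ f g) ∨ (Convex ℝ Df ∧ Convex ℝ Dg)) :
    LeastFavorable n μ N a Df Dg f₀ g₀ := by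
  refine ⟨hf₀, hg₀, fun f hf g hg => ?_⟩
  have h₀ := optError_eq_errorExpr (N := N) (a := a) hμ (hDf f₀ hf₀) (hDg g₀ hg₀) hmin
  rcases h with h | ⟨hcf, hcg⟩
  · rw [h₀, optError_eq_errorExpr hμ (hDf f hf) (hDg g hg) (h f hf g hg)]
    exact ENNReal.ofReal_le_ofReal (hmax f hf g hg (h f hf g hg))
  -- Equal weights suffice: the mixture characteristic is admissible for both pairs, so both of its
  -- errors may be lowered to the optimal ones.
  · obtain ⟨k, hk₀, hk, hle⟩ := exists_mixture_char hμ hDf hDg hf₀ hg₀ hmin hmax hcf hcg hf hg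
      (s := 1 / 2) (t := 1 / 2) (by norm_num) (by norm_num) (by norm_num)
    refine le_of_convex_comb_le (s := 1 / 2) (t := 1 / 2) (by rw [h₀]; exact ENNReal.ofReal_ne_top)
      (by norm_num) (by norm_num) (by norm_num) (le_trans ?_ hle)
    gcongr
    · exact iInf₂_le _ hk₀
    · exact iInf₂_le _ hk

/-- The optimal characteristic of a maximising pair has its largest error at that pair. -/
theorem mse_specChar_le (hμ : 0 < μ) (hDf : ∀ f ∈ Df, IsSpectralDensity f)
    (hDg : ∀ g ∈ Dg, IsSpectralDensity g) (hf₀ : f₀ ∈ Df) (hg₀ : g₀ ∈ Dg)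
    (hmin : Minimality n μ f₀ g₀)
    (hmax : ∀ f ∈ Df, ∀ g ∈ Dg, Minimality n μ f g →
      errorExpr n μ N a f g ≤ errorExpr n μ N a f₀ g₀)
    (hcf : Convex ℝ Df) (hcg : Convex ℝ Dg) (hf : f ∈ Df) (hg : g ∈ Dg) :
    mse n μ N a (specChar n μ N a f₀ g₀) f g ≤ mse n μ N a (specChar n μ N a f₀ g₀) f₀ g₀ := by
  have h₀ := optError_eq_errorExpr (N := N) (a := a) hμ (hDf f₀ hf₀) (hDg g₀ hg₀) hmin
  have hopt := isOptimal_specChar (N := N) (a := a) hμ (hDf f₀ hf₀) (hDg g₀ hg₀) hmin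
  have hVtop : optError n μ N a f₀ g₀ ≠ ⊤ := by rw [h₀]; exact ENNReal.ofReal_ne_top
  -- The weights `2^{-(k+1)}` of the arbitrary pair are summable and leave the maximising pair a
  -- weight of at least `1 / 2`.
  have ht : ∀ k : ℕ, 0 < (1 / 2 : ℝ) ^ (k + 1) := fun k => by positivity
  have hs : ∀ k : ℕ, (1 / 2 : ℝ) ≤ 1 - (1 / 2 : ℝ) ^ (k + 1) := fun k => by
    have : (1 / 2 : ℝ) ^ k ≤ 1 := pow_le_one₀ (by norm_num) (by norm_num)
    rw [pow_succ]
    linarith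
  have hs0 : ∀ k : ℕ, 0 < 1 - (1 / 2 : ℝ) ^ (k + 1) := fun k => by linarith [hs k]
  choose u hu₀ hu hle using fun k : ℕ => exists_mixture_char hμ hDf hDg hf₀ hg₀ hmin hmax hcf hcg
    hf hg (hs0 k) (ht k) (sub_add_cancel _ _)
  rw [hopt.2]
  refine mse_le_of_tendsto (hDf f₀ hf₀) (hDg g₀ hg₀) hmin.1 (hDf f hf) (hDg g hg) hopt.1.1
    (fun k => (hu k).1) ?_ fun k => ?_
  · set V := optError n μ N a f₀ g₀ with hV
    set c := ENNReal.ofReal (1 / (2 * Real.pi)) with hc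
    have hc0 : c ≠ 0 := by
      have := Real.pi_pos
      simp only [hc, ne_eq, ENNReal.ofReal_eq_zero, not_le]
      positivity
    -- By Pythagoras the mixture inequality reads `(1 - t)(V + c ‖h⁰ - u_k‖²) ≤ (1 - t) V + t V`;
    -- cancelling bounds the squared distance by a multiple of `t`.
    have hk : ∀ k, ENNReal.ofReal (1 / 2) * (c * sqNorm (dens n f₀ g₀)
        (fun x => specChar n μ N a f₀ g₀ x - u k x)) ≤ ENNReal.ofReal ((1 / 2) ^ (k + 1)) * V := by
      intro k
      have h1 := (le_self_add).trans (hle k)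
      rw [mse_eq_add hμ (hDf f₀ hf₀) (hDg g₀ hg₀) hmin (hu₀ k), hopt.2, ← hV, ← hc, mul_add] at h1
      have h2 : V = ENNReal.ofReal (1 - (1 / 2) ^ (k + 1)) * V +
          ENNReal.ofReal ((1 / 2) ^ (k + 1)) * V := by
        rw [← add_mul, ← ENNReal.ofReal_add (hs0 k).le (ht k).le, sub_add_cancel,
          ENNReal.ofReal_one, one_mul]
      have h3 := (ENNReal.add_le_add_iff_left
        (ENNReal.mul_ne_top ENNReal.ofReal_ne_top hVtop)).1 (h1.trans_eq h2)
      refine le_trans ?_ h3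
      gcongr
      exact hs k
    have hsum : ∑' k : ℕ, ENNReal.ofReal ((1 / 2 : ℝ) ^ (k + 1)) * V ≠ ⊤ := by
      rw [ENNReal.tsum_mul_right]
      refine ENNReal.mul_ne_top ?_ hVtop
      have hsumm : Summable fun k : ℕ => (1 / 2 : ℝ) ^ (k + 1) :=
        (summable_nat_add_iff 1).2 summable_geometric_two
      rw [← ENNReal.ofReal_tsum_of_nonneg (fun k => (ht k).le) hsumm]
      exact ENNReal.ofReal_ne_top
    have h1 := ne_top_of_le_ne_top hsum (ENNReal.tsum_le_tsum hk)
    rw [ENNReal.tsum_mul_left, ENNReal.tsum_mul_left] at h1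
    intro h2
    rw [h2, ENNReal.mul_top hc0, ENNReal.mul_top (by simp)] at h1
    exact h1 rfl
  -- The error of `u k` at the maximising pair is at least `V`, so at the other pair it is at most
  -- `V`, uniformly in `k`.
  · refine le_of_convex_comb_le hVtop (hs0 k).le (ht k) (sub_add_cancel _ _) (le_trans ?_ (hle k))
    gcongr
    exact iInf₂_le _ (hu₀ k)

/-- Saddle point: any robust characteristic already has error at least `V` at the maximising pair,
while the explicit one never exceeds `V`. -/
theorem minimaxRobust_specChar (hμ : 0 < μ) (hDf : ∀ f ∈ Df, IsSpectralDensity f)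
    (hDg : ∀ g ∈ Dg, IsSpectralDensity g) (hf₀ : f₀ ∈ Df) (hg₀ : g₀ ∈ Dg)
    (hmin : Minimality n μ f₀ g₀)
    (hmax : ∀ f ∈ Df, ∀ g ∈ Dg, Minimality n μ f g →
      errorExpr n μ N a f g ≤ errorExpr n μ N a f₀ g₀)
    (hcf : Convex ℝ Df) (hcg : Convex ℝ Dg)
    (hrob : specChar n μ N a f₀ g₀ ∈ robustSpace n μ N Df Dg) :
    MinimaxRobust n μ N a Df Dg (specChar n μ N a f₀ g₀) := by
  have hle : ∀ f ∈ Df, ∀ g ∈ Dg, mse n μ N a (specChar n μ N a f₀ g₀) f g ≤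
      mse n μ N a (specChar n μ N a f₀ g₀) f₀ g₀ := fun f hf g hg =>
    mse_specChar_le hμ hDf hDg hf₀ hg₀ hmin hmax hcf hcg hf hg
  refine ⟨hrob, ⟨f₀, hf₀, g₀, hg₀, hle⟩, fun h hh => ?_⟩
  refine (iSup₂_le fun f hf => iSup₂_le fun g hg => hle f hf g hg).trans ?_
  rw [(isOptimal_specChar hμ (hDf f₀ hf₀) (hDg g₀ hg₀) hmin).2]
  refine (iInf₂_le h (hh f₀ hf₀ g₀ hg₀)).trans ?_
  exact (le_iSup₂ (f := fun g _ => mse n μ N a h f₀ g) g₀ hg₀).trans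
    (le_iSup₂ (f := fun f _ => ⨆ g ∈ Dg, mse n μ N a h f g) f₀ hf₀)

end Minimax

/-! ### The isometry between random variables and spectral characteristics -/

section Isometry

variable {Ω : Type*} {ι κ : Type*}

/-- The linear span of pairs formed by a random variable and its spectral characteristic. -/
def specSpan (X : ι → Ω → ℂ) (Φ : ι → ℝ → Fin T → ℂ) :
    Submodule ℂ ((Ω → ℂ) × (ℝ → Fin T → ℂ)) :=
  Submodule.span ℂ (Set.range fun i => (X i, Φ i))

variable {X : ι → Ω → ℂ} {Φ : ι → ℝ → Fin T → ℂ} {X' : κ → Ω → ℂ} {Φ' : κ → ℝ → Fin T → ℂ}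
  {M : ℝ → Matrix (Fin T) (Fin T) ℂ} {y z : (Ω → ℂ) × (ℝ → Fin T → ℂ)}

lemma aemeasurable_of_mem_specSpan (hΦ : ∀ i, Measurable (Φ i)) (hy : y ∈ specSpan X Φ) :
    AEMeasurable y.2 freq := by
  induction hy using Submodule.span_induction with
  | mem y h => obtain ⟨i, rfl⟩ := h; exact (hΦ i).aemeasurable
  | zero => exact measurable_zero.aemeasurable
  | add y z _ _ h1 h2 => exact h1.add h2
  | smul c y _ h1 => exact h1.const_smul c

lemma integrable_quad_of_mem_specSpan (hM : IsSpectralDensity M) (hΦ : ∀ i, Measurable (Φ i))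
    (hΦi : ∀ i, Integrable (fun x => quad (M x) (Φ i x)) freq) (hy : y ∈ specSpan X Φ) :
    Integrable (fun x => quad (M x) (y.2 x)) freq := by
  induction hy using Submodule.span_induction with
  | mem y h => obtain ⟨i, rfl⟩ := h; exact hΦi i
  | zero => simp [quad_zero]
  | add y z hy hz h1 h2 =>
    exact integrable_quad_add hM.posSemidef hM.aemeasEntries
      (aemeasurable_of_mem_specSpan hΦ hy) (aemeasurable_of_mem_specSpan hΦ hz) h1 h2
  | smul c y _ h1 =>
    simp only [Prod.smul_snd, Pi.smul_apply, quad_smul]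
    exact h1.const_mul _

variable [MeasurableSpace Ω] {P : Measure Ω}

lemma memLp_of_mem_specSpan (hX : ∀ i, MemLp (X i) 2 P) (hy : y ∈ specSpan X Φ) :
    MemLp y.1 2 P := by
  induction hy using Submodule.span_induction with
  | mem y h => obtain ⟨i, rfl⟩ := h; exact hX i
  | zero => exact MemLp.zero
  | add y z _ _ h1 h2 => exact h1.add h2
  | smul c y _ h1 => exact h1.const_smul c

lemma integrable_mul_star {F G : Ω → ℂ} (hF : MemLp F 2 P) (hG : MemLp G 2 P) :
    Integrable (fun ω => F ω * star (G ω)) P :=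
  hF.integrable_mul hG.star

lemma integral_mul_star_add_left {F F' G : Ω → ℂ} (hF : MemLp F 2 P) (hF' : MemLp F' 2 P)
    (hG : MemLp G 2 P) : ∫ ω, (F + F') ω * star (G ω) ∂P =
      ∫ ω, F ω * star (G ω) ∂P + ∫ ω, F' ω * star (G ω) ∂P := by
  simp only [Pi.add_apply, add_mul]
  exact integral_add (integrable_mul_star hF hG) (integrable_mul_star hF' hG)

lemma integral_mul_star_smul_left (c : ℂ) (F G : Ω → ℂ) : ∫ ω, (c • F) ω * star (G ω) ∂P =
      c * ∫ ω, F ω * star (G ω) ∂P := by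
  simp only [Pi.smul_apply, smul_eq_mul, mul_assoc]
  exact integral_const_mul _ _

lemma integral_star_mul_swap (F G : Ω → ℂ) :
    ∫ ω, F ω * star (G ω) ∂P = star (∫ ω, G ω * star (F ω) ∂P) := by
  have h : ∫ ω, star (G ω * star (F ω)) ∂P = star (∫ ω, G ω * star (F ω) ∂P) := integral_conj
  rw [← h]
  simp only [star_mul', star_star, mul_comm]

lemma integral_mul_star_eq_zero (hX : ∀ i, MemLp (X i) 2 P) (hX' : ∀ i, MemLp (X' i) 2 P)
    (h0 : ∀ i j, ∫ ω, X i ω * star (X' j ω) ∂P = 0) (hy : y ∈ specSpan X Φ)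
    (hz : z ∈ specSpan X' Φ') : ∫ ω, y.1 ω * star (z.1 ω) ∂P = 0 := by
  induction hy using Submodule.span_induction with
  | mem y h =>
    obtain ⟨i, rfl⟩ := h
    rw [integral_star_mul_swap, star_eq_zero]
    induction hz using Submodule.span_induction with
    | mem z h =>
      obtain ⟨j, rfl⟩ := h
      rw [integral_star_mul_swap, star_eq_zero]
      exact h0 i j
    | zero => simp
    | add y z hy hz h1 h2 =>
      rw [Prod.fst_add, integral_mul_star_add_left (memLp_of_mem_specSpan hX' hy)
        (memLp_of_mem_specSpan hX' hz) (hX i), h1, h2, add_zero]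
    | smul c y _ h1 => rw [Prod.smul_fst, integral_mul_star_smul_left, h1, mul_zero]
  | zero => simp
  | add y y' hy hy' h1 h2 =>
    rw [Prod.fst_add, integral_mul_star_add_left (memLp_of_mem_specSpan hX hy)
      (memLp_of_mem_specSpan hX hy') (memLp_of_mem_specSpan hX' hz), h1, h2, add_zero]
  | smul c y _ h1 => rw [Prod.smul_fst, integral_mul_star_smul_left, h1, mul_zero]

lemma avg_add {F G : ℝ → ℂ} (hF : Integrable F freq) (hG : Integrable G freq) :
    avg (fun x => F x + G x) = avg F + avg G := by
  rw [avg, avg, avg, integral_add hF hG, mul_add]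

lemma avg_const_mul (c : ℂ) (F : ℝ → ℂ) : avg (fun x => c * F x) = c * avg F := by
  rw [avg, avg, integral_const_mul]
  ring

lemma avg_sesq_swap (hM : IsSpectralDensity M) (u v : ℝ → Fin T → ℂ) :
    avg (fun x => sesq (M x) (u x) (v x)) = star (avg fun x => sesq (M x) (v x) (u x)) := by
  have h : ∫ x, star (sesq (M x) (v x) (u x)) ∂freq = star (∫ x, sesq (M x) (v x) (u x) ∂freq) :=
    integral_conj
  rw [avg, avg, star_mul', ← h]
  congr 1
  · simp
  · refine integral_congr_ae ?_
    filter_upwards [hM.posSemidef] with x hx using (star_sesq hx.1 _ _).symm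

/-- Both sides are sesquilinear in the pairs, so equality of the Gram matrices of the generators
extends to the span. Working with pairs avoids choosing a linear map from variables to
characteristics. -/
lemma integral_mul_star_eq_avg (hM : IsSpectralDensity M) (hX : ∀ i, MemLp (X i) 2 P)
    (hΦ : ∀ i, Measurable (Φ i)) (hΦi : ∀ i, Integrable (fun x => quad (M x) (Φ i x)) freq)
    (hgram : ∀ i j, ∫ ω, X i ω * star (X j ω) ∂P = avg fun x => sesq (M x) (Φ i x) (Φ j x))
    (hy : y ∈ specSpan X Φ) (hz : z ∈ specSpan X Φ) :
    ∫ ω, y.1 ω * star (z.1 ω) ∂P = avg fun x => sesq (M x) (y.2 x) (z.2 x) := by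
  have hint : ∀ {y z : (Ω → ℂ) × (ℝ → Fin T → ℂ)}, y ∈ specSpan X Φ → z ∈ specSpan X Φ →
      Integrable (fun x => sesq (M x) (y.2 x) (z.2 x)) freq := fun hy hz =>
    integrable_sesq hM.posSemidef hM.aemeasEntries (aemeasurable_of_mem_specSpan hΦ hy)
      (aemeasurable_of_mem_specSpan hΦ hz) (integrable_quad_of_mem_specSpan hM hΦ hΦi hy)
      (integrable_quad_of_mem_specSpan hM hΦ hΦi hz)
  have hgen : ∀ i, (X i, Φ i) ∈ specSpan X Φ := fun i => Submodule.subset_span ⟨i, rfl⟩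
  induction hy using Submodule.span_induction with
  | mem y h =>
    obtain ⟨i, rfl⟩ := h
    -- Conjugation brings the second argument into the first slot, where additivity is already
    -- available.
    rw [integral_star_mul_swap, avg_sesq_swap hM]
    congr 1
    induction hz using Submodule.span_induction with
    | mem z h =>
      obtain ⟨j, rfl⟩ := h
      exact hgram j i
    | zero => simp [avg]
    | add y z hy hz h1 h2 =>
      rw [Prod.fst_add, integral_mul_star_add_left (memLp_of_mem_specSpan hX hy)
        (memLp_of_mem_specSpan hX hz) (hX i), h1, h2, ← avg_add (hint hy (hgen i))
        (hint hz (hgen i))]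
      simp only [Prod.snd_add, Pi.add_apply, sesq_add_left]
    | smul c y _ h1 =>
      rw [Prod.smul_fst, integral_mul_star_smul_left, h1, ← avg_const_mul]
      simp only [Prod.smul_snd, Pi.smul_apply, sesq_smul_left]
  | zero => simp [avg]
  | add y y' hy hy' h1 h2 =>
    rw [Prod.fst_add, integral_mul_star_add_left (memLp_of_mem_specSpan hX hy)
      (memLp_of_mem_specSpan hX hy') (memLp_of_mem_specSpan hX hz), h1, h2,
      ← avg_add (hint hy hz) (hint hy' hz)]
    simp only [Prod.snd_add, Pi.add_apply, sesq_add_left]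
  | smul c y _ h1 =>
    rw [Prod.smul_fst, integral_mul_star_smul_left, h1, ← avg_const_mul]
    simp only [Prod.smul_snd, Pi.smul_apply, sesq_smul_left]

lemma integral_norm_sq_eq (hM : IsSpectralDensity M) (hX : ∀ i, MemLp (X i) 2 P)
    (hΦ : ∀ i, Measurable (Φ i)) (hΦi : ∀ i, Integrable (fun x => quad (M x) (Φ i x)) freq)
    (hgram : ∀ i j, ∫ ω, X i ω * star (X j ω) ∂P = avg fun x => sesq (M x) (Φ i x) (Φ j x))
    (hy : y ∈ specSpan X Φ) :
    ∫ ω, ‖y.1 ω‖ ^ 2 ∂P = 1 / (2 * Real.pi) * ∫ x, quad (M x) (y.2 x) ∂freq := by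
  have h1 := integral_mul_star_eq_avg hM hX hΦ hΦi hgram hy hy
  have h2 : ∀ ω, y.1 ω * star (y.1 ω) = ((‖y.1 ω‖ ^ 2 : ℝ) : ℂ) := fun ω => by
    rw [Complex.star_def, Complex.mul_conj, Complex.normSq_eq_norm_sq]
  have h3 : ∫ x, sesq (M x) (y.2 x) (y.2 x) ∂freq = ∫ x, ((quad (M x) (y.2 x) : ℝ) : ℂ) ∂freq := by
    refine integral_congr_ae ?_
    filter_upwards [hM.posSemidef] with x hx using sesq_self hx.1 _
  have h4 : ∫ ω, ((‖y.1 ω‖ ^ 2 : ℝ) : ℂ) ∂P = ((∫ ω, ‖y.1 ω‖ ^ 2 ∂P : ℝ) : ℂ) :=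
    integral_complex_ofReal
  have h5 : ∫ x, ((quad (M x) (y.2 x) : ℝ) : ℂ) ∂freq =
      ((∫ x, quad (M x) (y.2 x) ∂freq : ℝ) : ℂ) := integral_complex_ofReal
  simp only [h2] at h1
  rw [avg, h3, h4, h5] at h1
  exact_mod_cast h1

lemma enorm_sq_eq_ofReal (z : ℂ) : ‖z‖ₑ ^ 2 = ENNReal.ofReal (‖z‖ ^ 2) := by
  rw [ENNReal.ofReal_pow (norm_nonneg _), ofReal_norm]

lemma lintegral_enorm_sq_add {F G : Ω → ℂ} (hF : MemLp F 2 P) (hG : MemLp G 2 P)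
    (h0 : ∫ ω, F ω * star (G ω) ∂P = 0) :
    ∫⁻ ω, ‖F ω + G ω‖ₑ ^ 2 ∂P =
      ENNReal.ofReal (∫ ω, ‖F ω‖ ^ 2 ∂P + ∫ ω, ‖G ω‖ ^ 2 ∂P) := by
  have hFi := (memLp_two_iff_integrable_sq_norm hF.1).1 hF
  have hGi := (memLp_two_iff_integrable_sq_norm hG.1).1 hG
  have hFG : Integrable (fun ω => ‖F ω + G ω‖ ^ 2) P := (memLp_two_iff_integrable_sq_norm (hF.add hG).1).1 (hF.add hG)
  have hc : Integrable (fun ω => (F ω * star (G ω)).re) P := (integrable_mul_star hF hG).re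
  have hc0 : ∫ ω, (F ω * star (G ω)).re ∂P = 0 := by
    have h1 : ∫ ω, (F ω * star (G ω)).re ∂P = (∫ ω, F ω * star (G ω) ∂P).re :=
      integral_re (integrable_mul_star hF hG)
    rw [h1, h0, Complex.zero_re]
  simp only [enorm_sq_eq_ofReal]
  rw [← ofReal_integral_eq_lintegral_ofReal hFG (Filter.Eventually.of_forall fun ω => by positivity)]
  congr 1
  have h1 : ∀ ω, ‖F ω + G ω‖ ^ 2 = ‖F ω‖ ^ 2 + ‖G ω‖ ^ 2 + 2 * (F ω * star (G ω)).re := fun ω => by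
    rw [← Complex.normSq_eq_norm_sq, ← Complex.normSq_eq_norm_sq, ← Complex.normSq_eq_norm_sq,
      Complex.normSq_add, Complex.star_def]
  have h2 := integral_add (hFi.add hGi) (hc.const_mul 2)
  simp only [Pi.add_apply] at h2
  simp only [h1]
  rw [h2, integral_add hFi hGi, integral_const_mul, hc0]
  ring

end Isometry

/-! ### The mean-square error of an estimate -/

section Model

variable {Ω : Type*}

lemma incr_add (n : ℕ) (ξ η : ℤ → Fin T → Ω → ℂ) (m ν : ℤ) (p : Fin T) (ω : Ω) :
    incr n (ξ + η) m ν p ω = incr n ξ m ν p ω + incr n η m ν p ω := by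
  simp only [incr, Pi.add_apply, mul_add, Finset.sum_add_distrib]

lemma initFunctional_add (n μ N : ℕ) (a : ℕ → Fin T → ℂ) (ξ η : ℤ → Fin T → Ω → ℂ) (ω : Ω) :
    initFunctional n μ N a (ξ + η) ω =
      initFunctional n μ N a ξ ω + initFunctional n μ N a η ω := by
  simp only [initFunctional, Pi.add_apply, mul_add, Finset.sum_add_distrib]

/-- The finite combination `∑_k c(k)ᵀ ξ^{(n)}(k, μ)` of increments. -/
def finComb (n μ : ℕ) (ξ : ℤ → Fin T → Ω → ℂ) (c : ℤ →₀ (Fin T → ℂ)) (ω : Ω) : ℂ :=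
  c.sum fun k v => ∑ p, v p * incr n ξ k μ p ω

lemma finComb_add (n μ : ℕ) (ξ η : ℤ → Fin T → Ω → ℂ) (c : ℤ →₀ (Fin T → ℂ)) (ω : Ω) :
    finComb n μ (ξ + η) c ω = finComb n μ ξ c ω + finComb n μ η c ω := by
  simp only [finComb, Finsupp.sum, incr_add, mul_add, Finset.sum_add_distrib]

/-- The error of the estimate based on a finite combination splits into the contributions of the
signal and of the noise. -/
lemma error_finComb (n : ℕ) {μ : ℕ} (hμ : 0 < μ) (N : ℕ) (a : ℕ → Fin T → ℂ)
    (ξ η : ℤ → Fin T → Ω → ℂ) (c : ℤ →₀ (Fin T → ℂ)) (ω : Ω) :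
    functional N a ξ ω - (finComb n μ (ξ + η) c ω - initFunctional n μ N a (ξ + η) ω) =
      (∑ k ∈ Finset.range (N + 1), ∑ p, bCoeff n μ N a k p * incr n ξ k μ p ω -
        finComb n μ ξ c ω) +
      (∑ k ∈ Finset.range (N + 1), ∑ p, bCoeff n μ N a k p * incr n η k μ p ω -
        finComb n μ η c ω - functional N a η ω) := by
  rw [sum_bCoeff_mul_incr n hμ, sum_bCoeff_mul_incr n hμ, finComb_add, initFunctional_add]
  ring

/-- Linear combinations of `T`-dimensional families belong to the span. -/
lemma sum_mem_specSpan {ι : Type*} {X : ι → Ω → ℂ} {Φ : ι → ℝ → Fin T → ℂ}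
    {Z : ℤ → Fin T → Ω → ℂ} {φ : ℤ → ℝ → ℂ}
    (h : ∀ k p, (Z k p, fun x => φ k x • (Pi.single p 1 : Fin T → ℂ)) ∈ specSpan X Φ)
    {κ : Type*} (s : Finset κ) (e : κ → ℤ) (v : κ → Fin T → ℂ) :
    ((fun ω => ∑ k ∈ s, ∑ p, v k p * Z (e k) p ω), fun x => ∑ k ∈ s, φ (e k) x • v k) ∈
      specSpan X Φ := by
  have h1 : ((fun ω => ∑ k ∈ s, ∑ p, v k p * Z (e k) p ω), fun x => ∑ k ∈ s, φ (e k) x • v k) =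
      ∑ k ∈ s, ∑ p, v k p • ((Z (e k) p,
        fun x => φ (e k) x • (Pi.single p 1 : Fin T → ℂ)) : (Ω → ℂ) × (ℝ → Fin T → ℂ)) := by
    refine Prod.ext ?_ ?_
    · funext ω
      simp [Prod.fst_sum, Finset.sum_apply]
    · funext x
      simp only [Prod.snd_sum, Finset.sum_apply, Prod.smul_snd, Pi.smul_apply]
      refine Finset.sum_congr rfl fun k _ => ?_
      funext q
      simp only [Finset.sum_apply, Pi.smul_apply, smul_eq_mul]
      rw [Finset.sum_eq_single q]
      · simp [mul_comm]
      · intro b _ hb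
        simp [hb.symm]
      · simp
  rw [h1]
  exact Submodule.sum_mem _ fun k _ => Submodule.sum_mem _ fun p _ =>
    Submodule.smul_mem _ _ (h _ _)

variable {f g : ℝ → Matrix (Fin T) (Fin T) ℂ}

/-- The increments of the signal. -/
def signalFamily (n μ : ℕ) (ξ : ℤ → Fin T → Ω → ℂ) (i : ℤ × Fin T) : Ω → ℂ :=
  incr n ξ i.1 μ i.2

/-- The spectral characteristics of the increments of the signal. -/
def signalChar (n μ : ℕ) (i : ℤ × Fin T) (x : ℝ) : Fin T → ℂ :=
  (chi n μ x * ex i.1 x) • (Pi.single i.2 1 : Fin T → ℂ)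

/-- The values of the noise. -/
def noiseFamily (η : ℤ → Fin T → Ω → ℂ) (i : ℤ × Fin T) : Ω → ℂ := η i.1 i.2

/-- The spectral characteristics of the values of the noise. -/
def noiseChar (i : ℤ × Fin T) (x : ℝ) : Fin T → ℂ :=
  ex i.1 x • (Pi.single i.2 1 : Fin T → ℂ)

lemma measurable_signalChar (n μ : ℕ) (i : ℤ × Fin T) : Measurable (signalChar n μ i) := by
  unfold signalChar
  exact ((measurable_chi n μ).mul (measurable_ex i.1)).smul_const _

lemma measurable_noiseChar (i : ℤ × Fin T) : Measurable (noiseChar i) := by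
  unfold noiseChar
  exact (measurable_ex i.1).smul_const _

lemma norm_single_le_one (p q : Fin T) : ‖(Pi.single p 1 : Fin T → ℂ) q‖ ≤ 1 := by
  by_cases h : q = p
  · subst h; simp
  · simp [h]

lemma integrable_quad_signalChar (hf : IsSpectralDensity f) (n μ : ℕ) (i : ℤ × Fin T) :
    Integrable (fun x => quad (f x) (signalChar n μ i x)) freq := by
  refine integrable_quad_of_bounded hf.integrable (measurable_signalChar n μ i).aemeasurable
    (C := (μ : ℝ) ^ n) (Filter.Eventually.of_forall fun x q => ?_)
  rw [signalChar, Pi.smul_apply, smul_eq_mul, norm_mul, norm_mul, norm_ex, mul_one]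
  exact (mul_le_of_le_one_right (norm_nonneg _) (norm_single_le_one _ _)).trans (norm_chi_le n μ x)

lemma integrable_quad_noiseChar (hg : IsSpectralDensity g) (i : ℤ × Fin T) :
    Integrable (fun x => quad (g x) (noiseChar i x)) freq := by
  refine integrable_quad_of_bounded hg.integrable (measurable_noiseChar i).aemeasurable
    (C := 1) (Filter.Eventually.of_forall fun x q => ?_)
  rw [noiseChar, Pi.smul_apply, smul_eq_mul, norm_mul, norm_ex, one_mul]
  exact norm_single_le_one _ _

lemma chi_mul_star_chi (n μ : ℕ) (x : ℝ) : chi n μ x * star (chi n μ x) =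
    (1 - ex (-(μ : ℤ)) x) ^ n * (1 - ex (μ : ℤ) x) ^ n * (1 / (x : ℂ) ^ (2 * n)) := by
  have h : (Complex.I * (x : ℂ)) ^ n * (-Complex.I * (x : ℂ)) ^ n = (x : ℂ) ^ (2 * n) := by
    rw [← mul_pow, pow_mul]
    congr 1
    linear_combination (-(x : ℂ) ^ 2) * Complex.I_sq
  rw [star_chi, chi, div_mul_div_comm, h, mul_one_div]

/-- The noise itself is stationary, so its increments are finite combinations of its values and
their characteristics carry no denominator `(ix)^n`. -/
lemma incr_noise_mem (n μ : ℕ) (η : ℤ → Fin T → Ω → ℂ) (k : ℤ) (p : Fin T) :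
    (incr n η k μ p, fun x : ℝ => ((1 - ex (-(μ : ℤ)) x) ^ n * ex k x) •
      (Pi.single p 1 : Fin T → ℂ)) ∈ specSpan (noiseFamily η) noiseChar := by
  have h1 : (incr n η k μ p, fun x : ℝ => ((1 - ex (-(μ : ℤ)) x) ^ n * ex k x) •
      (Pi.single p 1 : Fin T → ℂ)) = ∑ l ∈ Finset.range (n + 1),
        ((-1 : ℂ) ^ l * (n.choose l : ℂ)) •
          (noiseFamily η (k - l * (μ : ℤ), p), noiseChar (k - l * (μ : ℤ), p)) := by
    refine Prod.ext ?_ ?_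
    · funext ω
      simp [Prod.fst_sum, Finset.sum_apply, incr, noiseFamily]
    · funext x
      simp only [Prod.snd_sum, Finset.sum_apply, Prod.smul_snd, Pi.smul_apply, noiseChar,
        smul_smul]
      rw [← Finset.sum_smul, one_sub_pow_eq_sum, Finset.sum_mul]
      congr 1
      refine Finset.sum_congr rfl fun l _ => ?_
      rw [← ex_mul_nat, mul_assoc, ← ex_add]
      congr 2
      ring
  rw [h1]
  exact Submodule.sum_mem _ fun l _ => Submodule.smul_mem _ _ (Submodule.subset_span ⟨_, rfl⟩)

lemma signal_error_mem (n μ N : ℕ) (a : ℕ → Fin T → ℂ) (ξ : ℤ → Fin T → Ω → ℂ)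
    (c : ℤ →₀ (Fin T → ℂ)) :
    ((fun ω => ∑ k ∈ Finset.range (N + 1), ∑ p, bCoeff n μ N a k p * incr n ξ k μ p ω -
        finComb n μ ξ c ω), residual n μ N a (finChar n μ c)) ∈
      specSpan (signalFamily n μ ξ) (signalChar (T := T) n μ) := by
  have hgen : ∀ k p, (incr n ξ k μ p, fun x => (chi n μ x * ex k x) •
      (Pi.single p 1 : Fin T → ℂ)) ∈ specSpan (signalFamily n μ ξ) (signalChar n μ) := fun k p =>
    Submodule.subset_span ⟨(k, p), rfl⟩
  have h := Submodule.sub_mem _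
    (sum_mem_specSpan hgen (Finset.range (N + 1)) (fun k => (k : ℤ)) (bCoeff n μ N a))
    (sum_mem_specSpan hgen c.support id c)
  convert h using 1
  refine Prod.ext rfl ?_
  funext x
  simp only [residual, poly, finChar, Finsupp.sum, Finset.smul_sum, smul_smul]
  rfl

lemma noise_error_mem (n μ N : ℕ) (a : ℕ → Fin T → ℂ) (η : ℤ → Fin T → Ω → ℂ)
    (c : ℤ →₀ (Fin T → ℂ)) :
    ((fun ω => ∑ k ∈ Finset.range (N + 1), ∑ p, bCoeff n μ N a k p * incr n η k μ p ω -
        finComb n μ η c ω - functional N a η ω),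
      fun x => (1 - ex (-(μ : ℤ)) x) ^ n • (poly N (bCoeff n μ N a) x -
        c.sum fun k v => ex k x • v) - poly N a x) ∈
      specSpan (noiseFamily η) noiseChar := by
  have hgen : ∀ k p, (η k p, fun x => ex k x • (Pi.single p 1 : Fin T → ℂ)) ∈
      specSpan (noiseFamily η) noiseChar := fun k p => Submodule.subset_span ⟨(k, p), rfl⟩
  have h := Submodule.sub_mem _ (Submodule.sub_mem _
    (sum_mem_specSpan (incr_noise_mem n μ η) (Finset.range (N + 1)) (fun k => (k : ℤ))
      (bCoeff n μ N a))
    (sum_mem_specSpan (incr_noise_mem n μ η) c.support id c))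
    (sum_mem_specSpan hgen (Finset.range (N + 1)) (fun k => (k : ℤ)) a)
  convert h using 1
  refine Prod.ext rfl ?_
  funext x
  simp only [poly, Finsupp.sum, smul_sub, Finset.smul_sum, smul_smul]
  rfl

/-- The factor `(ix)^n` in front of the noise term of `mse` removes the denominator of `χ`, and
produces the characteristic of the noise error with respect to the values of `η`. -/
lemma I_mul_pow_smul_residual {n μ N : ℕ} {a : ℕ → Fin T → ℂ} {x : ℝ} (hx : x ≠ 0)
    (c : ℤ →₀ (Fin T → ℂ)) :
    (Complex.I * (x : ℂ)) ^ n • residual n μ N a (finChar n μ c) x =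
      (1 - ex (-(μ : ℤ)) x) ^ n • (poly N (bCoeff n μ N a) x - c.sum fun k v => ex k x • v) := by
  have h : (Complex.I * (x : ℂ)) ^ n ≠ 0 := by simp [hx]
  rw [residual, finChar, ← smul_sub, smul_smul, chi, mul_div_cancel₀ _ h]

variable [MeasurableSpace Ω] {P : Measure Ω} {n : ℕ} {ξ η : ℤ → Fin T → Ω → ℂ}

lemma IsModel.gram_signal (hmod : IsModel n P ξ η f g) (μ : ℕ) (i j : ℤ × Fin T) :
    ∫ ω, signalFamily n μ ξ i ω * star (signalFamily n μ ξ j ω) ∂P =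
      avg fun x => sesq (f x) (signalChar n μ i x) (signalChar n μ j x) := by
  -- The covariance is taken at lag `i.1 - j.1` with both steps equal to `μ`, which makes the kernel
  -- `|χ|² f`.
  have h := hmod.cov_incr j.1 (i.1 - j.1) μ μ i.2 j.2
  rw [add_sub_cancel] at h
  refine h.trans ?_
  congr 1
  funext x
  rw [signalChar, signalChar, sesq_smul_left, sesq_smul_right, sesq_single, star_mul', star_ex,
    sub_eq_add_neg, ex_add]
  linear_combination (-(ex i.1 x * ex (-j.1) x * f x i.2 j.2)) * chi_mul_star_chi n μ x

lemma IsModel.gram_noise (hmod : IsModel n P ξ η f g) (i j : ℤ × Fin T) :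
    ∫ ω, noiseFamily η i ω * star (noiseFamily η j ω) ∂P =
      avg fun x => sesq (g x) (noiseChar i x) (noiseChar j x) := by
  have h := hmod.cov_noise j.1 (i.1 - j.1) i.2 j.2
  rw [add_sub_cancel] at h
  refine h.trans ?_
  congr 1
  funext x
  rw [noiseChar, noiseChar, sesq_smul_left, sesq_smul_right, sesq_single, star_ex,
    sub_eq_add_neg, ex_add]
  ring

/-- The mean-square error of the estimate based on a finite combination of increments. -/
lemma lintegral_error_finComb {μ N : ℕ} (hμ : 0 < μ) {a : ℕ → Fin T → ℂ}
    (hf : IsSpectralDensity f) (hg : IsSpectralDensity g) (hmod : IsModel n P ξ η f g)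
    (c : ℤ →₀ (Fin T → ℂ)) :
    ∫⁻ ω, ‖functional N a ξ ω -
      (finComb n μ (ξ + η) c ω - initFunctional n μ N a (ξ + η) ω)‖ₑ ^ 2 ∂P =
        mse n μ N a (finChar n μ c) f g := by
  have hs := signal_error_mem n μ N a ξ c
  have hn := noise_error_mem n μ N a η c
  have hX : ∀ i, MemLp (signalFamily n μ ξ i) 2 P := fun i => hmod.memLp_incr i.1 μ i.2
  have hX' : ∀ i, MemLp (noiseFamily η i) 2 P := fun i => hmod.memLp_noise i.1 i.2
  have h0 := integral_mul_star_eq_zero hX hX' (fun i j => hmod.uncorrelated i.1 μ j.1 i.2 j.2) hs hn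
  have hFi := integrable_quad_of_mem_specSpan hf (measurable_signalChar n μ)
    (integrable_quad_signalChar hf n μ) hs
  have hGi := integrable_quad_of_mem_specSpan hg measurable_noiseChar
    (integrable_quad_noiseChar hg) hn
  have h1 := lintegral_enorm_sq_add (memLp_of_mem_specSpan hX hs) (memLp_of_mem_specSpan hX' hn) h0
  rw [integral_norm_sq_eq hf hX (measurable_signalChar n μ) (integrable_quad_signalChar hf n μ)
      (hmod.gram_signal μ) hs,
    integral_norm_sq_eq hg hX' measurable_noiseChar (integrable_quad_noiseChar hg)
      hmod.gram_noise hn, ← mul_add, ← integral_add hFi hGi] at h1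
  rw [mse_eq_ofReal hf hg (measurable_finChar n μ c).aemeasurable
    (integrable_quad_finChar (hf.dens hg n) n μ c)]
  simp only [error_finComb n hμ]
  refine h1.trans ?_
  congr 2
  refine integral_congr_ae ?_
  filter_upwards [ae_regular hμ] with x hx
  rw [errDensity, I_mul_pow_smul_residual hx.1]

end Model

/-! ### Passage from finite combinations to arbitrary estimates. -/

section Limit

variable {n μ N : ℕ} {a : ℕ → Fin T → ℂ} {f g : ℝ → Matrix (Fin T) (Fin T) ℂ}

lemma norm_add_sq_le {s : ℝ} (hs : 0 < s) (z w : ℂ) :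
    ‖z + w‖ ^ 2 ≤ (1 + s) * ‖z‖ ^ 2 + (1 + s⁻¹) * ‖w‖ ^ 2 := by
  have h1 := pow_le_pow_left₀ (norm_nonneg _) (norm_add_le z w) 2
  have h2 : 0 ≤ s⁻¹ * (s * ‖z‖ - ‖w‖) ^ 2 := by positivity
  have h3 : s⁻¹ * (s * ‖z‖ - ‖w‖) ^ 2 = s * ‖z‖ ^ 2 - 2 * ‖z‖ * ‖w‖ + s⁻¹ * ‖w‖ ^ 2 := by
    field_simp
    ring
  nlinarith

lemma lintegral_enorm_sq_add_le {Ω : Type*} [MeasurableSpace Ω] {P : Measure Ω} {F G : Ω → ℂ}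
    (hF : AEMeasurable F P) {s : ℝ} (hs : 0 < s) :
    ∫⁻ ω, ‖F ω + G ω‖ₑ ^ 2 ∂P ≤ ENNReal.ofReal (1 + s) * ∫⁻ ω, ‖F ω‖ₑ ^ 2 ∂P +
      ENNReal.ofReal (1 + s⁻¹) * ∫⁻ ω, ‖G ω‖ₑ ^ 2 ∂P := by
  rw [← lintegral_const_mul' _ _ ENNReal.ofReal_ne_top,
    ← lintegral_const_mul' _ _ ENNReal.ofReal_ne_top,
    ← lintegral_add_left' ((hF.enorm.pow_const 2).const_mul _)]
  refine lintegral_mono fun ω => ?_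
  have h1 : (0 : ℝ) ≤ 1 + s := by positivity
  have h2 : (0 : ℝ) ≤ 1 + s⁻¹ := by positivity
  rw [enorm_sq_eq_ofReal, enorm_sq_eq_ofReal, enorm_sq_eq_ofReal, ← ENNReal.ofReal_mul h1,
    ← ENNReal.ofReal_mul h2, ← ENNReal.ofReal_add (by positivity) (by positivity)]
  exact ENNReal.ofReal_le_ofReal (norm_add_sq_le hs _ _)

/-- Replacing `h` by `k` shifts both terms of the error by the same function, up to `(ix)^n`; the
`f`-form plus `x^{2n}` times the `g`-form of that shift is the `p`-form. -/
lemma mse_le_mul_add (hf : IsSpectralDensity f) (hg : IsSpectralDensity g)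
    {h k : ℝ → Fin T → ℂ} (hh : AEMeasurable h freq) (hk : AEMeasurable k freq) {s : ℝ}
    (hs : 0 < s) : mse n μ N a h f g ≤ ENNReal.ofReal (1 + s) * mse n μ N a k f g +
      ENNReal.ofReal (1 + s⁻¹) *
        (ENNReal.ofReal (1 / (2 * Real.pi)) * sqNorm (dens n f g) (h - k)) := by
  have hp := hf.dens hg n
  have hE := aemeasurable_errDensity (n := n) (N := N) (a := a) hf hg
    (aemeasurable_residual (n := n) (μ := μ) (N := N) (a := a) hk)
  have h1 : (0 : ℝ) ≤ 1 + s := by positivity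
  have h2 : (0 : ℝ) ≤ 1 + s⁻¹ := by positivity
  rw [mse_eq_lavg hf hg hh, mse_eq_lavg hf hg hk, lavg, lavg, sqNorm, mul_left_comm,
    mul_left_comm (ENNReal.ofReal (1 + s⁻¹)), ← mul_add]
  gcongr
  rw [← lintegral_const_mul' _ _ ENNReal.ofReal_ne_top,
    ← lintegral_const_mul' _ _ ENNReal.ofReal_ne_top,
    ← lintegral_add_left' (hE.ennreal_ofReal.const_mul _)]
  refine lintegral_mono_ae ?_
  filter_upwards [hf.posSemidef, hg.posSemidef, hp.posSemidef] with x h3 h4 h5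
  rw [← ENNReal.ofReal_mul h1, ← ENNReal.ofReal_mul h2, ← ENNReal.ofReal_add
    (mul_nonneg h1 (errDensity_nonneg h3 h4)) (mul_nonneg h2 (quad_nonneg h5 _))]
  refine ENNReal.ofReal_le_ofReal ?_
  have h6 : residual n μ N a h x = residual n μ N a k x + -(h x - k x) := by
    simp only [residual]
    abel
  have h7 : (Complex.I * (x : ℂ)) ^ n • residual n μ N a h x - poly N a x =
      ((Complex.I * (x : ℂ)) ^ n • residual n μ N a k x - poly N a x) +
        (Complex.I * (x : ℂ)) ^ n • -(h x - k x) := by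
    rw [h6, smul_add]
    abel
  rw [errDensity, h7, h6, errDensity, Pi.sub_apply, quad_dens]
  have h8 := quad_add_le h3 hs (residual n μ N a k x) (-(h x - k x))
  have h9 := quad_add_le h4 hs ((Complex.I * (x : ℂ)) ^ n • residual n μ N a k x - poly N a x)
    ((Complex.I * (x : ℂ)) ^ n • -(h x - k x))
  rw [quad_smul, norm_I_mul_pow_sq, quad_neg] at h9
  rw [quad_neg] at h8
  nlinarith

/-- First `ε → 0`, which needs `C` finite, then `s → 0`. The intermediate `Z` is the error of a
finite combination; infinite values of `A` and `B` are allowed. -/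
lemma le_of_forall_approx {A B C : ENNReal} (hC : C ≠ ⊤)
    (h : ∀ s : ℝ, 0 < s → ∀ ε : ENNReal, 0 < ε → ∃ Z,
      A ≤ ENNReal.ofReal (1 + s) * Z + ENNReal.ofReal (1 + s⁻¹) * (C * ε) ∧
      Z ≤ ENNReal.ofReal (1 + s) * B + ENNReal.ofReal (1 + s⁻¹) * (C * ε)) : A ≤ B := by
  have h1 : ∀ s : ℝ, 0 < s → A ≤ ENNReal.ofReal (1 + s) * (ENNReal.ofReal (1 + s) * B) := by
    intro s hs
    set α := ENNReal.ofReal (1 + s) with hα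
    set β := ENNReal.ofReal (1 + s⁻¹) with hβ
    have hD : (α * β + β) * C ≠ ⊤ := by
      simp [hα, hβ, ENNReal.mul_eq_top, hC]
    have hlim : Filter.Tendsto (fun k : ℕ => α * (α * B) + (α * β + β) * C * (k : ENNReal)⁻¹)
        Filter.atTop (nhds (α * (α * B))) := by
      have := ENNReal.Tendsto.const_mul ENNReal.tendsto_inv_nat_nhds_zero
        (Or.inr hD)
      simpa using tendsto_const_nhds.add this
    refine ge_of_tendsto' hlim fun k => ?_
    -- At `k = 0` the accuracy is infinite, which is harmless: positivity is all that is required.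
    obtain ⟨Z, hZ, hZ'⟩ := h s hs (k : ENNReal)⁻¹ (by simp)
    refine hZ.trans ((add_le_add_left (mul_le_mul_right hZ' α) _).trans (le_of_eq ?_))
    ring
  by_cases hB : B = ⊤
  · rw [hB]; exact le_top
  have hlim : Filter.Tendsto (fun k : ℕ => ENNReal.ofReal (1 + 1 / ((k : ℝ) + 1)) *
      (ENNReal.ofReal (1 + 1 / ((k : ℝ) + 1)) * B)) Filter.atTop (nhds B) := by
    have h2 : Filter.Tendsto (fun k : ℕ => ENNReal.ofReal (1 + 1 / ((k : ℝ) + 1))) Filter.atTop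
        (nhds 1) := by
      have := ENNReal.tendsto_ofReal
        ((tendsto_one_div_add_atTop_nhds_zero_nat (𝕜 := ℝ)).const_add 1)
      simpa using this
    have h3 := ENNReal.Tendsto.mul_const (b := B) h2 (Or.inr hB)
    have h4 := ENNReal.Tendsto.mul h2 (Or.inl one_ne_zero) h3 (Or.inr ENNReal.one_ne_top)
    simpa using h4
  exact ge_of_tendsto' hlim fun k => h1 _ (by positivity)

/-- The mean-square error of an estimate with a given spectral characteristic. -/
theorem lintegral_error_eq_mse {Ω : Type*} [MeasurableSpace Ω] {P : Measure Ω}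
    {ξ η : ℤ → Fin T → Ω → ℂ} (hμ : 0 < μ) (hf : IsSpectralDensity f) (hg : IsSpectralDensity g)
    (hmod : IsModel n P ξ η f g) {h : ℝ → Fin T → ℂ} {Y : Ω → ℂ}
    (hY : HasChar n μ N P (ξ + η) f g h Y) :
    ∫⁻ ω, ‖functional N a ξ ω - (Y ω - initFunctional n μ N a (ξ + η) ω)‖ₑ ^ 2 ∂P =
      mse n μ N a h f g := by
  obtain ⟨hh, hYm, happ⟩ := hY
  have hζ : ∀ m p, AEMeasurable ((ξ + η) m p) P := fun m p =>
    (hmod.aemeasurable m p).add (hmod.memLp_noise m p).1.aemeasurable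
  have hfun : AEMeasurable (functional N a ξ) P :=
    Finset.aemeasurable_fun_sum _ fun k _ => Finset.aemeasurable_fun_sum _ fun p _ =>
      (hmod.aemeasurable k p).const_mul _
  have hinit : AEMeasurable (initFunctional n μ N a (ξ + η)) P :=
    Finset.aemeasurable_fun_sum _ fun k _ => Finset.aemeasurable_fun_sum _ fun p _ =>
      (hζ _ p).const_mul _
  have hcomb : ∀ c, AEMeasurable (finComb n μ (ξ + η) c) P := fun c =>
    Finset.aemeasurable_fun_sum _ fun k _ => Finset.aemeasurable_fun_sum _ fun p _ =>
      (Finset.aemeasurable_fun_sum _ fun l _ => (hζ _ p).const_mul _).const_mul _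
  set κ := ENNReal.ofReal (1 / (2 * Real.pi)) with hκ
  -- One constant serves both approximations: the random variables carry the factor `1`, the
  -- spectral norms the factor `κ`.
  set C := max 1 κ with hC
  have hCtop : C ≠ ⊤ := by simp [hC, hκ]
  have happ' : ∀ ε : ENNReal, 0 < ε → ∃ c : ℤ →₀ (Fin T → ℂ),
      κ * sqNorm (dens n f g) (h - finChar n μ c) ≤ C * ε ∧
      κ * sqNorm (dens n f g) (finChar n μ c - h) ≤ C * ε ∧
      ∫⁻ ω, ‖Y ω - finComb n μ (ξ + η) c ω‖ₑ ^ 2 ∂P ≤ C * ε ∧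
      ∫⁻ ω, ‖finComb n μ (ξ + η) c ω - Y ω‖ₑ ^ 2 ∂P ≤ C * ε := by
    intro ε hε
    obtain ⟨c, -, h1, h2⟩ := happ ε hε
    have h3 : sqNorm (dens n f g) (finChar n μ c - h) =
        sqNorm (dens n f g) (h - finChar n μ c) := by
      rw [← neg_sub]
      simp only [sqNorm, Pi.neg_apply, quad_neg]
    have h4 : ∫⁻ ω, ‖Y ω - finComb n μ (ξ + η) c ω‖ₑ ^ 2 ∂P ≤ C * ε :=
      h2.le.trans (le_mul_of_one_le_left zero_le (le_max_left _ _))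
    have h5 : κ * sqNorm (dens n f g) (h - finChar n μ c) ≤ C * ε :=
      mul_le_mul' (le_max_right _ _) h1.le
    refine ⟨c, h5, by rwa [h3], h4, ?_⟩
    simp only [enorm_sub_rev (finComb n μ (ξ + η) c _)]
    exact h4
  -- In each direction a common finite combination links the estimate with its characteristic, since
  -- its own error is known exactly on both sides.
  refine le_antisymm (le_of_forall_approx hCtop fun s hs ε hε => ?_)
    (le_of_forall_approx hCtop fun s hs ε hε => ?_)
  · obtain ⟨c, h1, h2, h3, h4⟩ := happ' ε hε
    refine ⟨mse n μ N a (finChar n μ c) f g, ?_,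
      (mse_le_mul_add hf hg (measurable_finChar n μ c).aemeasurable hh hs).trans ?_⟩
    · rw [← lintegral_error_finComb hμ hf hg hmod c]
      refine le_trans (le_of_eq ?_) ((lintegral_enorm_sq_add_le
        (F := fun ω => functional N a ξ ω -
          (finComb n μ (ξ + η) c ω - initFunctional n μ N a (ξ + η) ω))
        (G := fun ω => finComb n μ (ξ + η) c ω - Y ω)
        (hfun.sub ((hcomb c).sub hinit)) hs).trans ?_)
      · refine lintegral_congr fun ω => ?_
        congr 2
        ring
      · gcongr
    · gcongr
  · obtain ⟨c, h1, h2, h3, h4⟩ := happ' ε hε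
    refine ⟨mse n μ N a (finChar n μ c) f g,
      (mse_le_mul_add hf hg hh (measurable_finChar n μ c).aemeasurable hs).trans ?_, ?_⟩
    · gcongr
    · rw [← lintegral_error_finComb hμ hf hg hmod c]
      refine le_trans (le_of_eq ?_) ((lintegral_enorm_sq_add_le
        (F := fun ω => functional N a ξ ω - (Y ω - initFunctional n μ N a (ξ + η) ω))
        (G := fun ω => Y ω - finComb n μ (ξ + η) c ω)
        (hfun.sub (hYm.sub hinit)) hs).trans ?_)
      · refine lintegral_congr fun ω => ?_
        congr 2
        ring
      · gcongr

end Limit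

end PeriodicIncrements

end

theorem lemma4p1 {T : ℕ} (n μ N : ℕ) (hμ : 0 < μ) (a : ℕ → Fin T → ℂ)
    (Df Dg : Set (ℝ → Matrix (Fin T) (Fin T) ℂ))
    (hDf : ∀ f ∈ Df, PeriodicIncrements.IsSpectralDensity f)
    (hDg : ∀ g ∈ Dg, PeriodicIncrements.IsSpectralDensity g)
    (f₀ g₀ : ℝ → Matrix (Fin T) (Fin T) ℂ) (hf₀ : f₀ ∈ Df) (hg₀ : g₀ ∈ Dg)
    (hmin : PeriodicIncrements.Minimality n μ f₀ g₀)
    (hmax : ∀ f ∈ Df, ∀ g ∈ Dg, PeriodicIncrements.Minimality n μ f g →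
      PeriodicIncrements.errorExpr n μ N a f g ≤ PeriodicIncrements.errorExpr n μ N a f₀ g₀) :
    -- `mse` is the mean-square error of the estimates of the functional `∑ a(k)ᵀ ξ(k)`
    (∀ f ∈ Df, ∀ g ∈ Dg, ∀ (Ω : Type) [MeasurableSpace Ω] (P : MeasureTheory.Measure Ω)
      [MeasureTheory.IsProbabilityMeasure P] (ξ η : ℤ → Fin T → Ω → ℂ),
      PeriodicIncrements.IsModel n P ξ η f g → ∀ (h : ℝ → Fin T → ℂ) (Y : Ω → ℂ),
      PeriodicIncrements.HasChar n μ N P (ξ + η) f g h Y →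
      ∫⁻ ω, ‖PeriodicIncrements.functional N a ξ ω -
          (Y ω - PeriodicIncrements.initFunctional n μ N a (ξ + η) ω)‖ₑ ^ 2 ∂P =
        PeriodicIncrements.mse n μ N a h f g) ∧
    -- the explicit formula gives the optimal characteristic for `(f₀, g₀)`
    PeriodicIncrements.IsOptimal n μ N a f₀ g₀ (PeriodicIncrements.specChar n μ N a f₀ g₀) ∧
    -- least favorable densities
    (((∀ f ∈ Df, ∀ g ∈ Dg, PeriodicIncrements.Minimality n μ f g) ∨
        (Convex ℝ Df ∧ Convex ℝ Dg)) →
      PeriodicIncrements.LeastFavorable n μ N a Df Dg f₀ g₀) ∧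
    -- minimax-robust spectral characteristic
    (Convex ℝ Df → Convex ℝ Dg →
      PeriodicIncrements.specChar n μ N a f₀ g₀ ∈ PeriodicIncrements.robustSpace n μ N Df Dg →
      PeriodicIncrements.MinimaxRobust n μ N a Df Dg
        (PeriodicIncrements.specChar n μ N a f₀ g₀)) := by
  refine ⟨fun f hf g hg Ω _ P _ ξ η hmod h Y hY =>
    PeriodicIncrements.lintegral_error_eq_mse hμ (hDf f hf) (hDg g hg) hmod hY,
    PeriodicIncrements.isOptimal_specChar hμ (hDf f₀ hf₀) (hDg g₀ hg₀) hmin,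
    PeriodicIncrements.leastFavorable_of_isMax hμ hDf hDg hf₀ hg₀ hmin hmax,
    fun hcf hcg hrob => PeriodicIncrements.minimaxRobust_specChar hμ hDf hDg hf₀ hg₀ hmin hmax
      hcf hcg hrob⟩
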